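/- Notation. For $\beta\ge 0$, $a,a'>0$ let $\mathfrak A_\beta(a,a')$ be the class of functions $f(z)=\sum_{n\ge0}\hat f(n)z^n$ analytic in the unit disc $\mathbb D$, smooth up to the boundary, with $$|\hat f(n)|\le a'\exp\bigl(-a\,n^{(1+\beta)/(2+\beta)}\bigr),\qquad n\ge 0 .$$ For $d,d'>0$ let $\mathfrak C_\beta(d,d')$ be the class of planar Cauchy transforms $$f(z)=\frac1\pi\int_{\mathbb C}\frac{\varphi(\zeta)}{z-\zeta}\,dm_2(\zeta),\qquad z\in\overline{\mathbb D},$$ of measurable functions $\varphi$ that vanish off $\{1\le|z|<2\}$ and satisfy $|\varphi(z)|\le d'\exp\bigl(-(d(|z|-1))^{-(1+\beta)}\bigr)$ for $1<|z|<2$; here $m_2$ is planar Lebesgue measure. For $K\ge1$ let $\mathfrak A_\beta^K$ (resp. $\mathfrak C_\beta^K$) be the union of $\mathfrak A_\beta(a,a')$ (resp. $\mathfrak C_\beta(a,a')$) over $a,a'\in[K^{-1},K]$. Let $N_f$ be the number of zeros of $f$ in the closed disc $\overline{\mathbb D}$, counted with multiplicity (at every point $z$ of $\overline{\mathbb D}$,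 the multiplicity is the least $k\ge 0$ with $f^{(k)}(z)\ne0$, and $\infty$ if there is no such $k$). Theorem. Let $K\ge 1$. (0) For every $\beta_0>0$ there is $K'\ge1$, depending only on $\beta_0$ and $K$, such that $\mathfrak A_\beta^K\subset\mathfrak C_\beta^{K'}$ and $\mathfrak C_\beta^K\subset\mathfrak A_\beta^{K'}$ for all $0\le\beta\le\beta_0$. (a) There is $c>0$, depending only on $K$, such that if $f\in\mathfrak A_0^K\cup\mathfrak C_0^K$ and $|f(0)|\ge e^{-A}$ with $A\ge1$, then $N_f\le\exp(c\sqrt A)$. (b) For every $\beta_0>0$ there is $c>0$, depending only on $\beta_0$ and $K$, such that if $0<\beta\le\beta_0$, $f\in\mathfrak A_\beta^K\cup\mathfrak C_\beta^K$ and $|f(0)|\ge e^{-A}$ with $A\ge1$, then $$N_f\le\begin{cases}\exp(c\sqrt A), & A\le\beta^{-2},\\ A^{2/\beta+1}\,\beta^{4/\beta+2}\,e^{c/\beta}, & \beta^{-2}\le A\le\beta^{-4},\\ A^{1/\beta+1}\,e^{c/\beta}, & A\ge\beta^{-4}.\end{cases}$$ -/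

import Mathlib

open scoped ContDiff

noncomputable section

namespace Gevrey

/-- The closed unit disc. -/
def closedDisc : Set ℂ := Metric.closedBall (0 : ℂ) 1

/-- The `n`-th Taylor coefficient of `f` at the origin. -/
def taylorCoeff (f : ℂ → ℂ) (n : ℕ) : ℂ := iteratedDeriv n f 0 / (n.factorial : ℂ)

/-- `f` is analytic in the open unit disc, (complex) smooth up to the boundary, and its Taylor
coefficients are bounded by `a' * exp (-a * n ^ ((1 + β) / (2 + β)))`. -/
structure ClassA (β a a' : ℝ) (f : ℂ → ℂ) : Prop where
  analytic : AnalyticOnNhd ℂ f (Metric.ball (0 : ℂ) 1)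
  smooth : ContDiffOn ℂ ∞ f closedDisc
  coeff_le : ∀ n : ℕ,
    ‖taylorCoeff f n‖ ≤ a' * Real.exp (-(a * (n : ℝ) ^ ((1 + β) / (2 + β))))

/-- The weight `ρ_β(x) = exp (-1 / x ^ (1 + β))`, used for `x > 0`. -/
def rho (β x : ℝ) : ℝ := Real.exp (-(1 / x ^ (1 + β)))

/-- On the closed unit disc, `f` is the planar Cauchy transform of a function `φ` that vanishes
off the annulus `1 ≤ |z| < 2` and satisfies `|φ z| ≤ d' * ρ_β (d * (|z| - 1))`
for `1 < |z| < 2`. -/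
def ClassC (β d d' : ℝ) (f : ℂ → ℂ) : Prop :=
  ∃ φ : ℂ → ℂ, Measurable φ ∧
    (∀ z : ℂ, ¬ (1 ≤ ‖z‖ ∧ ‖z‖ < 2) → φ z = 0) ∧
    (∀ z : ℂ, 1 < ‖z‖ → ‖z‖ < 2 → ‖φ z‖ ≤ d' * rho β (d * (‖z‖ - 1))) ∧
    ∀ z ∈ closedDisc, f z = (1 / (Real.pi : ℂ)) * ∫ ζ : ℂ, φ ζ / (z - ζ)

/-- Membership in `ClassA` with both parameters comparable to `1`, with comparison constant `K`. -/
def ClassAComparable (K β : ℝ) (f : ℂ → ℂ) : Prop :=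
  ∃ a ∈ Set.Icc K⁻¹ K, ∃ a' ∈ Set.Icc K⁻¹ K, ClassA β a a' f

/-- Membership in `ClassC` with both parameters comparable to `1`, with comparison constant `K`. -/
def ClassCComparable (K β : ℝ) (f : ℂ → ℂ) : Prop :=
  ∃ d ∈ Set.Icc K⁻¹ K, ∃ d' ∈ Set.Icc K⁻¹ K, ClassC β d d' f

/-- The order of vanishing at `z` of a function smooth on the closed unit disc: the least `k` such
that the `k`-th derivative (relative to the closed disc) does not vanish at `z`, and `⊤` if all
of them vanish. It is `0` where `f z ≠ 0`. -/
def zeroMult (f : ℂ → ℂ) (z : ℂ) : ℕ∞ :=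
  ⨅ (k : ℕ) (_ : iteratedDerivWithin k f closedDisc z ≠ 0), (k : ℕ∞)

/-- The number of zeros of `f` in the closed unit disc, counted with multiplicity (`∞` if there are
infinitely many of them). -/
def zeroCount (f : ℂ → ℂ) : ENNReal :=
  ∑' z : closedDisc, ((zeroMult f z : ℕ∞) : ENNReal)

end Gevrey

end

/-! Both classes describe power series whose coefficients decay like exp(-n^s), s = (1+β)/(2+β). The
weight ρ_β(x) times (1+x)^(-n) is largest near x = n^(-1/(2+β)), where it equals exp(-n^s) up to
constants in the exponent (`rho_mul_pow_le`). Conversely c_n z^n is the Cauchy transform of a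
multiple of ζ^(n+1) on an annulus at that distance from the circle, and these densities can be added
(`norm_density_le`).

For the zeros, let L = log(1/|f|) on the circle, with f divided by a common bound of the class and
replaced by a long partial sum, so that L is nonnegative and integrable. Let m(ρ) be its integral
over an arc of half-length ρ. Since |f(0)| ≥ e^(-A), every m(ρ) is O(A).

Crowding: dividing out n zeros costs the n-th binomial moment of the coefficients, at most (C
n^(1/(1+β)))^n up to a constant factor. Hence n zeros within r of a boundary point make f of size
e^(-n) near it, as long as n ≤ (Cr)^(-(1+β)) (`Decay.norm_psum_le_exp`). A point with more zeros
than this threshold therefore forces m(r) ≥ c r^(-β).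

Propagation: by Poisson–Jensen, the mass m(ρ) makes f of size exp(-c h m/ρ²) at depth h ≤ ρ below
the doubled arc. A partial sum of length about h^(-(2+β)) stays bounded up to distance h outside the
disc and differs from f by exp(-c h^(-(1+β))) inside, so the maximum principle carries the smallness
to the circle (`Decay.norm_part_boundary_le`). Balancing the two exponents gives L ≥ c (m/ρ²)^s on
the doubled arc, that is, m(2ρ)^(1/(2+β)) ≥ m(ρ)^(1/(2+β)) + c ρ^(-β/(2+β))
(`Decay.mass_rpow_two_mul`).

Summed over J dyadic scales, this contradicts m = O(A) once ∑_{i ≤ J} 2^(iβ/(2+β)) exceeds C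
A^(1/(2+β)). For such J, no point of the circle is crowded at scale r = ρ₀ 2^(-J), so L is at least
the number of zeros within r, minus one, almost everywhere. Integration bounds the zeros near the
circle by C A/r, and Jensen's inequality bounds the others (`Decay.card_le`). Thus N_f ≤ C A 2^J
with the least admissible J. For β = 0 the sum is J itself, whence J is of order √A; for β > 0 it is
geometric, which yields the powers of A and β. -/

namespace Gevrey

/-! ### Power series with rapidly decaying coefficients on the closed disc -/

/-- The sum of the power series with coefficients `c`. -/
noncomputable def psum (c : ℕ → ℂ) (z : ℂ) : ℂ := ∑' n, c n * z ^ n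

/-- The binomial moments of a sequence of coefficients. -/
noncomputable def moment (m : ℕ) (c : ℕ → ℂ) : ENNReal := ∑' k, (k.choose m : ENNReal) * ‖c k‖ₑ

/-- All binomial moments of the coefficients are finite. -/
def Rapid (c : ℕ → ℂ) : Prop := ∀ m, moment m c ≠ ⊤

/-- The coefficients of the derivative. -/
noncomputable def derivCoeff (c : ℕ → ℂ) (n : ℕ) : ℂ := (n + 1) * c (n + 1)

/-- The coefficients of the difference quotient `(f z - f a) / (z - a)`. -/
noncomputable def quotCoeff (a : ℂ) (c : ℕ → ℂ) (i : ℕ) : ℂ := ∑' j, c (i + 1 + j) * a ^ j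

lemma mem_closedDisc {z : ℂ} : z ∈ closedDisc ↔ ‖z‖ ≤ 1 := by simp [closedDisc]

lemma uniqueDiffOn_closedDisc : UniqueDiffOn ℂ closedDisc := by
  apply uniqueDiffOn_convex_of_isRCLikeNormedField (𝕜 := ℂ)
  · exact convex_closedBall 0 1
  · rw [closedDisc, interior_closedBall _ one_ne_zero]
    exact ⟨0, by simp⟩

lemma summable_choose_mul {c : ℕ → ℂ} (hc : Rapid c) (m : ℕ) :
    Summable fun k => (k.choose m : ℝ) * ‖c k‖ := by
  have h := ENNReal.summable_toReal (hc m)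
  refine h.congr fun k => ?_
  simp [ENNReal.toReal_mul]

lemma Rapid.summable_norm {c : ℕ → ℂ} (hc : Rapid c) : Summable fun k => ‖c k‖ := by
  simpa using summable_choose_mul hc 0

lemma norm_mul_pow_le (c : ℕ → ℂ) {z : ℂ} (hz : ‖z‖ ≤ 1) (n : ℕ) : ‖c n * z ^ n‖ ≤ ‖c n‖ := by
  rw [norm_mul, norm_pow]
  exact mul_le_of_le_one_right (norm_nonneg _) (pow_le_one₀ (norm_nonneg _) hz)

lemma Rapid.summable {c : ℕ → ℂ} (hc : Rapid c) {z : ℂ} (hz : ‖z‖ ≤ 1) :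
    Summable fun n => c n * z ^ n :=
  .of_norm_bounded hc.summable_norm fun n => norm_mul_pow_le c hz n

lemma Rapid.norm_psum_le {c : ℕ → ℂ} (hc : Rapid c) {z : ℂ} (hz : ‖z‖ ≤ 1) :
    ‖psum c z‖ ≤ (moment 0 c).toReal := by
  have h1 : (moment 0 c).toReal = ∑' k, ‖c k‖ := by
    rw [moment, ENNReal.tsum_toReal_eq (fun k => ?_)]
    · simp
    · simp
  rw [h1]
  exact tsum_of_norm_bounded hc.summable_norm.hasSum fun n => norm_mul_pow_le c hz n

lemma Rapid.continuousOn_psum {c : ℕ → ℂ} (hc : Rapid c) : ContinuousOn (psum c) closedDisc := by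
  apply continuousOn_tsum (u := fun n => ‖c n‖)
  · intro n
    fun_prop
  · exact hc.summable_norm
  · intro n z hz
    exact norm_mul_pow_le c (mem_closedDisc.1 hz) n

lemma moment_derivCoeff_le (m : ℕ) (c : ℕ → ℂ) :
    moment m (derivCoeff c) ≤ (m + 1 : ENNReal) * moment (m + 1) c := by
  rw [moment, moment, ← ENNReal.tsum_mul_left]
  calc ∑' k, (k.choose m : ENNReal) * ‖derivCoeff c k‖ₑ
      = ∑' k, (m + 1 : ENNReal) * (((k + 1).choose (m + 1) : ENNReal) * ‖c (k + 1)‖ₑ) := by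
        refine tsum_congr fun k => ?_
        have h1 : ‖((k : ℂ) + 1)‖ₑ = ((k + 1 : ℕ) : ENNReal) := by
          rw [← ofReal_norm]
          have : ‖((k : ℂ) + 1)‖ = ((k + 1 : ℕ) : ℝ) := by
            rw [← Nat.cast_succ, Complex.norm_natCast]
          rw [this, ENNReal.ofReal_natCast]
        rw [derivCoeff, enorm_mul, h1, ← mul_assoc, ← mul_assoc]
        congr 1
        have h2 := Nat.add_one_mul_choose_eq k m
        have h3 : ((k.choose m * (k + 1) : ℕ) : ENNReal)
            = (((m + 1) * (k + 1).choose (m + 1) : ℕ) : ENNReal) := by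
          congr 1
          linarith
        exact_mod_cast h3
    _ ≤ _ := by
        exact ENNReal.tsum_comp_le_tsum_of_injective (add_left_injective 1)
          (fun k => (m + 1 : ENNReal) * ((k.choose (m + 1) : ENNReal) * ‖c k‖ₑ))

lemma Rapid.derivCoeff {c : ℕ → ℂ} (hc : Rapid c) : Rapid (derivCoeff c) := fun m =>
  ne_top_of_le_ne_top (ENNReal.mul_ne_top (by simp) (hc (m + 1))) (moment_derivCoeff_le m c)

/-- Induction on n: passing to the next power multiplies the error by `w` and adds a term of size
(n+1)|w-z|², and these add up to a binomial coefficient. The bound is uniform up to the boundary. -/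
lemma norm_pow_sub_linear_le {w z : ℂ} (hw : ‖w‖ ≤ 1) (hz : ‖z‖ ≤ 1) (n : ℕ) :
    ‖w ^ (n + 1) - z ^ (n + 1) - (n + 1) * z ^ n * (w - z)‖
      ≤ ((n + 1).choose 2 : ℝ) * ‖w - z‖ ^ 2 := by
  induction n with
  | zero => simp
  | succ n ih =>
    have h : w ^ (n + 1 + 1) - z ^ (n + 1 + 1) - ((n + 1 : ℕ) + 1) * z ^ (n + 1) * (w - z)
        = w * (w ^ (n + 1) - z ^ (n + 1) - (n + 1) * z ^ n * (w - z))
          + (n + 1) * z ^ n * (w - z) ^ 2 := by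
      push_cast; ring
    rw [h]
    have h1 : ‖w * (w ^ (n + 1) - z ^ (n + 1) - (n + 1) * z ^ n * (w - z))‖
        ≤ ((n + 1).choose 2 : ℝ) * ‖w - z‖ ^ 2 := by
      rw [norm_mul]
      exact (mul_le_of_le_one_left (norm_nonneg _) hw).trans ih
    have h2 : ‖((n : ℂ) + 1) * z ^ n * (w - z) ^ 2‖ ≤ (n + 1) * ‖w - z‖ ^ 2 := by
      rw [norm_mul, norm_mul, norm_pow, norm_pow]
      have h3 : ‖(n : ℂ) + 1‖ = n + 1 := by
        rw [← Nat.cast_succ, Complex.norm_natCast]; push_cast; ring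
      rw [h3]
      have : ‖z‖ ^ n ≤ 1 := pow_le_one₀ (norm_nonneg _) hz
      gcongr
      nlinarith
    have h4 : ((n + 1 + 1).choose 2 : ℝ) = (n + 1) + (n + 1).choose 2 := by
      rw [Nat.choose_succ_succ' (n + 1) 1]; simp
    rw [h4]
    calc _ ≤ _ := norm_add_le _ _
      _ ≤ _ := by linarith

/-- The quadratic Taylor errors of the monomials sum to at most the second binomial moment times
|w-z|². Termwise differentiation is thereby justified at boundary points too. -/
lemma Rapid.hasDerivWithinAt_psum {c : ℕ → ℂ} (hc : Rapid c) {z : ℂ} (hz : ‖z‖ ≤ 1) :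
    HasDerivWithinAt (psum c) (psum (Gevrey.derivCoeff c) z) closedDisc z := by
  rw [hasDerivWithinAt_iff_isLittleO]
  have key : ∀ w ∈ closedDisc,
      ‖psum c w - psum c z - (w - z) • psum (Gevrey.derivCoeff c) z‖
        ≤ (∑' k, (k.choose 2 : ℝ) * ‖c k‖) * ‖w - z‖ ^ 2 := by
    intro w hw
    have hw' := mem_closedDisc.1 hw
    have e : psum c w - psum c z - (w - z) • psum (Gevrey.derivCoeff c) z
        = ∑' n, c (n + 1) * (w ^ (n + 1) - z ^ (n + 1) - (n + 1) * z ^ n * (w - z)) := by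
      rw [psum, psum, psum, (hc.summable hw').tsum_eq_zero_add, (hc.summable hz).tsum_eq_zero_add,
        smul_eq_mul, ← tsum_mul_left]
      have s1 := (summable_nat_add_iff 1).2 (hc.summable hw')
      have s2 := (summable_nat_add_iff 1).2 (hc.summable hz)
      have s3 := (hc.derivCoeff.summable hz).mul_left (w - z)
      simp only [pow_zero, mul_one, add_sub_add_left_eq_sub]
      rw [← s1.tsum_sub s2, ← (s1.sub s2).tsum_sub s3]
      refine tsum_congr fun n => ?_
      simp only [Gevrey.derivCoeff]
      ring
    rw [e, ← tsum_mul_right]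
    have hs := (summable_nat_add_iff 1).2 ((summable_choose_mul hc 2).mul_right (‖w - z‖ ^ 2))
    refine (tsum_of_norm_bounded hs.hasSum fun n => ?_).trans ?_
    · have h := mul_le_mul_of_nonneg_left (norm_pow_sub_linear_le hw' hz n) (norm_nonneg (c (n + 1)))
      rw [norm_mul]
      linarith
    · rw [((summable_choose_mul hc 2).mul_right (‖w - z‖ ^ 2)).tsum_eq_zero_add]
      simp
  have h1 : (fun w => psum c w - psum c z - (w - z) • psum (Gevrey.derivCoeff c) z)
      =O[nhdsWithin z closedDisc] fun w => ‖w - z‖ ^ 2 := by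
    refine Asymptotics.IsBigO.of_bound (∑' k, (k.choose 2 : ℝ) * ‖c k‖) ?_
    filter_upwards [self_mem_nhdsWithin] with w hw
    simpa using key w hw
  refine h1.trans_isLittleO ?_
  have h2 : (fun w : ℂ => ‖w - z‖ ^ 2) =o[nhds z] fun w => w - z := by
    have := Asymptotics.isLittleO_pow_sub_sub z (m := 2) (by norm_num)
    exact this
  exact h2.mono nhdsWithin_le_nhds

lemma Rapid.derivWithin_psum {c : ℕ → ℂ} (hc : Rapid c) {z : ℂ} (hz : z ∈ closedDisc) :
    derivWithin (psum c) closedDisc z = psum (Gevrey.derivCoeff c) z :=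
  (hc.hasDerivWithinAt_psum (mem_closedDisc.1 hz)).derivWithin (uniqueDiffOn_closedDisc z hz)

lemma Rapid.contDiffOn_psum {c : ℕ → ℂ} (hc : Rapid c) : ContDiffOn ℂ ∞ (psum c) closedDisc := by
  rw [contDiffOn_infty]
  intro n
  induction n generalizing c with
  | zero => simpa using hc.continuousOn_psum
  | succ n ih =>
    rw [Nat.cast_succ, contDiffOn_succ_iff_derivWithin uniqueDiffOn_closedDisc]
    refine ⟨fun z hz => (hc.hasDerivWithinAt_psum (mem_closedDisc.1 hz)).differentiableWithinAt,
      by simp, ?_⟩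
    exact (ih hc.derivCoeff).congr fun z hz => hc.derivWithin_psum hz

lemma Rapid.analyticOnNhd_psum {c : ℕ → ℂ} (hc : Rapid c) :
    AnalyticOnNhd ℂ (psum c) (Metric.ball 0 1) := by
  apply DifferentiableOn.analyticOnNhd _ Metric.isOpen_ball
  intro z hz
  exact ((hc.hasDerivWithinAt_psum (by simpa using (mem_ball_zero_iff.1 hz).le)).mono
    Metric.ball_subset_closedBall).differentiableWithinAt

lemma Rapid.iteratedDeriv_psum {c : ℕ → ℂ} (hc : Rapid c) (n : ℕ) {z : ℂ} (hz : ‖z‖ < 1) :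
    iteratedDeriv n (psum c) z = psum (Gevrey.derivCoeff^[n] c) z := by
  induction n generalizing c with
  | zero => simp
  | succ n ih =>
    rw [iteratedDeriv_succ', Function.iterate_succ_apply, ← ih hc.derivCoeff]
    apply Filter.EventuallyEq.iteratedDeriv_eq
    filter_upwards [Metric.isOpen_ball.mem_nhds (mem_ball_zero_iff.2 hz)] with w hw
    have hw' : ‖w‖ < 1 := mem_ball_zero_iff.1 hw
    refine HasDerivAt.deriv ((hc.hasDerivWithinAt_psum hw'.le).hasDerivAt ?_)
    exact Filter.mem_of_superset (Metric.isOpen_ball.mem_nhds hw) Metric.ball_subset_closedBall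

lemma derivCoeff_iterate_zero (c : ℕ → ℂ) (n j : ℕ) :
    Gevrey.derivCoeff^[n] c j = ((j + n).factorial / j.factorial : ℂ) * c (j + n) := by
  induction n generalizing c j with
  | zero =>
    simp [Nat.factorial_ne_zero]
  | succ n ih =>
    rw [Function.iterate_succ_apply, ih, derivCoeff, ← add_assoc, Nat.factorial_succ (j + n)]
    push_cast
    ring

lemma psum_zero (c : ℕ → ℂ) : psum c 0 = c 0 := by
  rw [psum, tsum_eq_single 0]
  · simp
  · intro n hn
    simp [hn]

/-- A function given on the closed disc by a rapidly convergent power series has the coefficients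
of this series as Taylor coefficients. -/
lemma taylorCoeff_eq_of_eqOn {c : ℕ → ℂ} (hc : Rapid c) {f : ℂ → ℂ}
    (hf : Set.EqOn f (psum c) closedDisc) (n : ℕ) : taylorCoeff f n = c n := by
  have h : f =ᶠ[nhds 0] psum c := by
    filter_upwards [Metric.closedBall_mem_nhds (0 : ℂ) one_pos] with z hz using hf hz
  rw [taylorCoeff, h.iteratedDeriv_eq, hc.iteratedDeriv_psum n (by simp), psum_zero,
    derivCoeff_iterate_zero]
  have := Nat.factorial_ne_zero n
  field_simp
  simp

/-! ### The decay of the coefficients -/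

lemma summable_pow_mul_exp_sqrt {a : ℝ} (ha : 0 < a) (m : ℕ) :
    Summable fun k : ℕ => (k : ℝ) ^ m * Real.exp (-(a * (k : ℝ) ^ (1 / 2 : ℝ))) := by
  -- Since e^x ≥ x^N/N! and (√k)^N = k^(m+2), this N leaves the summable factor k^(-2).
  set N := 2 * (m + 2) with hN
  have h0 : Summable fun k : ℕ => (N.factorial / a ^ N : ℝ) * ((k : ℝ) ^ 2)⁻¹ :=
    (Real.summable_nat_pow_inv.2 (by norm_num)).mul_left _
  refine h0.of_norm_bounded_eventually_nat ?_
  filter_upwards [Filter.eventually_ge_atTop 1] with k hk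
  have hk' : (0 : ℝ) < k := by exact_mod_cast hk
  rw [Real.norm_of_nonneg (by positivity), Real.exp_neg]
  have h1 := Real.pow_div_factorial_le_exp (x := a * (k : ℝ) ^ (1 / 2 : ℝ)) (by positivity) N
  have h2 : (a * (k : ℝ) ^ (1 / 2 : ℝ)) ^ N = a ^ N * (k : ℝ) ^ (m + 2) := by
    rw [mul_pow, hN, pow_mul ((k : ℝ) ^ (1 / 2 : ℝ)), ← Real.rpow_natCast _ 2, ← Real.rpow_mul hk'.le]
    norm_num
  rw [h2] at h1
  have h3 : (0 : ℝ) < N.factorial := by exact_mod_cast N.factorial_pos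
  calc (k : ℝ) ^ m * (Real.exp (a * (k : ℝ) ^ (1 / 2 : ℝ)))⁻¹
      ≤ (k : ℝ) ^ m * (a ^ N * (k : ℝ) ^ (m + 2) / N.factorial)⁻¹ := by
        gcongr
    _ = _ := by
        rw [pow_add]
        field_simp

lemma half_rpow_le {s : ℝ} (hs : 1 / 2 ≤ s) (k : ℕ) : (k : ℝ) ^ (1 / 2 : ℝ) ≤ (k : ℝ) ^ s := by
  rcases Nat.eq_zero_or_pos k with rfl | hk
  · rw [Nat.cast_zero, Real.zero_rpow (by norm_num), Real.zero_rpow (by linarith)]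
  · exact Real.rpow_le_rpow_of_exponent_le (by exact_mod_cast hk) hs

lemma exp_neg_rpow_le {a s : ℝ} (ha : 0 < a) (hs : 1 / 2 ≤ s) (k : ℕ) :
    Real.exp (-(a * (k : ℝ) ^ s)) ≤ Real.exp (-(a * (k : ℝ) ^ (1 / 2 : ℝ))) := by
  have := half_rpow_le hs k
  gcongr

lemma rapid_of_exp_bound {c : ℕ → ℂ} {a a' s : ℝ} (ha : 0 < a) (hs : 1 / 2 ≤ s)
    (hc : ∀ n : ℕ, ‖c n‖ ≤ a' * Real.exp (-(a * (n : ℝ) ^ s))) : Rapid c := by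
  intro m
  have ha' : 0 ≤ a' := by
    have := (norm_nonneg _).trans (hc 0)
    exact nonneg_of_mul_nonneg_left this (Real.exp_pos _)
  have h1 : Summable fun k : ℕ => (k.choose m : ℝ) * ‖c k‖ := by
    refine .of_nonneg_of_le (fun k => by positivity) (fun k => ?_)
      ((summable_pow_mul_exp_sqrt ha m).mul_left a')
    have h2 : (k.choose m : ℝ) ≤ (k : ℝ) ^ m := by exact_mod_cast Nat.choose_le_pow k m
    calc (k.choose m : ℝ) * ‖c k‖ ≤ (k : ℝ) ^ m * (a' * Real.exp (-(a * (k : ℝ) ^ (1 / 2 : ℝ)))) := by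
          gcongr
          exact (hc k).trans (mul_le_mul_of_nonneg_left (exp_neg_rpow_le ha hs k) ha')
      _ = _ := by ring
  have h2 := h1.tsum_ofReal_ne_top
  convert h2 using 1
  refine tsum_congr fun k => ?_
  rw [ENNReal.ofReal_mul (by positivity), ofReal_norm, ENNReal.ofReal_natCast]

/-- The value 1/2, attained at β = 0, is the worst case. Replacing the exponent by 1/2 in part of
the decay makes the constants uniform in β. -/
lemma half_le_exponent {β : ℝ} (hβ : 0 ≤ β) : 1 / 2 ≤ (1 + β) / (2 + β) := by
  rw [div_le_div_iff₀ (by norm_num) (by linarith)]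
  linarith

lemma ClassA.rapid {β a a' : ℝ} {f : ℂ → ℂ} (hβ : 0 ≤ β) (ha : 0 < a) (hf : ClassA β a a' f) :
    Rapid (taylorCoeff f) :=
  rapid_of_exp_bound ha (half_le_exponent hβ) hf.coeff_le

lemma ClassA.eqOn_psum {β a a' : ℝ} {f : ℂ → ℂ} (hβ : 0 ≤ β) (ha : 0 < a)
    (hf : ClassA β a a' f) : Set.EqOn f (psum (taylorCoeff f)) closedDisc := by
  have h1 : Set.EqOn f (psum (taylorCoeff f)) (Metric.ball 0 1) := by
    intro z hz
    have := (Complex.hasSum_taylorSeries_on_ball hf.analytic.differentiableOn hz).tsum_eq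
    rw [← this, psum]
    refine tsum_congr fun n => ?_
    simp only [sub_zero, smul_eq_mul, taylorCoeff]
    ring
  refine h1.of_subset_closure hf.smooth.continuousOn (hf.rapid hβ ha).continuousOn_psum
    Metric.ball_subset_closedBall ?_
  rw [closure_ball _ one_ne_zero]
  exact subset_rfl

lemma classA_of_eqOn_psum {β a a' : ℝ} {c : ℕ → ℂ} {f : ℂ → ℂ} (hβ : 0 ≤ β) (ha : 0 < a)
    (hc : ∀ n : ℕ, ‖c n‖ ≤ a' * Real.exp (-(a * (n : ℝ) ^ ((1 + β) / (2 + β)))))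
    (hf : Set.EqOn f (psum c) closedDisc) : ClassA β a a' f := by
  have hr := rapid_of_exp_bound ha (half_le_exponent hβ) hc
  refine ⟨?_, hr.contDiffOn_psum.congr hf, fun n => ?_⟩
  · exact hr.analyticOnNhd_psum.congr Metric.isOpen_ball
      fun z hz => (hf (Metric.ball_subset_closedBall hz)).symm
  · rw [taylorCoeff_eq_of_eqOn hr hf]
    exact hc n

end Gevrey

namespace Gevrey

open MeasureTheory

/-! ### Expansion of Cauchy transforms -/

/-- The Taylor coefficients of the Cauchy transform of `φ`. -/
noncomputable def cauchyCoeff (φ : ℂ → ℂ) (k : ℕ) : ℂ :=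
  -(1 / (Real.pi : ℂ)) * ∫ ζ : ℂ, φ ζ / ζ ^ (k + 1)

/-- Below the height x = k^(-1/(2+β)) the weight alone is small enough; above it the power
(1+x)^(-k) is, because log(1+x) ≥ x/2 for x < 1. -/
lemma rho_mul_pow_le {β K d x : ℝ} (hβ : 0 ≤ β) (hK : 1 ≤ K) (hd : 0 < d) (hdK : d ≤ K)
    (hx0 : 0 < x) (hx1 : x < 1) (k : ℕ) :
    rho β (d * x) * ((1 + x) ^ (k + 1))⁻¹
      ≤ Real.exp (-((1 / 2) * K ^ (-(1 + β)) * (k : ℝ) ^ ((1 + β) / (2 + β)))) := by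
  have hK0 : 0 < K := by linarith
  have hq : 0 < 2 + β := by linarith
  have hKle : K ^ (-(1 + β)) ≤ 1 := Real.rpow_le_one_of_one_le_of_nonpos hK (by linarith)
  have hKpos : 0 < K ^ (-(1 + β)) := Real.rpow_pos_of_pos hK0 _
  have hlog : x / 2 ≤ Real.log (1 + x) := by
    refine le_trans ?_ (Real.le_log_one_add_of_nonneg hx0.le)
    rw [div_le_div_iff₀ (by norm_num) (by linarith)]
    nlinarith
  have hpow : ((1 + x) ^ (k + 1))⁻¹ ≤ Real.exp (-(k * (x / 2))) := by
    rw [Real.exp_neg, ← Real.exp_log (show 0 < (1 + x) ^ (k + 1) by positivity), Real.log_pow]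
    gcongr
    nlinarith
  rw [rho]
  refine (mul_le_mul_of_nonneg_left hpow (Real.exp_pos _).le).trans ?_
  rw [← Real.exp_add]
  apply Real.exp_le_exp.2
  have h1 : 0 ≤ 1 / (d * x) ^ (1 + β) := by positivity
  rcases Nat.eq_zero_or_pos k with rfl | hk
  · rw [Nat.cast_zero, Real.zero_rpow (by positivity)]
    simp only [zero_mul, mul_zero, neg_zero, add_zero]
    linarith
  have hk' : (0 : ℝ) < k := by exact_mod_cast hk
  have hks : 0 < (k : ℝ) ^ ((1 + β) / (2 + β)) := Real.rpow_pos_of_pos hk' _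
  rcases le_total x ((k : ℝ) ^ (-(1 / (2 + β)))) with hx | hx
  · have h2 : K ^ (-(1 + β)) * (k : ℝ) ^ ((1 + β) / (2 + β)) ≤ 1 / (d * x) ^ (1 + β) := by
      rw [one_div, ← Real.rpow_neg (by positivity)]
      have h3 : (k : ℝ) ^ ((1 + β) / (2 + β)) = ((k : ℝ) ^ (-(1 / (2 + β)))) ^ (-(1 + β)) := by
        rw [← Real.rpow_mul hk'.le]
        congr 1
        field_simp
      rw [h3, ← Real.mul_rpow hK0.le (by positivity)]
      apply Real.rpow_le_rpow_of_nonpos (by positivity) _ (by linarith)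
      gcongr
    nlinarith [mul_pos hk' hx0]
  · have h2 : (k : ℝ) ^ ((1 + β) / (2 + β)) ≤ k * x := by
      have h3 : (k : ℝ) ^ ((1 + β) / (2 + β)) = k * (k : ℝ) ^ (-(1 / (2 + β))) := by
        rw [← Real.rpow_one_add' hk'.le]
        · congr 1
          field_simp
          ring
        · have : 1 + -(1 / (2 + β)) = (1 + β) / (2 + β) := by field_simp; ring
          rw [this]
          positivity
      rw [h3]
      gcongr
    nlinarith [mul_le_mul_of_nonneg_right hKle hks.le]

lemma integrable_indicator_ball (C : ℝ) :
    Integrable ((Metric.ball (0 : ℂ) 2).indicator fun _ => C) := by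
  rw [integrable_indicator_iff measurableSet_ball]
  exact integrableOn_const (by simp [Complex.volume_ball, ENNReal.mul_eq_top]) (by simp)

lemma integral_indicator_ball (C : ℝ) :
    ∫ ζ, (Metric.ball (0 : ℂ) 2).indicator (fun _ => C) ζ = 4 * Real.pi * C := by
  rw [integral_indicator measurableSet_ball, setIntegral_const, smul_eq_mul, measureReal_def,
    Complex.volume_ball, ENNReal.toReal_mul, ENNReal.toReal_pow, ENNReal.toReal_ofReal (by norm_num)]
  norm_num [NNReal.coe_real_pi]

section

variable {φ : ℂ → ℂ} {β K d d' : ℝ}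

/-- The density is not bounded on the circle itself, where its values are irrelevant because the
circle is a null set. -/
lemma ae_norm_ne_one : ∀ᵐ ζ : ℂ, ‖ζ‖ ≠ 1 := by
  have h := Measure.addHaar_sphere (volume : Measure ℂ) 0 1
  rw [ae_iff]
  convert h using 2
  ext z
  simp

lemma ae_norm_div_pow_le (hβ : 0 ≤ β) (hK : 1 ≤ K) (hd : 0 < d) (hdK : d ≤ K) (hd' : 0 ≤ d')
    (h0 : ∀ z : ℂ, ¬ (1 ≤ ‖z‖ ∧ ‖z‖ < 2) → φ z = 0)
    (hb : ∀ z : ℂ, 1 < ‖z‖ → ‖z‖ < 2 → ‖φ z‖ ≤ d' * rho β (d * (‖z‖ - 1))) (k : ℕ) :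
    ∀ᵐ ζ : ℂ, ‖φ ζ / ζ ^ (k + 1)‖ ≤ (Metric.ball (0 : ℂ) 2).indicator (fun _ =>
      d' * Real.exp (-((1 / 2) * K ^ (-(1 + β)) * (k : ℝ) ^ ((1 + β) / (2 + β))))) ζ := by
  filter_upwards [ae_norm_ne_one] with ζ hζ
  by_cases h : 1 < ‖ζ‖ ∧ ‖ζ‖ < 2
  · rw [Set.indicator_of_mem (by simpa using h.2), norm_div, norm_pow, div_eq_mul_inv]
    have h1 := rho_mul_pow_le hβ hK hd hdK (x := ‖ζ‖ - 1) (by linarith [h.1]) (by linarith [h.2]) k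
    rw [add_sub_cancel] at h1
    calc _ ≤ d' * rho β (d * (‖ζ‖ - 1)) * (‖ζ‖ ^ (k + 1))⁻¹ := by
          gcongr
          exact hb ζ h.1 h.2
      _ ≤ _ := by
          rw [mul_assoc]
          gcongr
  · rw [h0 ζ (fun h' => h ⟨lt_of_le_of_ne h'.1 (Ne.symm hζ), h'.2⟩)]
    simp only [zero_div, norm_zero]
    exact Set.indicator_nonneg (fun _ _ => by positivity) _

lemma integrable_div_pow (hβ : 0 ≤ β) (hK : 1 ≤ K) (hd : 0 < d) (hdK : d ≤ K) (hd' : 0 ≤ d')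
    (hm : Measurable φ) (h0 : ∀ z : ℂ, ¬ (1 ≤ ‖z‖ ∧ ‖z‖ < 2) → φ z = 0)
    (hb : ∀ z : ℂ, 1 < ‖z‖ → ‖z‖ < 2 → ‖φ z‖ ≤ d' * rho β (d * (‖z‖ - 1))) (k : ℕ) :
    Integrable fun ζ => φ ζ / ζ ^ (k + 1) :=
  (integrable_indicator_ball _).mono'
    (hm.div (measurable_id.pow_const _)).aestronglyMeasurable
    (ae_norm_div_pow_le hβ hK hd hdK hd' h0 hb k)

lemma integral_norm_div_pow_le (hβ : 0 ≤ β) (hK : 1 ≤ K) (hd : 0 < d) (hdK : d ≤ K) (hd' : 0 ≤ d')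
    (h0 : ∀ z : ℂ, ¬ (1 ≤ ‖z‖ ∧ ‖z‖ < 2) → φ z = 0)
    (hb : ∀ z : ℂ, 1 < ‖z‖ → ‖z‖ < 2 → ‖φ z‖ ≤ d' * rho β (d * (‖z‖ - 1))) (k : ℕ) :
    ∫ ζ, ‖φ ζ / ζ ^ (k + 1)‖ ≤ 4 * Real.pi *
      (d' * Real.exp (-((1 / 2) * K ^ (-(1 + β)) * (k : ℝ) ^ ((1 + β) / (2 + β))))) := by
  rw [← integral_indicator_ball]
  have h := norm_integral_le_of_norm_le (f := fun ζ => ‖φ ζ / ζ ^ (k + 1)‖)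
    (integrable_indicator_ball _)
    ((ae_norm_div_pow_le hβ hK hd hdK hd' h0 hb k).mono fun ζ hζ => by rwa [norm_norm])
  exact (le_abs_self _).trans h

lemma norm_cauchyCoeff_le (hβ : 0 ≤ β) (hK : 1 ≤ K) (hd : 0 < d) (hdK : d ≤ K) (hd' : 0 ≤ d')
    (h0 : ∀ z : ℂ, ¬ (1 ≤ ‖z‖ ∧ ‖z‖ < 2) → φ z = 0)
    (hb : ∀ z : ℂ, 1 < ‖z‖ → ‖z‖ < 2 → ‖φ z‖ ≤ d' * rho β (d * (‖z‖ - 1))) (k : ℕ) :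
    ‖cauchyCoeff φ k‖ ≤ 4 * d' *
      Real.exp (-((1 / 2) * K ^ (-(1 + β)) * (k : ℝ) ^ ((1 + β) / (2 + β)))) := by
  have h := (norm_integral_le_integral_norm _).trans
    (integral_norm_div_pow_le hβ hK hd hdK hd' h0 hb k)
  have hpi := Real.pi_pos
  rw [cauchyCoeff, norm_mul, norm_neg, norm_div, norm_one, Complex.norm_real,
    Real.norm_of_nonneg hpi.le, one_div_mul_eq_div, div_le_iff₀ hpi]
  linarith

lemma tsum_div_pow {z ζ : ℂ} (hz : ‖z‖ ≤ 1) (hζ : 1 < ‖ζ‖) (w : ℂ) :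
    ∑' k : ℕ, -(z ^ k * (w / ζ ^ (k + 1))) = w / (z - ζ) := by
  have hζ0 : ζ ≠ 0 := norm_pos_iff.1 (by linarith)
  have hne : z - ζ ≠ 0 := by
    intro h
    rw [sub_eq_zero.1 h] at hz
    linarith
  have h1 : ‖z / ζ‖ < 1 := by
    rw [norm_div, div_lt_one (by linarith)]
    linarith
  have h2 : ∀ k : ℕ, -(z ^ k * (w / ζ ^ (k + 1))) = -(w / ζ) * (z / ζ) ^ k := by
    intro k
    rw [div_pow, pow_succ]
    field_simp
  simp_rw [h2]
  have hne' : ζ - z ≠ 0 := by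
    rw [← neg_sub]
    exact neg_ne_zero.2 hne
  rw [tsum_mul_left, tsum_geometric_of_norm_lt_one h1]
  have : 1 - z / ζ = (ζ - z) / ζ := by field_simp
  rw [this]
  field_simp
  rw [← neg_sub ζ z]
  field_simp

/-- For |z| ≤ 1 < |ζ| the Cauchy kernel is a geometric series. Sum and integral may be interchanged
even for |z| = 1, since the integrals of |φ|/|ζ|^(k+1) are summable. -/
lemma cauchyTransform_eq_psum (hβ : 0 ≤ β) (hK : 1 ≤ K) (hd : 0 < d) (hdK : d ≤ K) (hd' : 0 ≤ d')
    (hm : Measurable φ) (h0 : ∀ z : ℂ, ¬ (1 ≤ ‖z‖ ∧ ‖z‖ < 2) → φ z = 0)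
    (hb : ∀ z : ℂ, 1 < ‖z‖ → ‖z‖ < 2 → ‖φ z‖ ≤ d' * rho β (d * (‖z‖ - 1)))
    {z : ℂ} (hz : ‖z‖ ≤ 1) :
    (1 / (Real.pi : ℂ)) * ∫ ζ : ℂ, φ ζ / (z - ζ) = psum (cauchyCoeff φ) z := by
  have hK0 : 0 < K := by linarith
  have hKpos : 0 < K ^ (-(1 + β)) := Real.rpow_pos_of_pos hK0 _
  have hint := fun k => integrable_div_pow hβ hK hd hdK hd' hm h0 hb k
  have hS : Summable fun k : ℕ => ∫ ζ, ‖-(z ^ k * (φ ζ / ζ ^ (k + 1)))‖ := by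
    have hs := ((summable_pow_mul_exp_sqrt (a := (1 / 2) * K ^ (-(1 + β))) (by positivity) 0).mul_left
      d').mul_left (4 * Real.pi)
    refine .of_nonneg_of_le (fun k => integral_nonneg fun _ => norm_nonneg _) (fun k => ?_) hs
    have h1 : ∫ ζ, ‖-(z ^ k * (φ ζ / ζ ^ (k + 1)))‖ ≤ ∫ ζ, ‖φ ζ / ζ ^ (k + 1)‖ := by
      apply integral_mono_of_nonneg (Filter.Eventually.of_forall fun _ => norm_nonneg _)
        (hint k).norm (Filter.Eventually.of_forall fun ζ => ?_)
      simp only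
      rw [norm_neg, norm_mul, norm_pow]
      exact mul_le_of_le_one_left (norm_nonneg _) (pow_le_one₀ (norm_nonneg _) hz)
    refine (h1.trans (integral_norm_div_pow_le hβ hK hd hdK hd' h0 hb k)).trans ?_
    rw [pow_zero, one_mul]
    have := exp_neg_rpow_le (a := (1 / 2) * K ^ (-(1 + β))) (by positivity) (half_le_exponent hβ) k
    have := Real.pi_pos
    gcongr
  have h := (hasSum_integral_of_summable_integral_norm
    (F := fun (k : ℕ) ζ => -(z ^ k * (φ ζ / ζ ^ (k + 1)))) (fun k => ((hint k).const_mul _).neg)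
    hS).tsum_eq
  have h2 : ∫ ζ, ∑' k : ℕ, -(z ^ k * (φ ζ / ζ ^ (k + 1))) = ∫ ζ : ℂ, φ ζ / (z - ζ) := by
    apply integral_congr_ae
    filter_upwards [ae_norm_ne_one] with ζ hζ
    by_cases h : 1 ≤ ‖ζ‖ ∧ ‖ζ‖ < 2
    · exact tsum_div_pow hz (lt_of_le_of_ne h.1 (Ne.symm hζ)) _
    · simp [h0 ζ h]
  rw [← h2, ← h, psum, ← tsum_mul_left]
  refine tsum_congr fun k => ?_
  rw [cauchyCoeff, integral_neg, integral_const_mul]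
  ring

end

/-- Cauchy transforms have rapidly decaying Taylor coefficients. -/
lemma classA_of_classC {β β₀ K : ℝ} (hβ : 0 ≤ β) (hβ₀ : β ≤ β₀) (hK : 1 ≤ K) {f : ℂ → ℂ}
    (hf : ClassCComparable K β f) : ClassAComparable (4 * K ^ (1 + β₀)) β f := by
  obtain ⟨d, ⟨hd1, hd2⟩, d', ⟨hd1', hd2'⟩, φ, hm, h0, hb, hfφ⟩ := hf
  have hK0 : 0 < K := by linarith
  have hd : 0 < d := (inv_pos.2 hK0).trans_le hd1
  have hd' : 0 < d' := (inv_pos.2 hK0).trans_le hd1'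
  have hKK : K ≤ K ^ (1 + β₀) := by
    nth_rw 1 [← Real.rpow_one K]
    exact Real.rpow_le_rpow_of_exponent_le hK (by linarith)
  have hP : 0 < K ^ (1 + β₀) := by positivity
  have hX : (1 / 2) * K ^ (-(1 + β₀)) ∈ Set.Icc (4 * K ^ (1 + β₀))⁻¹ (4 * K ^ (1 + β₀)) := by
    rw [Real.rpow_neg hK0.le]
    constructor
    · rw [mul_inv]
      gcongr
      norm_num
    · have : (K ^ (1 + β₀))⁻¹ ≤ 1 := inv_le_one_of_one_le₀ (by linarith)
      linarith
  refine ⟨_, hX, 4 * d', ⟨?_, by linarith⟩, ?_⟩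
  · calc (4 * K ^ (1 + β₀))⁻¹ ≤ K⁻¹ := by
          gcongr
          linarith
      _ ≤ 4 * d' := by linarith
  · refine classA_of_eqOn_psum hβ (by positivity) (c := cauchyCoeff φ) (fun n => ?_) fun z hz => ?_
    · refine (norm_cauchyCoeff_le hβ hK hd hd2 hd'.le h0 hb n).trans ?_
      gcongr
    · rw [hfφ z hz, cauchyTransform_eq_psum hβ hK hd hd2 hd'.le hm h0 hb (mem_closedDisc.1 hz)]

end Gevrey

namespace Gevrey

open MeasureTheory

/-! ### Representation of functions with decaying coefficients as Cauchy transforms -/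

/-- The open annulus with radii `p` and `r`. -/
def annulus (p r : ℝ) : Set ℂ := {ζ | p < ‖ζ‖ ∧ ‖ζ‖ < r}

lemma measurableSet_annulus (p r : ℝ) : MeasurableSet (annulus p r) :=
  (measurableSet_lt measurable_const measurable_norm).inter
    (measurableSet_lt measurable_norm measurable_const)

lemma volume_annulus {p r : ℝ} (hp : 0 ≤ p) (hpr : p < r) :
    volume.real (annulus p r) = Real.pi * (r ^ 2 - p ^ 2) := by
  have h : annulus p r = Metric.ball 0 r \ Metric.closedBall 0 p := by
    ext z
    simp [annulus, and_comm]
  rw [h, measureReal_sdiff (Metric.closedBall_subset_ball hpr) measurableSet_closedBall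
    (by simp [ENNReal.mul_eq_top]), measureReal_def, measureReal_def,
    Complex.volume_ball, Complex.volume_closedBall, ENNReal.toReal_mul, ENNReal.toReal_mul,
    ENNReal.toReal_pow, ENNReal.toReal_pow, ENNReal.toReal_ofReal hp,
    ENNReal.toReal_ofReal (hp.trans hpr.le)]
  simp only [ENNReal.coe_toReal, NNReal.coe_real_pi]
  ring

/-- The rotation by the angle π/(n-k) preserves the annulus and changes the sign of the integrand.
-/
lemma integral_annulus_pow_div_pow_of_ne {n k : ℕ} (hnk : n ≠ k) (p r : ℝ) :
    ∫ ζ in annulus p r, ζ ^ (n + 1) / ζ ^ (k + 1) = 0 := by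
  have hnk' : (n : ℂ) - k ≠ 0 := by
    rw [sub_ne_zero]
    exact_mod_cast hnk
  set x : ℝ := Real.pi / ((n : ℝ) - k) with hx
  set u : Circle := Circle.exp x with hu
  have hval : (u : ℂ) ^ (n + 1) / (u : ℂ) ^ (k + 1) = -1 := by
    rw [hu, Circle.coe_exp, ← Complex.exp_nat_mul, ← Complex.exp_nat_mul, ← Complex.exp_sub,
      ← Complex.exp_pi_mul_I]
    congr 1
    rw [hx]
    push_cast
    field_simp
    ring
  rw [← integral_indicator (measurableSet_annulus p r)]
  set g : ℂ → ℂ := (annulus p r).indicator fun ζ => ζ ^ (n + 1) / ζ ^ (k + 1) with hg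
  have h1 : ∀ ζ, g (rotation u ζ) = - g ζ := by
    intro ζ
    have hmem : rotation u ζ ∈ annulus p r ↔ ζ ∈ annulus p r := by
      simp only [annulus, Set.mem_ofPred_eq, LinearIsometryEquiv.norm_map]
    by_cases hζ : ζ ∈ annulus p r
    · rw [hg, Set.indicator_of_mem (hmem.2 hζ), Set.indicator_of_mem hζ, rotation_apply, mul_pow,
        mul_pow, mul_div_mul_comm, hval]
      ring
    · rw [hg, Set.indicator_of_notMem (fun h => hζ (hmem.1 h)), Set.indicator_of_notMem hζ, neg_zero]
  have h2 := (rotation u).measurePreserving.integral_comp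
    (rotation u).toHomeomorph.measurableEmbedding g
  simp_rw [h1, integral_neg] at h2
  exact self_eq_neg.1 h2.symm

lemma integral_annulus_pow_div_pow_self (n : ℕ) {p r : ℝ} (hp : 0 ≤ p) :
    ∫ ζ in annulus p r, ζ ^ (n + 1) / ζ ^ (n + 1) = (volume.real (annulus p r) : ℂ) := by
  have : ∫ ζ in annulus p r, ζ ^ (n + 1) / ζ ^ (n + 1) = ∫ ζ in annulus p r, (1 : ℂ) := by
    apply setIntegral_congr_fun (measurableSet_annulus p r)
    intro ζ hζ
    have : ζ ≠ 0 := norm_pos_iff.1 (hp.trans_lt hζ.1)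
    simp only
    field_simp
  rw [this]
  simp

/-- The width of the `n`-th annulus. -/
noncomputable def width (κ β : ℝ) (n : ℕ) : ℝ := κ * ((n : ℝ) + 1) ^ (-(1 / (2 + β)))

/-- A density on the `n`-th annulus whose Cauchy transform is `c n * z ^ n`. -/
noncomputable def density (κ β : ℝ) (c : ℕ → ℂ) (n : ℕ) : ℂ → ℂ :=
  (annulus (1 + width κ β n) (1 + 2 * width κ β n)).indicator fun ζ =>
    -(Real.pi * c n / volume.real (annulus (1 + width κ β n) (1 + 2 * width κ β n)) : ℂ) *
      ζ ^ (n + 1)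

section

variable {κ β : ℝ} {c : ℕ → ℂ}

lemma width_pos (hκ : 0 < κ) (n : ℕ) : 0 < width κ β n := by
  unfold width
  positivity

lemma width_le (hκ : 0 < κ) (hβ : 0 ≤ β) (n : ℕ) : width κ β n ≤ κ := by
  have : ((n : ℝ) + 1) ^ (-(1 / (2 + β))) ≤ 1 := by
    apply Real.rpow_le_one_of_one_le_of_nonpos
    · linarith [(n.cast_nonneg : (0 : ℝ) ≤ n)]
    · have : 0 < 1 / (2 + β) := by positivity
      linarith
  unfold width
  nlinarith

lemma measurable_density (n : ℕ) : Measurable (density κ β c n) :=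
  Measurable.indicator (by fun_prop) (measurableSet_annulus _ _)

lemma integral_density_div_pow (hκ : 0 < κ) (n k : ℕ) :
    ∫ ζ, density κ β c n ζ / ζ ^ (k + 1) = if n = k then -(Real.pi * c n) else 0 := by
  have hw := width_pos (β := β) hκ n
  set p := 1 + width κ β n
  set r := 1 + 2 * width κ β n
  set v := volume.real (annulus p r) with hv
  have hvpos : 0 < v := by
    rw [hv, volume_annulus (by positivity) (by simp only [p, r]; linarith)]
    have : 0 < r ^ 2 - p ^ 2 := by simp only [p, r]; nlinarith
    have := Real.pi_pos
    positivity
  have h1 : ∀ ζ, density κ β c n ζ / ζ ^ (k + 1) = (annulus p r).indicator (fun ζ =>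
      -(Real.pi * c n / v : ℂ) * (ζ ^ (n + 1) / ζ ^ (k + 1))) ζ := by
    intro ζ
    by_cases hζ : ζ ∈ annulus p r
    · rw [density, Set.indicator_of_mem hζ, Set.indicator_of_mem hζ, mul_div_assoc]
    · rw [density, Set.indicator_of_notMem hζ, Set.indicator_of_notMem hζ, zero_div]
  simp_rw [h1]
  rw [integral_indicator (measurableSet_annulus p r), integral_const_mul]
  split_ifs with h
  · subst h
    rw [integral_annulus_pow_div_pow_self n (by positivity), ← hv]
    have : (v : ℂ) ≠ 0 := by exact_mod_cast hvpos.ne'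
    field_simp
  · rw [integral_annulus_pow_div_pow_of_ne h, mul_zero]

lemma add_one_rpow_le {s : ℝ} (hs0 : 0 ≤ s) (hs1 : s ≤ 1) (n : ℕ) :
    ((n : ℝ) + 1) ^ s ≤ (n : ℝ) ^ s + 1 := by
  have := Real.rpow_add_le_add_rpow (a := (n : ℝ)) (b := 1) (by positivity) zero_le_one hs0 hs1
  simpa using this

lemma add_one_rpow_eq_mul (hβ : 0 ≤ β) (n : ℕ) :
    ((n : ℝ) + 1) ^ ((1 + β) / (2 + β)) = ((n : ℝ) + 1) * ((n : ℝ) + 1) ^ (-(1 / (2 + β))) := by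
  have h0 : (0 : ℝ) < (n : ℝ) + 1 := by positivity
  nth_rw 2 [← Real.rpow_one ((n : ℝ) + 1)]
  rw [← Real.rpow_add h0]
  congr 1
  field_simp
  ring

/-- The bound for the `n`-th density. -/
lemma norm_density_le {K : ℝ} (hK : 1 ≤ K) (hβ : 0 ≤ β)
    (hc : ∀ n : ℕ, ‖c n‖ ≤ K * Real.exp (-(K⁻¹ * (n : ℝ) ^ ((1 + β) / (2 + β))))) (n : ℕ) {ζ : ℂ}
    (hζ : ζ ∈ annulus (1 + width (K⁻¹ / 8) β n) (1 + 2 * width (K⁻¹ / 8) β n)) :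
    ‖density (K⁻¹ / 8) β c n ζ‖ ≤ 12 * K ^ 2 * (((n : ℝ) + 1) *
        Real.exp (-(K⁻¹ / 2 * (n : ℝ) ^ (1 / 2 : ℝ)))) *
      rho β (32 * K ^ 2 * (‖ζ‖ - 1)) := by
  have hK0 : 0 < K := by linarith
  set a := K⁻¹ with ha
  have ha0 : 0 < a := inv_pos.2 hK0
  have ha1 : a ≤ 1 := inv_le_one_of_one_le₀ hK
  have haK : a * K = 1 := inv_mul_cancel₀ hK0.ne'
  set s := (1 + β) / (2 + β) with hs
  have hs2 := half_le_exponent hβ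
  have hs1 : s ≤ 1 := by
    rw [hs, div_le_one (by linarith)]
    linarith
  have hκ : 0 < a / 8 := by positivity
  set δ := width (a / 8) β n with hδ
  have hδ0 : 0 < δ := width_pos hκ n
  have hn1 : (0 : ℝ) < (n : ℝ) + 1 := by positivity
  set y := (n : ℝ) ^ s with hy
  have hy0 : 0 ≤ y := by positivity
  have hn1s : ((n : ℝ) + 1) ^ s ≤ y + 1 := add_one_rpow_le (by linarith) hs1 n
  have hv : 2 * Real.pi * δ ≤ volume.real (annulus (1 + δ) (1 + 2 * δ)) := by
    rw [volume_annulus (by positivity) (by linarith)]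
    nlinarith [Real.pi_pos, mul_pos Real.pi_pos hδ0]
  -- With width (a/8)(n+1)^(-1/(2+β)), the growth of the monomial uses up only a quarter of the
  -- decay rate `a`.
  have hpow : ‖ζ‖ ^ (n + 1) ≤ Real.exp (a / 4 * (y + 1)) := by
    have h1 : ‖ζ‖ ≤ Real.exp (2 * δ) := by
      linarith [hζ.2, Real.add_one_le_exp (2 * δ)]
    calc ‖ζ‖ ^ (n + 1) ≤ Real.exp (2 * δ) ^ (n + 1) := by gcongr
      _ = Real.exp (a / 4 * ((n : ℝ) + 1) ^ s) := by
        rw [← Real.exp_nat_mul, add_one_rpow_eq_mul hβ, hδ, width]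
        congr 1
        push_cast
        ring
      _ ≤ _ := by gcongr
  have hδinv : 1 / δ ≤ 8 * K * ((n : ℝ) + 1) := by
    have h2 : 1 ≤ ((n : ℝ) + 1) * ((n : ℝ) + 1) ^ (-(1 / (2 + β))) := by
      rw [← add_one_rpow_eq_mul hβ]
      exact Real.one_le_rpow (by linarith [(n.cast_nonneg : (0 : ℝ) ≤ n)]) (by linarith)
    rw [div_le_iff₀ hδ0, hδ, width]
    calc (1 : ℝ) ≤ ((n : ℝ) + 1) * ((n : ℝ) + 1) ^ (-(1 / (2 + β))) := h2
      _ = (a * K) * (((n : ℝ) + 1) * ((n : ℝ) + 1) ^ (-(1 / (2 + β)))) := by rw [haK, one_mul]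
      _ = _ := by ring
  have hx0 : 0 < ‖ζ‖ - 1 := by linarith [hζ.1]
  -- The factor 32K² turns the width into 4K(n+1)^(-1/(2+β)). Since (4K)^(1+β) ≥ 4K, the weight
  -- costs at most another quarter of the rate, uniformly in β.
  have hrho : Real.exp (-(a / 4 * (y + 1))) ≤ rho β (32 * K ^ 2 * (‖ζ‖ - 1)) := by
    rw [rho]
    apply Real.exp_le_exp.2
    apply neg_le_neg
    have h3 : 32 * K ^ 2 * δ ≤ 32 * K ^ 2 * (‖ζ‖ - 1) := by
      have := hζ.1
      gcongr
      linarith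
    have h4 : 32 * K ^ 2 * δ = (4 * K) * ((n : ℝ) + 1) ^ (-(1 / (2 + β))) := by
      rw [hδ, width]
      calc _ = (a * K) * ((4 * K) * ((n : ℝ) + 1) ^ (-(1 / (2 + β)))) := by ring
        _ = _ := by rw [haK, one_mul]
    have h5 : 4 * K * (((n : ℝ) + 1) ^ s)⁻¹ ≤ (32 * K ^ 2 * (‖ζ‖ - 1)) ^ (1 + β) := by
      calc 4 * K * (((n : ℝ) + 1) ^ s)⁻¹ ≤ (4 * K) ^ (1 + β) * (((n : ℝ) + 1) ^ s)⁻¹ := by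
            gcongr
            nth_rw 1 [← Real.rpow_one (4 * K)]
            exact Real.rpow_le_rpow_of_exponent_le (by linarith) (by linarith)
        _ = (32 * K ^ 2 * δ) ^ (1 + β) := by
            rw [h4, Real.mul_rpow (x := 4 * K) (by positivity) (by positivity), ← Real.rpow_mul hn1.le,
              ← Real.rpow_neg hn1.le]
            congr 2
            rw [hs]
            field_simp
        _ ≤ _ := by
            gcongr
    calc 1 / (32 * K ^ 2 * (‖ζ‖ - 1)) ^ (1 + β) ≤ 1 / (4 * K * (((n : ℝ) + 1) ^ s)⁻¹) := by
          gcongr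
      _ = a / 4 * ((n : ℝ) + 1) ^ s := by
          rw [ha]
          field_simp
      _ ≤ _ := by gcongr
  -- The remaining half of the rate makes the densities summable; 3 bounds the leftover constant
  -- e^(a/2).
  have hexp : Real.exp (-(a * y)) * Real.exp (a / 4 * (y + 1)) ≤
      3 * Real.exp (-(a / 2 * (n : ℝ) ^ (1 / 2 : ℝ))) * Real.exp (-(a / 4 * (y + 1))) := by
    have h6 : (n : ℝ) ^ (1 / 2 : ℝ) ≤ y := half_rpow_le hs2 n
    have h7 : Real.exp (a / 2) ≤ 3 := by
      have h8 := Real.exp_one_lt_d9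
      have h9 : Real.exp (a / 2) ≤ Real.exp 1 := Real.exp_le_exp.2 (by linarith)
      linarith
    calc _ = Real.exp (a / 2) * Real.exp (-(a / 2 * y)) * Real.exp (-(a / 4 * (y + 1))) := by
          rw [← Real.exp_add, ← Real.exp_add, ← Real.exp_add]
          congr 1
          ring
      _ ≤ _ := by
          gcongr
  rw [density, Set.indicator_of_mem hζ, norm_mul, norm_neg, norm_div, norm_mul, norm_pow,
    Complex.norm_real, Complex.norm_real, Real.norm_of_nonneg Real.pi_pos.le,
    Real.norm_of_nonneg (by positivity)]
  calc Real.pi * ‖c n‖ / volume.real (annulus (1 + δ) (1 + 2 * δ)) * ‖ζ‖ ^ (n + 1)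
      ≤ Real.pi * (K * Real.exp (-(a * y))) / (2 * Real.pi * δ) * Real.exp (a / 4 * (y + 1)) := by
        have := hc n
        have := Real.pi_pos
        gcongr
    _ = K / 2 * (1 / δ) * (Real.exp (-(a * y)) * Real.exp (a / 4 * (y + 1))) := by
        have := Real.pi_pos.ne'
        field_simp
    _ ≤ K / 2 * (8 * K * ((n : ℝ) + 1)) * (3 * Real.exp (-(a / 2 * (n : ℝ) ^ (1 / 2 : ℝ))) *
          rho β (32 * K ^ 2 * (‖ζ‖ - 1))) := by
        exact mul_le_mul (by gcongr) (hexp.trans (by gcongr)) (by positivity) (by positivity)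
    _ = _ := by ring

end

lemma summable_densityBound {K : ℝ} (hK : 1 ≤ K) :
    Summable fun n : ℕ => 12 * K ^ 2 * (((n : ℝ) + 1) *
        Real.exp (-(K⁻¹ / 2 * (n : ℝ) ^ (1 / 2 : ℝ)))) := by
  have hK0 : 0 < K := by linarith
  have h1 := summable_pow_mul_exp_sqrt (a := K⁻¹ / 2) (by positivity) 1
  have h0 := summable_pow_mul_exp_sqrt (a := K⁻¹ / 2) (by positivity) 0
  refine ((h1.add h0).mul_left (12 * K ^ 2)).congr fun n => ?_
  ring

lemma rho_le_one {β x : ℝ} (hx : 0 ≤ x) : rho β x ≤ 1 := by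
  rw [rho, Real.exp_le_one_iff, neg_nonpos]
  positivity

lemma exists_density {β K : ℝ} (hβ : 0 ≤ β) (hK : 1 ≤ K) {c : ℕ → ℂ}
    (hc : ∀ n : ℕ, ‖c n‖ ≤ K * Real.exp (-(K⁻¹ * (n : ℝ) ^ ((1 + β) / (2 + β))))) :
    ∃ φ : ℂ → ℂ, Measurable φ ∧ (∀ z : ℂ, ¬ (1 ≤ ‖z‖ ∧ ‖z‖ < 2) → φ z = 0) ∧
      (∀ z : ℂ, 1 < ‖z‖ → ‖z‖ < 2 → ‖φ z‖ ≤ (∑' n : ℕ, 12 * K ^ 2 * (((n : ℝ) + 1) *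
        Real.exp (-(K⁻¹ / 2 * (n : ℝ) ^ (1 / 2 : ℝ))))) * rho β (32 * K ^ 2 * (‖z‖ - 1))) ∧
      ∀ k, cauchyCoeff φ k = c k := by
  have hK0 : 0 < K := by linarith
  have hκ : 0 < K⁻¹ / 8 := by positivity
  have hκ1 : K⁻¹ / 8 ≤ 1 / 8 := by
    have : K⁻¹ ≤ 1 := inv_le_one_of_one_le₀ hK
    linarith
  set B : ℕ → ℝ := fun n => 12 * K ^ 2 * (((n : ℝ) + 1) *
        Real.exp (-(K⁻¹ / 2 * (n : ℝ) ^ (1 / 2 : ℝ)))) with hB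
  have hBs : Summable B := summable_densityBound hK
  have hB0 : ∀ n, 0 ≤ B n := fun n => by simp only [hB]; positivity
  set D := density (K⁻¹ / 8) β c with hD
  have hout : ∀ n (z : ℂ), ¬ (1 < ‖z‖ ∧ ‖z‖ < 2) → D n z = 0 := by
    intro n z hz
    rw [hD, density, Set.indicator_of_notMem]
    intro h
    have h1 := width_pos (β := β) hκ n
    have h2 := width_le hκ hβ n
    exact hz ⟨by linarith [h.1], by linarith [h.2]⟩
  have hbd : ∀ n (z : ℂ), 1 < ‖z‖ → ‖D n z‖ ≤ B n * rho β (32 * K ^ 2 * (‖z‖ - 1)) := by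
    intro n z hz
    by_cases h : z ∈ annulus (1 + width (K⁻¹ / 8) β n) (1 + 2 * width (K⁻¹ / 8) β n)
    · exact norm_density_le hK hβ hc n h
    · rw [hD, density, Set.indicator_of_notMem h, norm_zero]
      have := hB0 n
      have : 0 ≤ rho β (32 * K ^ 2 * (‖z‖ - 1)) := (Real.exp_pos _).le
      positivity
  have hbd' : ∀ n (z : ℂ) (k : ℕ), ‖D n z / z ^ (k + 1)‖
      ≤ (Metric.ball (0 : ℂ) 2).indicator (fun _ => B n) z := by
    intro n z k
    by_cases h : 1 < ‖z‖ ∧ ‖z‖ < 2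
    · rw [Set.indicator_of_mem (by simpa using h.2), norm_div, norm_pow]
      have h1 : 1 ≤ ‖z‖ ^ (k + 1) := one_le_pow₀ h.1.le
      have hz1 : 0 ≤ ‖z‖ - 1 := by linarith [h.1]
      refine (div_le_self (norm_nonneg _) h1).trans ((hbd n z h.1).trans ?_)
      exact mul_le_of_le_one_right (hB0 n) (rho_le_one (by positivity))
    · rw [hout n z h]
      simp only [zero_div, norm_zero]
      exact Set.indicator_nonneg (fun _ _ => hB0 n) _
  refine ⟨fun z => ∑' n, D n z, Measurable.tsum fun n => measurable_density n, ?_, ?_, ?_⟩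
  · intro z hz
    simp [fun n => hout n z fun h => hz ⟨h.1.le, h.2⟩]
  · intro z hz _
    rw [← tsum_mul_right]
    exact tsum_of_norm_bounded (hBs.mul_right _).hasSum fun n => hbd n z hz
  · intro k
    have hint : ∀ n, Integrable fun z => D n z / z ^ (k + 1) := fun n =>
      (integrable_indicator_ball (B n)).mono'
        ((measurable_density n).div (measurable_id.pow_const _)).aestronglyMeasurable
        (Filter.Eventually.of_forall fun z => hbd' n z k)
    have hS : Summable fun n => ∫ z, ‖D n z / z ^ (k + 1)‖ := by
      refine .of_nonneg_of_le (fun n => integral_nonneg fun _ => norm_nonneg _) (fun n => ?_)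
        (hBs.mul_left (4 * Real.pi))
      rw [← integral_indicator_ball]
      exact integral_mono (hint n).norm (integrable_indicator_ball _) fun z => hbd' n z k
    have h := (hasSum_integral_of_summable_integral_norm hint hS).tsum_eq
    rw [cauchyCoeff]
    have h2 : ∫ z, (∑' n, D n z) / z ^ (k + 1) = ∑' n, ∫ z, D n z / z ^ (k + 1) := by
      rw [h]
      congr 1
      ext z
      rw [tsum_div_const]
    rw [h2]
    simp_rw [hD, integral_density_div_pow hκ]
    rw [tsum_ite_eq]
    have : (Real.pi : ℂ) ≠ 0 := by exact_mod_cast Real.pi_ne_zero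
    field_simp

/-- Functions with decaying Taylor coefficients are Cauchy transforms. -/
lemma exists_classC_of_classA {K : ℝ} (hK : 1 ≤ K) : ∃ K' : ℝ, 1 ≤ K' ∧ ∀ β : ℝ, 0 ≤ β →
    ∀ f : ℂ → ℂ, ClassAComparable K β f → ClassCComparable K' β f := by
  set B := ∑' n : ℕ, 12 * K ^ 2 * (((n : ℝ) + 1) *
        Real.exp (-(K⁻¹ / 2 * (n : ℝ) ^ (1 / 2 : ℝ)))) with hB
  have hK0 : 0 < K := by linarith
  have hB1 : 1 ≤ B := by
    have h := (summable_densityBound hK).le_tsum 0 fun n _ => by positivity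
    rw [← hB] at h
    refine le_trans ?_ h
    rw [Nat.cast_zero, Real.zero_rpow (by norm_num)]
    simp only [mul_zero, neg_zero, Real.exp_zero]
    nlinarith
  have hKB : 1 ≤ 32 * K ^ 2 := by nlinarith
  refine ⟨32 * K ^ 2 + B, by linarith, fun β hβ f hf => ?_⟩
  obtain ⟨a, ⟨ha1, ha2⟩, a', ⟨ha1', ha2'⟩, hA⟩ := hf
  have ha0 : 0 < a := (inv_pos.2 hK0).trans_le ha1
  have hc : ∀ n : ℕ, ‖taylorCoeff f n‖
      ≤ K * Real.exp (-(K⁻¹ * (n : ℝ) ^ ((1 + β) / (2 + β)))) := fun n =>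
    (hA.coeff_le n).trans (by gcongr)
  obtain ⟨φ, hm, h0, hb, hφ⟩ := exists_density hβ hK hc
  have hinv : (32 * K ^ 2 + B)⁻¹ ≤ 1 := inv_le_one_of_one_le₀ (by linarith)
  refine ⟨32 * K ^ 2, ⟨by linarith, by linarith⟩, B, ⟨by linarith, by linarith⟩, φ, hm, h0, hb,
    fun z hz => ?_⟩
  rw [hA.eqOn_psum hβ ha0 hz, cauchyTransform_eq_psum hβ hKB (by positivity) le_rfl
    (by linarith) hm h0 hb (mem_closedDisc.1 hz)]
  congr 1
  ext k
  exact (hφ k).symm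

end Gevrey

namespace Gevrey

open MeasureTheory

/-! ### Division by zeros -/

lemma sum_range_choose_eq (k m : ℕ) : ∑ i ∈ Finset.range k, i.choose m = k.choose (m + 1) := by
  induction k with
  | zero => simp
  | succ k ih => rw [Finset.sum_range_succ, ih, Nat.choose_succ_succ' k m, add_comm]

/-- After interchanging the sums, |c_k| is weighted by ∑_{i<k} C(i,m) = C(k,m+1). Binomial moments
are chosen because division then raises the order by one without any constant. -/
lemma moment_quotCoeff_le (m : ℕ) {a : ℂ} (ha : ‖a‖ ≤ 1) (c : ℕ → ℂ) :
    moment m (quotCoeff a c) ≤ moment (m + 1) c := by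
  have h1 : ∀ i, ‖quotCoeff a c i‖ₑ ≤ ∑' k, if i < k then ‖c k‖ₑ else 0 := by
    intro i
    calc ‖quotCoeff a c i‖ₑ ≤ ∑' j, ‖c (i + 1 + j) * a ^ j‖ₑ := enorm_tsum_le_tsum_enorm
      _ ≤ ∑' j, ‖c (i + 1 + j)‖ₑ := by
          refine ENNReal.tsum_le_tsum fun j => ?_
          rw [enorm_mul, enorm_pow]
          refine mul_le_of_le_one_right' (pow_le_one₀ zero_le (?_ : ‖a‖ₑ ≤ 1))
          rw [← ofReal_norm]
          exact ENNReal.ofReal_le_one.2 ha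
      _ = ∑' j, (fun k => if i < k then ‖c k‖ₑ else 0) (i + 1 + j) := by
          refine tsum_congr fun j => ?_
          simp only
          rw [if_pos (by omega)]
      _ ≤ _ := ENNReal.tsum_comp_le_tsum_of_injective (add_right_injective (i + 1)) _
  calc moment m (quotCoeff a c)
      ≤ ∑' i, ∑' k, (i.choose m : ENNReal) * (if i < k then ‖c k‖ₑ else 0) := by
        refine ENNReal.tsum_le_tsum fun i => ?_
        rw [ENNReal.tsum_mul_left]
        gcongr
        exact h1 i
    _ = ∑' k, ∑' i, (i.choose m : ENNReal) * (if i < k then ‖c k‖ₑ else 0) := ENNReal.tsum_comm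
    _ = moment (m + 1) c := by
        refine tsum_congr fun k => ?_
        rw [tsum_eq_sum (s := Finset.range k), ← sum_range_choose_eq, Nat.cast_sum, Finset.sum_mul]
        · refine Finset.sum_congr rfl fun i hi => ?_
          rw [if_pos (Finset.mem_range.1 hi)]
        · intro i hi
          rw [if_neg (fun h => hi (Finset.mem_range.2 h)), mul_zero]

lemma Rapid.quotCoeff {c : ℕ → ℂ} (hc : Rapid c) {a : ℂ} (ha : ‖a‖ ≤ 1) :
    Rapid (quotCoeff a c) := fun m =>
  ne_top_of_le_ne_top (hc (m + 1)) (moment_quotCoeff_le m ha c)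

lemma Rapid.summable_shift {c : ℕ → ℂ} (hc : Rapid c) {a : ℂ} (ha : ‖a‖ ≤ 1) (i : ℕ) :
    Summable fun j => c (i + j) * a ^ j := by
  have h : Summable fun j => ‖c (i + j)‖ := by
    have := (summable_nat_add_iff i).2 hc.summable_norm
    simpa only [add_comm] using this
  exact .of_norm_bounded h fun j => norm_mul_pow_le (fun j => c (i + j)) ha j

lemma quotCoeff_succ {c : ℕ → ℂ} (hc : Rapid c) {a : ℂ} (ha : ‖a‖ ≤ 1) (i : ℕ) :
    a * quotCoeff a c (i + 1) = quotCoeff a c i - c (i + 1) := by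
  rw [quotCoeff, quotCoeff, (hc.summable_shift ha (i + 1)).tsum_eq_zero_add, ← tsum_mul_left]
  simp only [add_zero, pow_zero, mul_one, add_sub_cancel_left]
  refine tsum_congr fun j => ?_
  rw [show i + 1 + 1 + j = i + 1 + (j + 1) by ring]
  ring

lemma quotCoeff_zero {c : ℕ → ℂ} (hc : Rapid c) {a : ℂ} (ha : ‖a‖ ≤ 1) :
    a * quotCoeff a c 0 = psum c a - c 0 := by
  rw [quotCoeff, psum, (hc.summable ha).tsum_eq_zero_add, ← tsum_mul_left]
  simp only [pow_zero, mul_one, add_sub_cancel_left]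
  refine tsum_congr fun j => ?_
  rw [show 0 + 1 + j = j + 1 by ring]
  ring

lemma psum_sub_psum {c : ℕ → ℂ} (hc : Rapid c) {a w : ℂ} (ha : ‖a‖ ≤ 1) (hw : ‖w‖ ≤ 1) :
    psum c w - psum c a = (w - a) * psum (quotCoeff a c) w := by
  have hq := (hc.quotCoeff ha).summable hw
  have h1 : a * psum (quotCoeff a c) w
      = psum c a - psum c w + w * psum (quotCoeff a c) w := by
    have s1 := (summable_nat_add_iff 1).2 (hc.summable hw)
    have e1 : a * psum (quotCoeff a c) w = a * quotCoeff a c 0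
        + ∑' i, (w * (quotCoeff a c i * w ^ i) - c (i + 1) * w ^ (i + 1)) := by
      rw [psum, hq.tsum_eq_zero_add, mul_add, ← tsum_mul_left, pow_zero, mul_one]
      congr 1
      refine tsum_congr fun i => ?_
      rw [← mul_assoc, quotCoeff_succ hc ha]
      ring
    rw [e1, (hq.mul_left w).tsum_sub s1, tsum_mul_left, quotCoeff_zero hc ha]
    have e2 : psum c w = c 0 + ∑' i, c (i + 1) * w ^ (i + 1) := by
      rw [psum, (hc.summable hw).tsum_eq_zero_add]
      simp
    rw [e2]
    change psum c a - c 0 + (w * psum (quotCoeff a c) w - _) = _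
    ring
  linear_combination h1

lemma Rapid.iterate_derivCoeff {c : ℕ → ℂ} (hc : Rapid c) (n : ℕ) :
    Rapid (Gevrey.derivCoeff^[n] c) := by
  induction n generalizing c with
  | zero => exact hc
  | succ n ih => exact ih hc.derivCoeff

lemma Rapid.iteratedDerivWithin_psum {c : ℕ → ℂ} (hc : Rapid c) (n : ℕ) {z : ℂ}
    (hz : z ∈ closedDisc) :
    iteratedDerivWithin n (psum c) closedDisc z = psum (Gevrey.derivCoeff^[n] c) z := by
  induction n generalizing z with
  | zero => simp
  | succ n ih =>
    rw [iteratedDerivWithin_succ, Function.iterate_succ_apply',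
      ← (hc.iterate_derivCoeff n).derivWithin_psum hz]
    exact derivWithin_congr (fun w hw => ih hw) (ih hz)

/-- The power series vanishes at `z` to the order at least `k`. -/
def VanishTo (c : ℕ → ℂ) (z : ℂ) (k : ℕ) : Prop := ∀ i < k, psum (derivCoeff^[i] c) z = 0

/-- This is the Leibniz rule for a linear factor. It shows how division by w - a changes the order
of vanishing at `a` and at the other points. -/
lemma psum_derivCoeff_of_mul {c c' : ℕ → ℂ} (hc : Rapid c) (hc' : Rapid c') {a : ℂ}
    (h : ∀ w ∈ closedDisc, psum c w = (w - a) * psum c' w) (n : ℕ) :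
    ∀ w ∈ closedDisc, psum (derivCoeff^[n + 1] c) w
      = (w - a) * psum (derivCoeff^[n + 1] c') w + (n + 1) * psum (derivCoeff^[n] c') w := by
  induction n with
  | zero =>
    intro w hw
    have h1 := (hc.hasDerivWithinAt_psum (mem_closedDisc.1 hw)).congr_of_mem
      (fun w hw => (h w hw).symm) hw
    have h2 := ((hasDerivWithinAt_id w closedDisc).sub_const a).mul
      (hc'.hasDerivWithinAt_psum (mem_closedDisc.1 hw))
    have h3 := (uniqueDiffOn_closedDisc w hw).eq_deriv _ h1 h2
    simp only [zero_add, Function.iterate_one, Function.iterate_zero, id_eq, Nat.cast_zero]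
    rw [h3]
    simp only [id]
    ring
  | succ n ih =>
    intro w hw
    have h1 := ((hc.iterate_derivCoeff (n + 1)).hasDerivWithinAt_psum
      (mem_closedDisc.1 hw)).congr_of_mem (fun w hw => (ih w hw).symm) hw
    have h2 := (((hasDerivWithinAt_id w closedDisc).sub_const a).mul
      ((hc'.iterate_derivCoeff (n + 1)).hasDerivWithinAt_psum (mem_closedDisc.1 hw))).add
      (((hc'.iterate_derivCoeff n).hasDerivWithinAt_psum (mem_closedDisc.1 hw)).const_mul
        ((n : ℂ) + 1))
    have h3 := (uniqueDiffOn_closedDisc w hw).eq_deriv _ h1 h2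
    simp only [← Function.iterate_succ_apply' derivCoeff] at h3
    rw [h3]
    push_cast
    simp only [id]
    ring

lemma VanishTo.quot_of_ne {c c' : ℕ → ℂ} (hc : Rapid c) (hc' : Rapid c') {a : ℂ}
    (h : ∀ w ∈ closedDisc, psum c w = (w - a) * psum c' w) {z : ℂ} (hz : z ∈ closedDisc)
    (hza : z ≠ a) {k : ℕ} (hv : VanishTo c z k) : VanishTo c' z k := by
  intro i
  induction i with
  | zero =>
    intro hi
    have h1 := hv 0 hi
    rw [Function.iterate_zero, id_eq, h z hz] at h1
    exact (mul_eq_zero.1 h1).resolve_left (sub_ne_zero.2 hza)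
  | succ i ih =>
    intro hi
    have h1 := hv (i + 1) hi
    rw [psum_derivCoeff_of_mul hc hc' h i z hz, ih (by omega), mul_zero, add_zero] at h1
    exact (mul_eq_zero.1 h1).resolve_left (sub_ne_zero.2 hza)

lemma VanishTo.quot_self {c c' : ℕ → ℂ} (hc : Rapid c) (hc' : Rapid c') {a : ℂ}
    (h : ∀ w ∈ closedDisc, psum c w = (w - a) * psum c' w) (ha : a ∈ closedDisc)
    {k : ℕ} (hv : VanishTo c a (k + 1)) : VanishTo c' a k := by
  intro i hi
  have h1 := hv (i + 1) (by omega)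
  rw [psum_derivCoeff_of_mul hc hc' h i a ha, sub_self, zero_mul, zero_add] at h1
  refine (mul_eq_zero.1 h1).resolve_left ?_
  exact_mod_cast Nat.succ_ne_zero i

open scoped Classical in
/-- `Z` is a multiset of zeros of the power series in the closed disc, counted with multiplicity. -/
def ZerosOf (c : ℕ → ℂ) (Z : Multiset ℂ) : Prop :=
  (∀ z ∈ Z, z ∈ closedDisc) ∧ ∀ z ∈ Z, VanishTo c z (Z.count z)

lemma ZerosOf.mono {c : ℕ → ℂ} {Z Z' : Multiset ℂ} (hZ : ZerosOf c Z) (h : Z' ≤ Z) :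
    ZerosOf c Z' := by
  classical
  refine ⟨fun z hz => hZ.1 z (Multiset.mem_of_le h hz), fun z hz i hi => ?_⟩
  exact hZ.2 z (Multiset.mem_of_le h hz) i (hi.trans_le (Multiset.count_le_of_le z h))

lemma ZerosOf.exists_quot {c : ℕ → ℂ} (hc : Rapid c) {Z : Multiset ℂ} (hZ : ZerosOf c Z) :
    ∃ c', Rapid c' ∧ moment 0 c' ≤ moment (Multiset.card Z) c ∧
      ∀ w ∈ closedDisc, psum c w = (Z.map fun z => w - z).prod * psum c' w := by
  classical
  -- Each division uses one moment, so the induction needs the estimate for every order `m`.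
  suffices H : ∃ c', Rapid c' ∧ (∀ m, moment m c' ≤ moment (m + Multiset.card Z) c) ∧
      ∀ w ∈ closedDisc, psum c w = (Z.map fun z => w - z).prod * psum c' w by
    obtain ⟨c', h1, h2, h3⟩ := H
    exact ⟨c', h1, by simpa using h2 0, h3⟩
  induction Z using Multiset.induction generalizing c with
  | empty => exact ⟨c, hc, by simp, by simp⟩
  | cons a Z ih =>
    have ha := hZ.1 a (Multiset.mem_cons_self a Z)
    have ha' := mem_closedDisc.1 ha
    have hva := hZ.2 a (Multiset.mem_cons_self a Z)
    rw [Multiset.count_cons_self] at hva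
    have h0 : psum c a = 0 := by simpa using hva 0 (Nat.succ_pos _)
    have hq := hc.quotCoeff ha'
    have hmul : ∀ w ∈ closedDisc, psum c w = (w - a) * psum (quotCoeff a c) w := by
      intro w hw
      rw [← psum_sub_psum hc ha' (mem_closedDisc.1 hw), h0, sub_zero]
    have hZ' : ZerosOf (quotCoeff a c) Z := by
      refine ⟨fun z hz => hZ.1 z (Multiset.mem_cons_of_mem hz), fun z hz => ?_⟩
      have hzD := hZ.1 z (Multiset.mem_cons_of_mem hz)
      by_cases hza : z = a
      · subst hza
        exact VanishTo.quot_self hc hq hmul ha hva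
      · have hvz := hZ.2 z (Multiset.mem_cons_of_mem hz)
        rw [Multiset.count_cons_of_ne hza] at hvz
        exact VanishTo.quot_of_ne hc hq hmul hzD hza hvz
    obtain ⟨c', h1, h2, h3⟩ := ih hq hZ'
    refine ⟨c', h1, fun m => ?_, fun w hw => ?_⟩
    · rw [Multiset.card_cons]
      refine (h2 m).trans ((moment_quotCoeff_le _ ha' c).trans_eq ?_)
      rfl
    · rw [hmul w hw, h3 w hw, Multiset.map_cons, Multiset.prod_cons, mul_assoc]

lemma norm_multiset_prod (Z : Multiset ℂ) (g : ℂ → ℂ) :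
    ‖(Z.map g).prod‖ = (Z.map fun z => ‖g z‖).prod := by
  induction Z using Multiset.induction with
  | empty => simp
  | cons a Z ih => simp [ih]

lemma multiset_prod_le_pow (Z : Multiset ℂ) (g : ℂ → ℝ) (B : ℝ) (h0 : ∀ z ∈ Z, 0 ≤ g z)
    (hB : ∀ z ∈ Z, g z ≤ B) : (Z.map g).prod ≤ B ^ Multiset.card Z := by
  induction Z using Multiset.induction with
  | empty => simp
  | cons a Z ih =>
    have ha0 := h0 a (Multiset.mem_cons_self a Z)
    have haB := hB a (Multiset.mem_cons_self a Z)
    rw [Multiset.map_cons, Multiset.prod_cons, Multiset.card_cons, pow_succ']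
    refine mul_le_mul haB (ih (fun z hz => h0 z (Multiset.mem_cons_of_mem hz))
      fun z hz => hB z (Multiset.mem_cons_of_mem hz)) ?_ (ha0.trans haB)
    refine Multiset.prod_nonneg fun x hx => ?_
    obtain ⟨z, hz, rfl⟩ := Multiset.mem_map.1 hx
    exact h0 z (Multiset.mem_cons_of_mem hz)

/-- A function with many zeros near a point is small there. -/
lemma ZerosOf.norm_psum_le {c : ℕ → ℂ} (hc : Rapid c) {Z : Multiset ℂ} (hZ : ZerosOf c Z)
    {w : ℂ} (hw : ‖w‖ ≤ 1) {B : ℝ} (hB : ∀ z ∈ Z, ‖w - z‖ ≤ B) :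
    ‖psum c w‖ ≤ B ^ Multiset.card Z * (moment (Multiset.card Z) c).toReal := by
  obtain ⟨c', h1, h2, h3⟩ := hZ.exists_quot hc
  rw [h3 w (mem_closedDisc.2 hw), norm_mul, norm_multiset_prod]
  refine mul_le_mul (multiset_prod_le_pow Z _ B (fun _ _ => norm_nonneg _) hB)
    ((h1.norm_psum_le hw).trans (ENNReal.toReal_mono (hc _) h2)) (norm_nonneg _) ?_
  by_cases hZ0 : Z = 0
  · simp [hZ0]
  · obtain ⟨z, hz⟩ := Multiset.exists_mem_of_ne_zero hZ0
    exact pow_nonneg ((norm_nonneg _).trans (hB z hz)) _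

lemma norm_sub_eq_of_norm_eq_one {w z : ℂ} (hw : ‖w‖ = 1) :
    ‖w - z‖ = ‖1 - (starRingEnd ℂ) z * w‖ := by
  have h1 : w * (starRingEnd ℂ) w = 1 := by
    rw [Complex.mul_conj, Complex.normSq_eq_norm_sq, hw]
    norm_num
  calc ‖w - z‖ = ‖(starRingEnd ℂ) (w - z)‖ * ‖w‖ := by rw [hw, mul_one, Complex.norm_conj]
    _ = ‖1 - (starRingEnd ℂ) z * w‖ := by
        rw [← norm_mul, map_sub, sub_mul, mul_comm _ w, h1]

/-- An inequality of Jensen type. -/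
lemma ZerosOf.norm_psum_zero_le {c : ℕ → ℂ} (hc : Rapid c) {Z : Multiset ℂ} (hZ : ZerosOf c Z)
    {S : ℝ} (hS : ∀ w : ℂ, ‖w‖ ≤ 1 → ‖psum c w‖ ≤ S) :
    ‖psum c 0‖ ≤ S * (Z.map fun z => ‖z‖).prod := by
  obtain ⟨c', h1, -, h3⟩ := hZ.exists_quot hc
  have hcont : ContinuousOn (fun w => (Z.map fun z => 1 - (starRingEnd ℂ) z * w).prod * psum c' w)
      closedDisc := by
    refine ContinuousOn.mul (Continuous.continuousOn ?_) h1.continuousOn_psum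
    exact continuous_multiset_prod Z fun z _ => by fun_prop
  have hdiff : DifferentiableOn ℂ
      (fun w => (Z.map fun z => 1 - (starRingEnd ℂ) z * w).prod * psum c' w)
      (Metric.ball 0 1) := by
    refine DifferentiableOn.mul (Differentiable.differentiableOn ?_)
      h1.analyticOnNhd_psum.differentiableOn
    clear hZ h3 hcont
    induction Z using Multiset.induction with
    | empty => simp
    | cons a Z ih =>
      simp only [Multiset.map_cons, Multiset.prod_cons]
      exact Differentiable.mul (by fun_prop) ih
  -- Replacing each factor w - z by 1 - z̄w does not change the modulus on the circle, and the new
  -- factors equal 1 at the origin; the maximum principle then applies.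
  have hbd : ‖(Z.map fun z => 1 - (starRingEnd ℂ) z * 0).prod * psum c' 0‖ ≤ S := by
    refine Complex.norm_le_of_forall_mem_frontier_norm_le (U := Metric.ball (0 : ℂ) 1)
      Metric.isBounded_ball
      (f := fun w => (Z.map fun z => 1 - (starRingEnd ℂ) z * w).prod * psum c' w)
      ⟨hdiff, ?_⟩ ?_ (subset_closure (by simp))
    · rw [closure_ball _ one_ne_zero]
      exact hcont
    · intro w hw
      rw [frontier_ball _ one_ne_zero, mem_sphere_zero_iff_norm] at hw
      refine le_trans (le_of_eq ?_) (hS w hw.le)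
      rw [h3 w (mem_closedDisc.2 hw.le), norm_mul, norm_mul, norm_multiset_prod,
        norm_multiset_prod]
      simp_rw [norm_sub_eq_of_norm_eq_one hw]
  simp only [mul_zero, sub_zero, Multiset.map_const', Multiset.prod_replicate, one_pow,
    one_mul] at hbd
  rw [h3 0 (mem_closedDisc.2 (by simp)), norm_mul, norm_multiset_prod, mul_comm]
  simp only [zero_sub, norm_neg]
  gcongr
  exact Multiset.prod_nonneg fun x hx => by
    obtain ⟨z, -, rfl⟩ := Multiset.mem_map.1 hx
    exact norm_nonneg z

/-- To bound the number of zeros, it suffices to bound the size of multisets of zeros. -/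
lemma zeroCount_le {f : ℂ → ℂ} {c : ℕ → ℂ} (hc : Rapid c) (hf : Set.EqOn f (psum c) closedDisc)
    {B : ℝ} (hB : ∀ Z, ZerosOf c Z → (Multiset.card Z : ℝ) ≤ B) :
    zeroCount f ≤ ENNReal.ofReal B := by
  classical
  have hB0 : 0 ≤ B := by
    simpa using hB 0 ⟨by simp, by simp⟩
  -- Any finite choice of points, with multiplicities not exceeding the orders of vanishing, forms a
  -- multiset of zeros.
  have key : ∀ (F : Finset closedDisc) (k : closedDisc → ℕ),
      (∀ z ∈ F, (k z : ℕ∞) ≤ zeroMult f z) → ((∑ z ∈ F, k z : ℕ) : ENNReal) ≤ ENNReal.ofReal B := by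
    intro F k hk
    set Z : Multiset ℂ := ∑ z ∈ F, Multiset.replicate (k z) (z : ℂ) with hZ
    have hcount : ∀ z ∈ F, Z.count (z : ℂ) = k z := by
      intro z hz
      rw [hZ, Multiset.count_sum', Finset.sum_eq_single z]
      · simp
      · intro b _ hbz
        rw [Multiset.count_replicate, if_neg]
        exact fun h => hbz (Subtype.ext h)
      · intro h
        exact absurd hz h
    have hmem : ∀ z ∈ Z, ∃ w ∈ F, (w : ℂ) = z := by
      intro z hz
      rw [hZ, Multiset.mem_sum] at hz
      obtain ⟨w, hw, hzw⟩ := hz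
      exact ⟨w, hw, (Multiset.eq_of_mem_replicate hzw).symm⟩
    have hZz : ZerosOf c Z := by
      constructor
      · intro z hz
        obtain ⟨w, -, rfl⟩ := hmem z hz
        exact w.2
      · intro z hz
        obtain ⟨w, hw, rfl⟩ := hmem z hz
        rw [hcount w hw]
        intro i hi
        rw [← hc.iteratedDerivWithin_psum i w.2]
        rw [← iteratedDerivWithin_congr hf w.2]
        by_contra hne
        have h1 : zeroMult f w ≤ i := iInf₂_le i hne
        have h2 := (hk w hw).trans h1
        exact absurd (by exact_mod_cast h2) (not_le.2 hi)
    have h := hB Z hZz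
    have hcard : Multiset.card Z = ∑ z ∈ F, k z := by
      simp [hZ]
    rw [← ENNReal.ofReal_natCast, ← hcard]
    exact ENNReal.ofReal_le_ofReal h
  have hfin : ∀ z : closedDisc, zeroMult f z ≠ ⊤ := by
    intro z hz
    obtain ⟨M, hM⟩ := exists_nat_gt B
    -- At a zero of infinite order any multiplicity is allowed, in particular one above the bound.
    have h := key {z} (fun _ => M) (by simp [hz])
    rw [Finset.sum_singleton, ← ENNReal.ofReal_natCast] at h
    exact absurd ((ENNReal.ofReal_le_ofReal_iff hB0).1 h) (not_le.2 hM)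
  rw [zeroCount, ENNReal.tsum_eq_iSup_sum]
  refine iSup_le fun F => ?_
  have h := key F (fun z => (zeroMult f z).toNat) (fun z _ => by rw [ENat.natCast_toNat (hfin z)])
  refine le_trans (le_of_eq ?_) h
  rw [Nat.cast_sum]
  refine Finset.sum_congr rfl fun z _ => ?_
  conv_lhs => rw [← ENat.natCast_toNat (hfin z)]
  simp

end Gevrey

namespace Gevrey

open MeasureTheory

/-! ### Smallness near clusters of zeros -/

/-- A common bound for the functions of the class. -/
noncomputable def supBound (K : ℝ) : ℝ := K * ∑' k : ℕ, Real.exp (-(K⁻¹ / 2 * (k : ℝ) ^ (1 / 2 : ℝ)))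

lemma summable_supBound {K : ℝ} (hK : 1 ≤ K) :
    Summable fun k : ℕ => Real.exp (-(K⁻¹ / 2 * (k : ℝ) ^ (1 / 2 : ℝ))) := by
  have hK0 : 0 < K := by linarith
  simpa using summable_pow_mul_exp_sqrt (a := K⁻¹ / 2) (by positivity) 0

lemma one_le_supBound {K : ℝ} (hK : 1 ≤ K) : 1 ≤ supBound K := by
  have h := (summable_supBound hK).le_tsum 0 fun n _ => by positivity
  rw [Nat.cast_zero, Real.zero_rpow (by norm_num), mul_zero, neg_zero, Real.exp_zero] at h
  rw [supBound]
  nlinarith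

/-- The decay condition on the coefficients. -/
def Decay (K β : ℝ) (c : ℕ → ℂ) : Prop :=
  ∀ k : ℕ, ‖c k‖ ≤ K * Real.exp (-(K⁻¹ * (k : ℝ) ^ ((1 + β) / (2 + β))))

lemma Decay.rapid {K β : ℝ} (hK : 1 ≤ K) (hβ : 0 ≤ β) {c : ℕ → ℂ} (hc : Decay K β c) : Rapid c :=
  rapid_of_exp_bound (inv_pos.2 (by linarith)) (half_le_exponent hβ) hc

/-- With t the exponent on the left, k^s is (2Kn/s)·(st/n). The inequality u ≤ e^u at u = st/n,
raised to the power n/s, gives k^n ≤ (4Kn)^(n/s) e^t. As 1/s = 1 + 1/(1+β), one factor n^n appears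
and is absorbed by n! at the cost of e^n. -/
lemma choose_mul_exp_le {K β : ℝ} (hK : 1 ≤ K) (hβ : 0 ≤ β) (n k : ℕ) :
    (k.choose n : ℝ) * Real.exp (-(K⁻¹ / 2 * (k : ℝ) ^ ((1 + β) / (2 + β))))
      ≤ (16 * Real.exp 1 * K ^ 2 * (n : ℝ) ^ (1 / (1 + β))) ^ n := by
  have hK0 : 0 < K := by linarith
  set s := (1 + β) / (2 + β) with hs
  have hs2 : 1 / 2 ≤ s := half_le_exponent hβ
  have hs0 : 0 < s := by linarith
  rcases Nat.eq_zero_or_pos n with rfl | hn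
  · simp only [Nat.choose_zero_right, Nat.cast_one, one_mul, pow_zero, Real.exp_le_one_iff]
    have : 0 ≤ K⁻¹ / 2 * (k : ℝ) ^ s := by positivity
    linarith
  have hn' : (0 : ℝ) < n := by exact_mod_cast hn
  set t := K⁻¹ / 2 * (k : ℝ) ^ s with ht
  have hk : (k : ℝ) ^ n ≤ ((16 * K ^ 2) * (n * (n : ℝ) ^ (1 / (1 + β)))) ^ n * Real.exp t := by
    have h1 : (k : ℝ) ^ s ≤ (4 * K * n) * Real.exp (s * t / n) := by
      have h2 : s * t / n ≤ Real.exp (s * t / n) := by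
        linarith [Real.add_one_le_exp (s * t / n)]
      have h3 : (k : ℝ) ^ s = (2 * K * n / s) * (s * t / n) := by
        rw [ht]
        field_simp
      rw [h3]
      have h4 : 2 * K * n / s ≤ 4 * K * n := by
        rw [div_le_iff₀ hs0]
        nlinarith [mul_pos hK0 hn']
      have h5 : 0 ≤ s * t / n := by positivity
      gcongr
    have h6 := Real.rpow_le_rpow (by positivity) h1 (show 0 ≤ 1 / s * n by positivity)
    rw [← Real.rpow_mul (by positivity), Real.mul_rpow (by positivity) (by positivity),
      ← Real.exp_mul] at h6
    have e1 : s * (1 / s * n) = n := by field_simp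
    have e2 : s * t / n * (1 / s * n) = t := by field_simp
    rw [e1, e2, Real.rpow_natCast, Real.rpow_mul (by positivity), Real.rpow_natCast] at h6
    refine h6.trans ?_
    gcongr
    rw [Real.mul_rpow (by positivity) (by positivity)]
    have e3 : (n : ℝ) ^ (1 / s) = n * (n : ℝ) ^ (1 / (1 + β)) := by
      rw [← Real.rpow_one_add' hn'.le (by positivity)]
      congr 1
      rw [hs]
      field_simp
      ring
    rw [e3]
    gcongr
    calc (4 * K) ^ (1 / s) ≤ (4 * K) ^ (2 : ℝ) := by
          apply Real.rpow_le_rpow_of_exponent_le (by linarith)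
          rw [div_le_iff₀ hs0]
          linarith
      _ = 16 * K ^ 2 := by
          rw [Real.rpow_two]
          ring
  have hfac : (0 : ℝ) < n.factorial := by exact_mod_cast n.factorial_pos
  have hchoose : (k.choose n : ℝ) ≤ (k : ℝ) ^ n / n.factorial := Nat.choose_le_pow_div n k
  have hexp : (n : ℝ) ^ n / n.factorial ≤ Real.exp 1 ^ n := by
    rw [← Real.exp_nat_mul, mul_one]
    exact Real.pow_div_factorial_le_exp _ hn'.le n
  calc (k.choose n : ℝ) * Real.exp (-t)
      ≤ ((16 * K ^ 2) * (n * (n : ℝ) ^ (1 / (1 + β)))) ^ n * Real.exp t / n.factorial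
        * Real.exp (-t) := by
        gcongr
        exact hchoose.trans (by gcongr)
    _ = (16 * K ^ 2 * (n : ℝ) ^ (1 / (1 + β))) ^ n * ((n : ℝ) ^ n / n.factorial) := by
        rw [Real.exp_neg, mul_left_comm (16 * K ^ 2), mul_pow (n : ℝ)]
        have := (Real.exp_pos t).ne'
        field_simp
    _ ≤ (16 * K ^ 2 * (n : ℝ) ^ (1 / (1 + β))) ^ n * Real.exp 1 ^ n := by
        gcongr
    _ = _ := by
        rw [← mul_pow]
        congr 1
        ring

/-- Half of the decay is kept for summability with a constant free of β. The other half pays for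
binomial weights, for growth outside the disc, or for the smallness of tails. -/
lemma Decay.exp_half_le {K β : ℝ} (hK : 1 ≤ K) (hβ : 0 ≤ β) {c : ℕ → ℂ} (hc : Decay K β c)
    (k : ℕ) : ‖c k‖ ≤ K * Real.exp (-(K⁻¹ / 2 * (k : ℝ) ^ (1 / 2 : ℝ))) *
      Real.exp (-(K⁻¹ / 2 * (k : ℝ) ^ ((1 + β) / (2 + β)))) := by
  have hK0 : 0 < K := by linarith
  refine (hc k).trans ?_
  rw [mul_assoc, ← Real.exp_add]
  gcongr
  have := mul_le_mul_of_nonneg_left (half_rpow_le (half_le_exponent hβ) k)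
    (show 0 ≤ K⁻¹ / 2 by positivity)
  linarith

lemma Decay.moment_le {K β : ℝ} (hK : 1 ≤ K) (hβ : 0 ≤ β) {c : ℕ → ℂ} (hc : Decay K β c) (n : ℕ) :
    (moment n c).toReal
      ≤ supBound K * (16 * Real.exp 1 * K ^ 2 * (n : ℝ) ^ (1 / (1 + β))) ^ n := by
  have hK0 : 0 < K := by linarith
  have hr := hc.rapid hK hβ
  set M := (16 * Real.exp 1 * K ^ 2 * (n : ℝ) ^ (1 / (1 + β))) ^ n with hM
  have h1 : (moment n c).toReal = ∑' k, (k.choose n : ℝ) * ‖c k‖ := by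
    rw [moment, ENNReal.tsum_toReal_eq (fun k => ?_)]
    · refine tsum_congr fun k => ?_
      simp [ENNReal.toReal_mul]
    · exact ENNReal.mul_ne_top (by simp) (by simp)
  rw [h1, supBound, ← tsum_mul_left, ← tsum_mul_right]
  refine (summable_choose_mul hr n).tsum_le_tsum (fun k => ?_)
    (((summable_supBound hK).mul_left K).mul_right M)
  calc (k.choose n : ℝ) * ‖c k‖
      ≤ (k.choose n : ℝ) * (K * Real.exp (-(K⁻¹ / 2 * (k : ℝ) ^ (1 / 2 : ℝ))) *
      Real.exp (-(K⁻¹ / 2 * (k : ℝ) ^ ((1 + β) / (2 + β))))) := by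
        gcongr
        exact hc.exp_half_le hK hβ k
    _ = K * Real.exp (-(K⁻¹ / 2 * (k : ℝ) ^ (1 / 2 : ℝ))) * ((k.choose n : ℝ) *
      Real.exp (-(K⁻¹ / 2 * (k : ℝ) ^ ((1 + β) / (2 + β))))) := by ring
    _ ≤ _ := by
        gcongr
        exact choose_mul_exp_le hK hβ n k

lemma Decay.norm_psum_le {K β : ℝ} (hK : 1 ≤ K) (hβ : 0 ≤ β) {c : ℕ → ℂ} (hc : Decay K β c)
    {w : ℂ} (hw : ‖w‖ ≤ 1) : ‖psum c w‖ ≤ supBound K := by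
  have h := ((hc.rapid hK hβ).norm_psum_le hw).trans (hc.moment_le hK hβ 0)
  simpa using h

/-- If there are `n` zeros in a neighbourhood of size `r`, where `n` is not too large, then the
function is of size `exp (-n)` there. -/
lemma Decay.norm_psum_le_exp {K β : ℝ} (hK : 1 ≤ K) (hβ : 0 ≤ β) {c : ℕ → ℂ} (hc : Decay K β c)
    {Z : Multiset ℂ} (hZ : ZerosOf c Z) {r : ℝ} (hr : 0 < r) {w : ℂ} (hw : ‖w‖ ≤ 1)
    (hwZ : ∀ z ∈ Z, ‖w - z‖ ≤ 2 * r)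
    (hn : (Multiset.card Z : ℝ) ≤ (256 * K ^ 2 * r) ^ (-(1 + β))) :
    ‖psum c w‖ ≤ supBound K * Real.exp (-(Multiset.card Z : ℝ)) := by
  have hK0 : 0 < K := by linarith
  have hS := one_le_supBound hK
  set n := Multiset.card Z with hn'
  refine (hZ.norm_psum_le (hc.rapid hK hβ) hw hwZ).trans ?_
  have h1 : (n : ℝ) ^ (1 / (1 + β)) ≤ (256 * K ^ 2 * r)⁻¹ := by
    calc (n : ℝ) ^ (1 / (1 + β)) ≤ ((256 * K ^ 2 * r) ^ (-(1 + β))) ^ (1 / (1 + β)) := by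
          gcongr
      _ = (256 * K ^ 2 * r)⁻¹ := by
          rw [← Real.rpow_mul (by positivity), ← Real.rpow_neg_one]
          congr 1
          field_simp
  -- The constant 256 makes the cost per zero at most e/8, which is below 1/e because e² < 8.
  have h2 : 2 * r * (16 * Real.exp 1 * K ^ 2 * (n : ℝ) ^ (1 / (1 + β))) ≤ Real.exp (-1) := by
    calc _ ≤ 2 * r * (16 * Real.exp 1 * K ^ 2 * (256 * K ^ 2 * r)⁻¹) := by gcongr
      _ = Real.exp 1 / 8 := by
          field_simp
          norm_num
      _ ≤ Real.exp (-1) := by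
          rw [Real.exp_neg, div_le_iff₀ (by norm_num), inv_mul_eq_div, le_div_iff₀ (Real.exp_pos 1)]
          nlinarith [Real.exp_one_lt_d9, Real.exp_pos 1]
  calc (2 * r) ^ n * (moment n c).toReal
      ≤ (2 * r) ^ n * (supBound K * (16 * Real.exp 1 * K ^ 2 * (n : ℝ) ^ (1 / (1 + β))) ^ n) := by
        gcongr
        exact hc.moment_le hK hβ n
    _ = supBound K * (2 * r * (16 * Real.exp 1 * K ^ 2 * (n : ℝ) ^ (1 / (1 + β)))) ^ n := by
        rw [mul_pow (2 * r)]
        ring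
    _ ≤ supBound K * Real.exp (-1) ^ n := by
        gcongr
    _ = _ := by
        rw [← Real.exp_nat_mul]
        congr 2
        ring

end Gevrey

namespace Gevrey

open MeasureTheory Polynomial

/-! ### The Poisson–Jensen inequality for polynomials -/

lemma continuousOn_poissonKernel {w : ℂ} (hw : ‖w‖ < 1) :
    ContinuousOn (poissonKernel 0 w) (Metric.sphere 0 |1|) := by
  rw [poissonKernel_eq_re_herglotzRieszKernel]
  exact Complex.continuous_re.comp_continuousOn
    (continuousOn_herglotzRieszKernel_sphere (by simpa using hw))

lemma continuous_poissonKernel_circleMap {w : ℂ} (hw : ‖w‖ < 1) :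
    Continuous fun θ => poissonKernel 0 w (circleMap 0 1 θ) := by
  have h := (continuousOn_poissonKernel hw).comp_continuous (continuous_circleMap 0 1)
    (fun θ => circleMap_mem_sphere' 0 1 θ)
  exact h

lemma circleIntegrable_log_norm_eval (p : ℂ[X]) :
    CircleIntegrable (fun z => Real.log ‖p.eval z‖) 0 1 := by
  have h : MeromorphicOn (fun z => p.eval z) (Metric.sphere (0 : ℂ) |1|) := fun z _ =>
    (p.differentiable.analyticAt z).meromorphicAt
  exact h.circleIntegrable_log_norm

lemma circleIntegrable_poissonKernel_mul {w : ℂ} (hw : ‖w‖ < 1) {g : ℂ → ℝ}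
    (hg : CircleIntegrable g 0 1) :
    CircleIntegrable (fun z => poissonKernel 0 w z * g z) 0 1 := by
  have h : IntervalIntegrable (fun θ => g (circleMap 0 1 θ)) volume 0 (2 * Real.pi) := hg
  exact h.continuousOn_mul (continuous_poissonKernel_circleMap hw).continuousOn

/-- The Poisson average of the logarithm of the modulus. -/
noncomputable def poissonLog (p : ℂ[X]) (w : ℂ) : ℝ :=
  Real.circleAverage (fun z => poissonKernel 0 w z * Real.log ‖p.eval z‖) 0 1

/-- Without zeros in the closed disc, log|p| is harmonic near it, so the Poisson formula is exact.
-/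
lemma poissonLog_eq_of_ne_zero {p : ℂ[X]} (hp : ∀ z : ℂ, ‖z‖ ≤ 1 → p.eval z ≠ 0) {w : ℂ}
    (hw : ‖w‖ < 1) : poissonLog p w = Real.log ‖p.eval w‖ := by
  have h : InnerProductSpace.HarmonicOnNhd (fun z => Real.log ‖p.eval z‖)
      (Metric.closedBall 0 1) := fun z hz =>
    (p.differentiable.analyticAt z).harmonicAt_log_norm (hp z (by simpa using hz))
  exact h.circleAverage_poissonKernel_smul (by simpa using hw)

lemma poissonLog_sub_C_of_norm_eq_one {b : ℂ} (hb : ‖b‖ = 1) {w : ℂ} (hw : ‖w‖ < 1) :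
    poissonLog (X - C b) w = Real.log ‖(X - C b).eval w‖ := by
  have h := circleAverage_re_herglotzRieszKernel_mul_log (c := 0) (R := 1) (ρ := b) (w := w)
    (by simpa using hb) (by simpa using hw)
  rw [← poissonKernel_eq_re_herglotzRieszKernel] at h
  simp only [poissonLog, eval_sub, eval_X, eval_C]
  exact h

/-- For |b| ≥ 1 this is the Poisson formula. For |b| < 1 the factor z - b is replaced by 1 - b̄z,
which has the same modulus on the circle, no zeros in the closed disc and a larger modulus inside.
-/
lemma norm_eval_sub_C_le {b w : ℂ} (hw : ‖w‖ < 1) :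
    ‖(X - C b).eval w‖ ≤ Real.exp (poissonLog (X - C b) w) := by
  rcases lt_trichotomy ‖b‖ 1 with hb | hb | hb
  · set q : ℂ[X] := 1 - C ((starRingEnd ℂ) b) * X with hq
    have hq0 : ∀ z : ℂ, ‖z‖ ≤ 1 → q.eval z ≠ 0 := by
      intro z hz h
      simp only [hq, eval_sub, eval_one, eval_mul, eval_C, eval_X] at h
      have h1 : ‖(starRingEnd ℂ) b * z‖ = 1 := by rw [← sub_eq_zero.1 h, norm_one]
      rw [norm_mul, Complex.norm_conj] at h1
      nlinarith [norm_nonneg b, norm_nonneg z]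
    have heq : poissonLog (X - C b) w = poissonLog q w := by
      apply Real.circleAverage_congr_sphere
      intro z hz
      rw [abs_one, mem_sphere_zero_iff_norm] at hz
      simp only [hq, eval_sub, eval_one, eval_mul, eval_C, eval_X]
      rw [norm_sub_eq_of_norm_eq_one hz]
    rw [heq, poissonLog_eq_of_ne_zero hq0 hw,
      Real.exp_log (norm_pos_iff.2 (hq0 w hw.le))]
    simp only [hq, eval_sub, eval_one, eval_mul, eval_C, eval_X]
    rw [← sq_le_sq₀ (norm_nonneg _) (norm_nonneg _), ← Complex.normSq_eq_norm_sq,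
      ← Complex.normSq_eq_norm_sq]
    have e : Complex.normSq (1 - (starRingEnd ℂ) b * w) - Complex.normSq (w - b)
        = (1 - Complex.normSq b) * (1 - Complex.normSq w) := by
      simp only [Complex.normSq_apply, Complex.sub_re, Complex.sub_im, Complex.mul_re,
        Complex.mul_im, Complex.conj_re, Complex.conj_im, Complex.one_re, Complex.one_im]
      ring
    have h1 : Complex.normSq b ≤ 1 := by
      rw [Complex.normSq_eq_norm_sq]
      nlinarith [norm_nonneg b]
    have h2 : Complex.normSq w ≤ 1 := by
      rw [Complex.normSq_eq_norm_sq]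
      nlinarith [norm_nonneg w]
    nlinarith
  · rw [poissonLog_sub_C_of_norm_eq_one hb hw]
    exact Real.le_exp_log _
  · rw [poissonLog_eq_of_ne_zero _ hw]
    · exact Real.le_exp_log _
    · intro z hz h
      simp only [eval_sub, eval_X, eval_C, sub_eq_zero] at h
      rw [h] at hz
      linarith

lemma ae_eval_circleMap_ne_zero {p : ℂ[X]} (hp : p ≠ 0) :
    ∀ᵐ θ : ℝ, p.eval (circleMap 0 1 θ) ≠ 0 := by
  have h : ({z | p.eval z = 0} : Set ℂ).Countable := by
    refine (p.roots.toFinset.finite_toSet.subset fun z hz => ?_).countable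
    simp only [Finset.mem_coe, Multiset.mem_toFinset]
    exact (mem_roots hp).2 hz
  exact (h.preimage_circleMap 0 one_ne_zero).ae_notMem volume

lemma poissonLog_mul {p q : ℂ[X]} (hp : p ≠ 0) (hq : q ≠ 0) {w : ℂ} (hw : ‖w‖ < 1) :
    poissonLog (p * q) w = poissonLog p w + poissonLog q w := by
  rw [poissonLog, poissonLog, poissonLog, ← Real.circleAverage_fun_add
    (circleIntegrable_poissonKernel_mul hw (circleIntegrable_log_norm_eval p))
    (circleIntegrable_poissonKernel_mul hw (circleIntegrable_log_norm_eval q)),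
    Real.circleAverage_def, Real.circleAverage_def]
  congr 1
  apply intervalIntegral.integral_congr_ae
  filter_upwards [ae_eval_circleMap_ne_zero hp, ae_eval_circleMap_ne_zero hq] with θ h1 h2 _
  rw [eval_mul, norm_mul, Real.log_mul (norm_ne_zero_iff.2 h1) (norm_ne_zero_iff.2 h2)]
  ring

/-- The Poisson–Jensen inequality for polynomials. -/
lemma norm_eval_le_exp_poissonLog {p : ℂ[X]} (hp : p ≠ 0) {w : ℂ} (hw : ‖w‖ < 1) :
    ‖p.eval w‖ ≤ Real.exp (poissonLog p w) := by
  -- The Poisson average of the logarithm is additive over products, so the roots can be treated one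
  -- at a time.
  have key : ∀ Z : Multiset ℂ, (C p.leadingCoeff * (Z.map fun a => X - C a).prod) ≠ 0 ∧
      ‖(C p.leadingCoeff * (Z.map fun a => X - C a).prod).eval w‖
        ≤ Real.exp (poissonLog (C p.leadingCoeff * (Z.map fun a => X - C a).prod) w) := by
    intro Z
    induction Z using Multiset.induction with
    | empty =>
      have hl : p.leadingCoeff ≠ 0 := leadingCoeff_ne_zero.2 hp
      simp only [Multiset.map_zero, Multiset.prod_zero, mul_one]
      refine ⟨by simpa using hl, ?_⟩
      rw [poissonLog_eq_of_ne_zero (fun z _ => by simpa using hl) hw]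
      exact Real.le_exp_log _
    | cons b Z ih =>
      have h : C p.leadingCoeff * ((b ::ₘ Z).map fun a => X - C a).prod
          = (X - C b) * (C p.leadingCoeff * (Z.map fun a => X - C a).prod) := by
        rw [Multiset.map_cons, Multiset.prod_cons]
        ring
      rw [h]
      refine ⟨mul_ne_zero (X_sub_C_ne_zero b) ih.1, ?_⟩
      rw [poissonLog_mul (X_sub_C_ne_zero b) ih.1 hw, eval_mul, norm_mul, Real.exp_add]
      exact mul_le_mul (norm_eval_sub_C_le hw) ih.2 (norm_nonneg _) (Real.exp_pos _).le
  have h := (key p.roots).2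
  rwa [← (IsAlgClosed.splits p).eq_prod_roots] at h

end Gevrey

namespace Gevrey

open MeasureTheory Polynomial

/-! ### Logarithmic mass on arcs -/

/-- `log (1 / |P|)` on the unit circle. -/
noncomputable def logInv (P : ℂ[X]) (θ : ℝ) : ℝ := -Real.log ‖P.eval (circleMap 0 1 θ)‖

/-- The integral of `log (1 / |P|)` over an arc. -/
noncomputable def mass (P : ℂ[X]) (θ₀ ρ : ℝ) : ℝ := ∫ θ in (θ₀ - ρ)..(θ₀ + ρ), logInv P θ

lemma intervalIntegrable_logInv (P : ℂ[X]) (a b : ℝ) :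
    IntervalIntegrable (logInv P) volume a b := by
  have h : MeromorphicOn (fun θ : ℝ => P.eval (circleMap 0 1 θ)) (Set.uIcc a b) := by
    intro θ _
    have h1 : AnalyticAt ℝ (fun z : ℂ => P.eval z) (circleMap 0 1 θ) :=
      (P.differentiable.analyticAt _).restrictScalars
    exact (h1.comp (analyticOnNhd_circleMap 0 1 θ (Set.mem_univ θ))).meromorphicAt
  exact h.intervalIntegrable_log_norm.neg

lemma norm_circleMap_zero_one (θ : ℝ) : ‖circleMap 0 1 θ‖ = 1 := by simp

lemma logInv_nonneg {P : ℂ[X]} (hP : ∀ z : ℂ, ‖z‖ ≤ 1 → ‖P.eval z‖ ≤ 1) (θ : ℝ) :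
    0 ≤ logInv P θ := by
  have := Real.log_nonpos (norm_nonneg _) (hP _ (norm_circleMap_zero_one θ).le)
  rw [logInv]
  linarith

lemma mass_mono {P : ℂ[X]} (hP : ∀ z : ℂ, ‖z‖ ≤ 1 → ‖P.eval z‖ ≤ 1) (θ₀ : ℝ) {ρ ρ' : ℝ}
    (h0 : 0 ≤ ρ) (h : ρ ≤ ρ') : mass P θ₀ ρ ≤ mass P θ₀ ρ' := by
  apply intervalIntegral.integral_mono_interval (by linarith) (by linarith) (by linarith)
    (Filter.Eventually.of_forall fun θ => logInv_nonneg hP θ) (intervalIntegrable_logInv P _ _)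

lemma mass_nonneg {P : ℂ[X]} (hP : ∀ z : ℂ, ‖z‖ ≤ 1 → ‖P.eval z‖ ≤ 1) (θ₀ : ℝ) {ρ : ℝ}
    (h0 : 0 ≤ ρ) : 0 ≤ mass P θ₀ ρ :=
  intervalIntegral.integral_nonneg (by linarith) fun θ _ => logInv_nonneg hP θ

lemma poissonKernel_nonneg {w : ℂ} (hw : ‖w‖ < 1) (θ : ℝ) :
    0 ≤ poissonKernel 0 w (circleMap 0 1 θ) := by
  rw [poissonKernel, sub_zero, sub_zero, norm_circleMap_zero_one]
  have : ‖w‖ ^ 2 ≤ 1 := by nlinarith [norm_nonneg w]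
  apply div_nonneg _ (by positivity)
  linarith

/-- A large logarithmic mass on an arc makes a polynomial small in the disc. -/
lemma norm_eval_le_exp_mass {P : ℂ[X]} (hP0 : P ≠ 0) (hP : ∀ z : ℂ, ‖z‖ ≤ 1 → ‖P.eval z‖ ≤ 1)
    {w : ℂ} (hw : ‖w‖ < 1) {θ₀ ρ l : ℝ} (hρ0 : 0 ≤ ρ) (hρ : ρ ≤ Real.pi)
    (hl : ∀ θ ∈ Set.Icc (θ₀ - ρ) (θ₀ + ρ), l ≤ poissonKernel 0 w (circleMap 0 1 θ)) :
    ‖P.eval w‖ ≤ Real.exp (-(l / (2 * Real.pi) * mass P θ₀ ρ)) := by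
  refine (norm_eval_le_exp_poissonLog hP0 hw).trans (Real.exp_le_exp.2 ?_)
  have hpi := Real.pi_pos
  set g : ℝ → ℝ := fun θ => poissonKernel 0 w (circleMap 0 1 θ) * logInv P θ with hg
  have hgi : ∀ a b, IntervalIntegrable g volume a b := fun a b =>
    (intervalIntegrable_logInv P a b).continuousOn_mul
      (continuous_poissonKernel_circleMap hw).continuousOn
  have hper : Function.Periodic g (2 * Real.pi) := by
    intro θ
    simp only [hg, logInv, periodic_circleMap 0 1 θ]
  have h1 : poissonLog P w = -((2 * Real.pi)⁻¹ * ∫ θ in 0..2 * Real.pi, g θ) := by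
    rw [poissonLog, Real.circleAverage_def, smul_eq_mul, ← mul_neg, ← intervalIntegral.integral_neg]
    congr 1
    apply intervalIntegral.integral_congr
    intro θ _
    simp [hg, logInv]
  have h2 : ∫ θ in 0..2 * Real.pi, g θ = ∫ θ in (θ₀ - Real.pi)..(θ₀ + Real.pi), g θ := by
    have := hper.intervalIntegral_add_eq 0 (θ₀ - Real.pi)
    rw [zero_add] at this
    rw [this]
    congr 1
    ring
  have h3 : ∫ θ in (θ₀ - ρ)..(θ₀ + ρ), g θ ≤ ∫ θ in (θ₀ - Real.pi)..(θ₀ + Real.pi), g θ := by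
    apply intervalIntegral.integral_mono_interval (by linarith) (by linarith) (by linarith)
      (Filter.Eventually.of_forall fun θ =>
        mul_nonneg (poissonKernel_nonneg hw θ) (logInv_nonneg hP θ)) (hgi _ _)
  have h4 : l * mass P θ₀ ρ ≤ ∫ θ in (θ₀ - ρ)..(θ₀ + ρ), g θ := by
    rw [mass, ← intervalIntegral.integral_const_mul]
    apply intervalIntegral.integral_mono_on (by linarith)
      ((intervalIntegrable_logInv P _ _).const_mul l) (hgi _ _)
    intro θ hθ
    exact mul_le_mul_of_nonneg_right (hl θ hθ) (logInv_nonneg hP θ)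
  rw [h1, h2]
  apply neg_le_neg
  rw [div_eq_inv_mul, mul_assoc]
  gcongr
  exact h4.trans h3

/-- The total mass is controlled by the value at the origin. -/
lemma mass_le {P : ℂ[X]} (hP : ∀ z : ℂ, ‖z‖ ≤ 1 → ‖P.eval z‖ ≤ 1) {A : ℝ}
    (hA : Real.exp (-A) ≤ ‖P.eval 0‖) (θ₀ : ℝ) {ρ : ℝ} (hρ0 : 0 ≤ ρ) (hρ : ρ ≤ Real.pi) :
    mass P θ₀ ρ ≤ 2 * Real.pi * A := by
  have hP0 : P ≠ 0 := by
    rintro rfl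
    have := Real.exp_pos (-A)
    simp only [eval_zero, norm_zero] at hA
    linarith
  have h := norm_eval_le_exp_mass hP0 hP (w := 0) (by simp) (θ₀ := θ₀) (l := 1) hρ0 hρ
    (fun θ _ => by simp [poissonKernel])
  have h2 := Real.exp_le_exp.1 (hA.trans h)
  have hpi := Real.pi_pos
  have : 1 / (2 * Real.pi) * mass P θ₀ ρ ≤ A := by linarith
  rw [one_div, inv_mul_le_iff₀ (by positivity)] at this
  linarith

/-- The smallness at points of the disc close to an arc that carries a large mass. -/
lemma norm_eval_le_of_near_arc {P : ℂ[X]} (hP0 : P ≠ 0)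
    (hP : ∀ z : ℂ, ‖z‖ ≤ 1 → ‖P.eval z‖ ≤ 1) {z : ℂ} {h ρ θ θ₀ : ℝ} (hh : 0 < h) (hhρ : h ≤ ρ)
    (hρ : ρ ≤ 1) (hθ : |θ - θ₀| ≤ 2 * ρ) (hz1 : ‖z - circleMap 0 1 θ‖ ≤ h)
    (hz2 : ‖z‖ ^ 2 ≤ 1 - h / 2) :
    ‖P.eval z‖ ≤ Real.exp (-(h * mass P θ₀ ρ / (256 * ρ ^ 2))) := by
  have hρ0 : 0 < ρ := hh.trans_le hhρ
  have hpi := Real.pi_gt_three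
  have hpi4 := Real.pi_lt_four
  have hz : ‖z‖ < 1 := by nlinarith [norm_nonneg z]
  have hm := mass_nonneg hP θ₀ hρ0.le
  -- The arc lies within 4ρ of `z` and 1 - |z|² ≥ h/2, so the Poisson kernel is at least
  -- (h/2)/(4ρ)². Bounding 2π by 8 then gives 256.
  have key := norm_eval_le_exp_mass hP0 hP hz (θ₀ := θ₀) (ρ := ρ) (l := h / (32 * ρ ^ 2)) hρ0.le
    (by linarith) ?_
  · refine key.trans (Real.exp_le_exp.2 (neg_le_neg ?_))
    calc h * mass P θ₀ ρ / (256 * ρ ^ 2) = h / (32 * ρ ^ 2) / 8 * mass P θ₀ ρ := by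
          field_simp
          ring
      _ ≤ h / (32 * ρ ^ 2) / (2 * Real.pi) * mass P θ₀ ρ := by
          gcongr
          linarith
  · intro t ht
    have hdist : ‖circleMap 0 1 t - z‖ ≤ 4 * ρ := by
      have h1 : ‖circleMap 0 1 θ - circleMap 0 1 t‖ ≤ |θ - t| := by
        have := (lipschitzWith_circleMap 0 1).dist_le_mul θ t
        simpa [dist_eq_norm, Real.dist_eq] using this
      have h2 : |θ - t| ≤ 3 * ρ := by
        have h3 : |θ₀ - t| ≤ ρ := abs_le.2 ⟨by linarith [ht.2], by linarith [ht.1]⟩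
        calc |θ - t| = |(θ - θ₀) + (θ₀ - t)| := by ring_nf
          _ ≤ _ := abs_add_le _ _
          _ ≤ _ := by linarith
      calc ‖circleMap 0 1 t - z‖
          = ‖(z - circleMap 0 1 θ) + (circleMap 0 1 θ - circleMap 0 1 t)‖ := by
            rw [← norm_neg]
            congr 1
            ring
        _ ≤ _ := norm_add_le _ _
        _ ≤ _ := by linarith
    have hpos : 0 < ‖circleMap 0 1 t - z‖ := by
      rw [norm_pos_iff, sub_ne_zero]
      rintro rfl
      rw [norm_circleMap_zero_one] at hz
      exact lt_irrefl _ hz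
    rw [poissonKernel, sub_zero, sub_zero, norm_circleMap_zero_one, le_div_iff₀ (by positivity)]
    calc h / (32 * ρ ^ 2) * ‖circleMap 0 1 t - z‖ ^ 2 ≤ h / (32 * ρ ^ 2) * (4 * ρ) ^ 2 := by
          gcongr
      _ = h / 2 := by
          field_simp
          norm_num
      _ ≤ _ := by linarith

/-! ### Partial sums -/

/-- Partial sums of the power series. -/
noncomputable def part (c : ℕ → ℂ) (n : ℕ) (z : ℂ) : ℂ := ∑ k ∈ Finset.range n, c k * z ^ k

/-- For k < n the growth e^(hk) is absorbed by half of the decay of c_k, because k = k^(1/(2+β)) ·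
k^((1+β)/(2+β)). This serves as an extension of the function a distance h beyond the circle. -/
lemma Decay.norm_part_le {K β : ℝ} (hK : 1 ≤ K) (hβ : 0 ≤ β) {c : ℕ → ℂ} (hc : Decay K β c) {n : ℕ}
    {h : ℝ} (hn : ∀ k < n, h * (k : ℝ) ^ (1 / (2 + β)) ≤ K⁻¹ / 2) {z : ℂ}
    (hz : ‖z‖ ≤ 1 + h) : ‖part c n z‖ ≤ supBound K := by
  have hK0 : 0 < K := by linarith
  calc ‖part c n z‖ ≤ ∑ k ∈ Finset.range n, ‖c k * z ^ k‖ := norm_sum_le _ _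
    _ ≤ ∑ k ∈ Finset.range n, K * Real.exp (-(K⁻¹ / 2 * (k : ℝ) ^ (1 / 2 : ℝ))) := by
        refine Finset.sum_le_sum fun k hk => ?_
        rw [norm_mul, norm_pow]
        have h1 : ‖z‖ ^ k ≤ Real.exp (K⁻¹ / 2 * (k : ℝ) ^ ((1 + β) / (2 + β))) := by
          have h2 : ‖z‖ ≤ Real.exp h := by linarith [Real.add_one_le_exp h]
          calc ‖z‖ ^ k ≤ Real.exp h ^ k := by gcongr
            _ = Real.exp (k * h) := by rw [← Real.exp_nat_mul]
            _ ≤ _ := by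
              apply Real.exp_le_exp.2
              rcases Nat.eq_zero_or_pos k with rfl | hk0
              · simp only [Nat.cast_zero, zero_mul]
                positivity
              have hk' : (0 : ℝ) < k := by exact_mod_cast hk0
              have h3 : (k : ℝ) = (k : ℝ) ^ (1 / (2 + β)) * (k : ℝ) ^ ((1 + β) / (2 + β)) := by
                rw [← Real.rpow_add hk']
                have : 1 / (2 + β) + (1 + β) / (2 + β) = 1 := by field_simp; ring
                rw [this, Real.rpow_one]
              have h4 := mul_le_mul_of_nonneg_right (hn k (Finset.mem_range.1 hk))
                (show 0 ≤ (k : ℝ) ^ ((1 + β) / (2 + β)) by positivity)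
              calc (k : ℝ) * h = h * (k : ℝ) ^ (1 / (2 + β)) * (k : ℝ) ^ ((1 + β) / (2 + β)) := by
                    nth_rw 1 [h3]
                    ring
                _ ≤ _ := h4
        calc ‖c k‖ * ‖z‖ ^ k ≤ K * Real.exp (-(K⁻¹ / 2 * (k : ℝ) ^ (1 / 2 : ℝ))) *
              Real.exp (-(K⁻¹ / 2 * (k : ℝ) ^ ((1 + β) / (2 + β)))) *
              Real.exp (K⁻¹ / 2 * (k : ℝ) ^ ((1 + β) / (2 + β))) := by
              gcongr
              exact hc.exp_half_le hK hβ k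
          _ = _ := by
              rw [mul_assoc _ (Real.exp (-_)), ← Real.exp_add, neg_add_cancel, Real.exp_zero, mul_one]
    _ ≤ _ := by
        rw [← Finset.mul_sum, supBound]
        gcongr
        exact (summable_supBound hK).sum_le_tsum _ fun k _ => by positivity

lemma Decay.norm_part_sub_part_le {K β : ℝ} (hK : 1 ≤ K) (hβ : 0 ≤ β) {c : ℕ → ℂ}
    (hc : Decay K β c) {n N : ℕ} (hnN : n ≤ N) {z : ℂ} (hz : ‖z‖ ≤ 1) :
    ‖part c N z - part c n z‖
      ≤ supBound K * Real.exp (-(K⁻¹ / 2 * (n : ℝ) ^ ((1 + β) / (2 + β)))) := by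
  have hK0 : 0 < K := by linarith
  rw [part, part, ← Finset.sum_Ico_eq_sub _ hnN]
  calc ‖∑ k ∈ Finset.Ico n N, c k * z ^ k‖ ≤ ∑ k ∈ Finset.Ico n N, ‖c k * z ^ k‖ := norm_sum_le _ _
    _ ≤ ∑ k ∈ Finset.Ico n N, K * Real.exp (-(K⁻¹ / 2 * (k : ℝ) ^ (1 / 2 : ℝ))) *
          Real.exp (-(K⁻¹ / 2 * (n : ℝ) ^ ((1 + β) / (2 + β)))) := by
        refine Finset.sum_le_sum fun k hk => ?_
        refine (norm_mul_pow_le c hz k).trans ((hc.exp_half_le hK hβ k).trans ?_)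
        have := (Finset.mem_Ico.1 hk).1
        gcongr
    _ ≤ _ := by
        rw [← Finset.sum_mul, ← Finset.mul_sum, supBound]
        gcongr
        exact (summable_supBound hK).sum_le_tsum _ fun k _ => by positivity

/-- One of the four quarter-turns of a unit vector is within 45° of -1, and cos 45° > 7/10. -/
lemma exists_rotation_re_le {v : ℂ} (hv : ‖v‖ = 1) : ∃ j < 4, (Complex.I ^ j * v).re ≤ -(7 / 10) := by
  have h : v.re ^ 2 + v.im ^ 2 = 1 := by
    have := Complex.normSq_eq_norm_sq v
    rw [hv, Complex.normSq_apply] at this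
    linarith
  by_contra! hcon
  have h0 := hcon 0 (by norm_num)
  have h1 := hcon 1 (by norm_num)
  have h2 := hcon 2 (by norm_num)
  have h3 := hcon 3 (by norm_num)
  simp only [pow_zero, one_mul, pow_one, Complex.mul_re, Complex.I_re, Complex.I_im, zero_mul,
    Complex.I_sq, Complex.I_pow_three, Complex.neg_re, Complex.neg_im, Complex.one_re,
    Complex.one_im] at h0 h1 h2 h3
  nlinarith

/-- The two constants estimate at a point of the boundary. -/
lemma Decay.norm_part_boundary_le {K β : ℝ} (hK : 1 ≤ K) (hβ : 0 ≤ β) {c : ℕ → ℂ}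
    (hc : Decay K β c) (N : ℕ) {h T : ℝ} (hh : 0 < h) (hh2 : h ≤ 1 / 2) (hT0 : 0 ≤ T)
    (hT : T ≤ K⁻¹ / 2 * (K⁻¹ / (2 * h)) ^ (1 + β)) {z₀ : ℂ} (hz₀ : ‖z₀‖ = 1)
    (hdeep : ∀ z : ℂ, ‖z - z₀‖ ≤ h → ‖z‖ ^ 2 ≤ 1 - h / 2 →
      ‖part c N z‖ ≤ supBound K * Real.exp (-T)) :
    ‖part c N z₀‖ ≤ 3 * supBound K * Real.exp (-(T / 4)) := by
  have hK0 : 0 < K := by linarith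
  have hq : 0 < 2 + β := by linarith
  set S := supBound K with hS
  have hS1 : 1 ≤ S := one_le_supBound hK
  -- The longest truncation still bounded on the disc of radius 1 + h; the terms beyond it have
  -- total size at most S e^(-T).
  set x := (K⁻¹ / (2 * h)) ^ (2 + β) with hx
  set n := min ⌈x⌉₊ N with hn
  have hnN : n ≤ N := min_le_right _ _
  have hnk : ∀ k < n, h * (k : ℝ) ^ (1 / (2 + β)) ≤ K⁻¹ / 2 := by
    intro k hk
    have hk1 : (k : ℝ) < x := Nat.lt_ceil.1 (hk.trans_le (min_le_left _ _))
    have h1 : (k : ℝ) ^ (1 / (2 + β)) ≤ K⁻¹ / (2 * h) := by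
      calc (k : ℝ) ^ (1 / (2 + β)) ≤ x ^ (1 / (2 + β)) := by gcongr
        _ = K⁻¹ / (2 * h) := by
            rw [hx, ← Real.rpow_mul (by positivity), mul_one_div_cancel hq.ne', Real.rpow_one]
    calc h * (k : ℝ) ^ (1 / (2 + β)) ≤ h * (K⁻¹ / (2 * h)) := by gcongr
      _ = _ := by field_simp
  have htail : ∀ z : ℂ, ‖z‖ ≤ 1 → ‖part c N z - part c n z‖ ≤ S * Real.exp (-T) := by
    intro z hz
    rcases le_total ⌈x⌉₊ N with hN | hN
    · have hn' : n = ⌈x⌉₊ := min_eq_left hN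
      refine (hc.norm_part_sub_part_le hK hβ hnN hz).trans ?_
      gcongr
      refine hT.trans ?_
      gcongr
      calc (K⁻¹ / (2 * h)) ^ (1 + β) = x ^ ((1 + β) / (2 + β)) := by
            rw [hx, ← Real.rpow_mul (by positivity)]
            congr 1
            field_simp
        _ ≤ _ := by
            rw [hn']
            gcongr
            exact Nat.le_ceil x
    · have hn' : n = N := min_eq_right hN
      rw [hn', sub_self, norm_zero]
      positivity
  have hbig : ∀ z : ℂ, ‖z‖ ≤ 1 + h → ‖part c n z‖ ≤ S := fun z hz =>
    hc.norm_part_le hK hβ hnk hz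
  -- The product of four rotated copies replaces harmonic measure. On |v| = 1 at least one factor is
  -- evaluated deep inside the disc and is small, the others are at most `S`, and g(0) is the fourth
  -- power of the value sought.
  set g : ℂ → ℂ := fun v => ∏ j ∈ Finset.range 4, part c n (z₀ * (1 + h * (Complex.I ^ j * v)))
    with hg
  have hpt : ∀ v : ℂ, ‖v‖ = 1 → ∀ j, ‖z₀ * (1 + h * (Complex.I ^ j * v)) - z₀‖ = h := by
    intro v hv j
    have : z₀ * (1 + h * (Complex.I ^ j * v)) - z₀ = z₀ * (h * (Complex.I ^ j * v)) := by ring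
    rw [this, norm_mul, norm_mul, norm_mul, norm_pow, hz₀, hv, Complex.norm_I, Complex.norm_real,
      Real.norm_of_nonneg hh.le]
    simp
  have hbd : ∀ v : ℂ, ‖v‖ = 1 → ‖g v‖ ≤ S ^ 3 * (2 * S * Real.exp (-T)) := by
    intro v hv
    obtain ⟨j, hj, hre⟩ := exists_rotation_re_le hv
    have hsmall : ‖part c n (z₀ * (1 + h * (Complex.I ^ j * v)))‖ ≤ 2 * S * Real.exp (-T) := by
      set z := z₀ * (1 + h * (Complex.I ^ j * v)) with hz
      have hz2 : ‖z‖ ^ 2 ≤ 1 - h / 2 := by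
        set u := Complex.I ^ j * v with hu
        have hun : u.re ^ 2 + u.im ^ 2 = 1 := by
          have h1 : ‖u‖ = 1 := by rw [hu, norm_mul, norm_pow, Complex.norm_I, hv]; simp
          have := Complex.normSq_eq_norm_sq u
          rw [h1, Complex.normSq_apply] at this
          linarith
        rw [hz, norm_mul, hz₀, one_mul, ← Complex.normSq_eq_norm_sq, Complex.normSq_apply]
        simp only [Complex.add_re, Complex.one_re, Complex.mul_re, Complex.ofReal_re,
          Complex.ofReal_im, zero_mul, sub_zero, Complex.add_im, Complex.one_im, Complex.mul_im,
          add_zero, zero_add]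
        have e : (1 + h * u.re) * (1 + h * u.re) + h * u.im * (h * u.im)
            = 1 + 2 * (h * u.re) + h * h * (u.re ^ 2 + u.im ^ 2) := by ring
        rw [e, hun]
        nlinarith [mul_le_mul_of_nonneg_left hre hh.le]
      have hz1 : ‖z‖ ≤ 1 := by
        nlinarith [norm_nonneg z]
      have h1 := hdeep z (hpt v hv j).le hz2
      have h2 := htail z hz1
      calc ‖part c n z‖ = ‖part c N z - (part c N z - part c n z)‖ := by rw [sub_sub_cancel]
        _ ≤ _ := norm_sub_le _ _
        _ ≤ _ := by linarith
    have hall : ∀ i, ‖part c n (z₀ * (1 + h * (Complex.I ^ i * v)))‖ ≤ S := by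
      intro i
      apply hbig
      calc _ ≤ ‖z₀‖ + ‖z₀ * (1 + h * (Complex.I ^ i * v)) - z₀‖ := by
            rw [add_comm ‖z₀‖]
            exact norm_le_norm_sub_add _ _
        _ = 1 + h := by rw [hz₀, hpt v hv i]
    rw [hg, norm_prod, ← Finset.prod_erase_mul _ _ (Finset.mem_range.2 hj)]
    refine mul_le_mul ?_ hsmall (norm_nonneg _) (by positivity)
    refine (Finset.prod_le_prod (fun i _ => norm_nonneg _) fun i _ => hall i).trans_eq ?_
    rw [Finset.prod_const, Finset.card_erase_of_mem (Finset.mem_range.2 hj), Finset.card_range]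
  have hg0 : ‖g 0‖ ≤ S ^ 3 * (2 * S * Real.exp (-T)) := by
    have hd : Differentiable ℂ g := by
      simp only [hg, part]
      fun_prop
    refine Complex.norm_le_of_forall_mem_frontier_norm_le (U := Metric.ball (0 : ℂ) 1)
      Metric.isBounded_ball hd.diffContOnCl (fun v hv => ?_) (subset_closure (by simp))
    rw [frontier_ball _ one_ne_zero, mem_sphere_zero_iff_norm] at hv
    exact hbd v hv
  have hg0' : ‖g 0‖ = ‖part c n z₀‖ ^ 4 := by
    simp [hg]
  have hexp4 : Real.exp (-(T / 4)) ^ 4 = Real.exp (-T) := by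
    rw [← Real.exp_nat_mul]
    congr 1
    push_cast
    ring
  have hpn : ‖part c n z₀‖ ≤ 2 * S * Real.exp (-(T / 4)) := by
    rw [← pow_le_pow_iff_left₀ (norm_nonneg _) (by positivity) (show 4 ≠ 0 by norm_num), ← hg0',
      mul_pow, hexp4]
    refine hg0.trans ?_
    have : 0 < S ^ 4 * Real.exp (-T) := by positivity
    nlinarith
  have h1 := htail z₀ hz₀.le
  have h2 : Real.exp (-T) ≤ Real.exp (-(T / 4)) := Real.exp_le_exp.2 (by linarith)
  calc ‖part c N z₀‖ = ‖part c n z₀ + (part c N z₀ - part c n z₀)‖ := by rw [add_sub_cancel]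
    _ ≤ _ := norm_add_le _ _
    _ ≤ 2 * S * Real.exp (-(T / 4)) + S * Real.exp (-(T / 4)) := by
        gcongr
        exact h1.trans (by gcongr)
    _ = _ := by ring

end Gevrey

namespace Gevrey

open MeasureTheory Polynomial

/-! ### Growth of the logarithmic mass -/

/-- The normalized partial sums as polynomials. -/
noncomputable def npoly (K : ℝ) (c : ℕ → ℂ) (N : ℕ) : ℂ[X] :=
  ∑ k ∈ Finset.range N, C (c k / supBound K) * X ^ k

lemma eval_npoly (K : ℝ) (c : ℕ → ℂ) (N : ℕ) (z : ℂ) :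
    (npoly K c N).eval z = part c N z / supBound K := by
  simp only [npoly, eval_finsetSum, eval_mul, eval_C, eval_pow, eval_X, part, Finset.sum_div]
  refine Finset.sum_congr rfl fun k _ => ?_
  ring

lemma norm_eval_npoly {K : ℝ} (hK : 1 ≤ K) (c : ℕ → ℂ) (N : ℕ) (z : ℂ) :
    ‖(npoly K c N).eval z‖ = ‖part c N z‖ / supBound K := by
  have := one_le_supBound hK
  rw [eval_npoly, norm_div, Complex.norm_real, Real.norm_of_nonneg (by linarith)]

lemma Decay.norm_eval_npoly_le {K β : ℝ} (hK : 1 ≤ K) (hβ : 0 ≤ β) {c : ℕ → ℂ} (hc : Decay K β c)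
    (N : ℕ) (z : ℂ) (hz : ‖z‖ ≤ 1) : ‖(npoly K c N).eval z‖ ≤ 1 := by
  have hS := one_le_supBound hK
  have hK0 : 0 < K := by linarith
  rw [norm_eval_npoly hK, div_le_one (by linarith)]
  exact hc.norm_part_le hK hβ (h := 0) (fun k _ => by rw [zero_mul]; positivity) (by simpa using hz)

lemma log_three_le_two : Real.log 3 ≤ 2 := by
  have := Real.log_le_sub_one_of_pos (show (0 : ℝ) < 3 by norm_num)
  linarith

/-- The threshold parameter. -/
noncomputable def eps (K : ℝ) : ℝ := (2048 * K ^ 2)⁻¹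

/-- The largest scale under consideration. -/
noncomputable def rho0 (K : ℝ) : ℝ := eps K ^ 2 / 4096

lemma eps_pos {K : ℝ} (hK : 1 ≤ K) : 0 < eps K := by
  unfold eps
  positivity

lemma eps_le {K : ℝ} (hK : 1 ≤ K) : eps K ≤ K⁻¹ / 2048 := by
  have hK0 : 0 < K := by linarith
  unfold eps
  rw [mul_inv, mul_comm, div_eq_mul_inv]
  gcongr
  nlinarith

lemma eps_le' {K : ℝ} (hK : 1 ≤ K) : eps K ≤ 1 / 2048 := by
  have : K⁻¹ ≤ 1 := inv_le_one_of_one_le₀ hK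
  linarith [eps_le hK]

lemma rho0_pos {K : ℝ} (hK : 1 ≤ K) : 0 < rho0 K := by
  have := eps_pos hK
  unfold rho0
  positivity

lemma rho0_le {K : ℝ} (hK : 1 ≤ K) : rho0 K ≤ 1 / 4096 := by
  have h1 := eps_pos hK
  have h2 := eps_le' hK
  unfold rho0
  nlinarith

section

variable {K β : ℝ} {c : ℕ → ℂ} {N : ℕ}

lemma Decay.le_logInv (hK : 1 ≤ K) (hβ : 0 ≤ β) (hc : Decay K β c)
    (hP0 : npoly K c N ≠ 0) {h T ρ θ θ₀ : ℝ} (hh : 0 < h) (hhρ : h ≤ ρ) (hρ : ρ ≤ 1 / 2)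
    (hT0 : 0 ≤ T) (hT1 : T ≤ h * mass (npoly K c N) θ₀ ρ / (256 * ρ ^ 2))
    (hT2 : T ≤ K⁻¹ / 2 * (K⁻¹ / (2 * h)) ^ (1 + β)) (hθ : |θ - θ₀| ≤ 2 * ρ)
    (hne : (npoly K c N).eval (circleMap 0 1 θ) ≠ 0) :
    T / 4 - Real.log 3 ≤ logInv (npoly K c N) θ := by
  have hS := one_le_supBound hK
  have h1 := hc.norm_part_boundary_le hK hβ N hh (hhρ.trans hρ) hT0 hT2
    (norm_circleMap_zero_one θ) (fun z hz1 hz2 => ?_)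
  · have h2 : ‖(npoly K c N).eval (circleMap 0 1 θ)‖ ≤ 3 * Real.exp (-(T / 4)) := by
      rw [norm_eval_npoly hK, div_le_iff₀ (by linarith)]
      linarith
    have h3 := Real.log_le_log (norm_pos_iff.2 hne) h2
    rw [Real.log_mul (by norm_num) (Real.exp_pos _).ne', Real.log_exp] at h3
    rw [logInv]
    linarith
  · have h2 := norm_eval_le_of_near_arc hP0 (hc.norm_eval_npoly_le hK hβ N) hh hhρ
      (by linarith) hθ hz1 hz2
    rw [norm_eval_npoly hK, div_le_iff₀ (by linarith)] at h2
    rw [mul_comm]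
    refine h2.trans ?_
    gcongr

/-- The boundary estimate with the optimal choice of the width. -/
lemma Decay.le_logInv_rpow (hK : 1 ≤ K) (hβ : 0 ≤ β) (hc : Decay K β c)
    (hP0 : npoly K c N ≠ 0) {ρ θ θ₀ : ℝ} (hρ0 : 0 < ρ) (hρ : ρ ≤ rho0 K)
    (hm : (eps K / ρ) ^ (2 + β) ≤ mass (npoly K c N) θ₀ ρ / ρ ^ 2) (hθ : |θ - θ₀| ≤ 2 * ρ)
    (hne : (npoly K c N).eval (circleMap 0 1 θ) ≠ 0) :
    eps K / 2048 * (mass (npoly K c N) θ₀ ρ / ρ ^ 2) ^ ((1 + β) / (2 + β))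
      ≤ logInv (npoly K c N) θ := by
  have hK0 : 0 < K := by linarith
  set ε := eps K with hε
  have hε0 : 0 < ε := eps_pos hK
  have hεK : ε ≤ K⁻¹ / 2048 := eps_le hK
  have hε1 : ε ≤ 1 / 2048 := eps_le' hK
  have hKi : 0 < K⁻¹ := inv_pos.2 hK0
  have hq : 0 < 2 + β := by linarith
  set M := mass (npoly K c N) θ₀ ρ / ρ ^ 2 with hM
  have hM0 : 0 < M := lt_of_lt_of_le (by positivity) hm
  -- This depth balances hM, the gain from the Poisson kernel, against h^(-(1+β)), the limit set by
  -- truncation.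
  set h := ε * M ^ (-(1 / (2 + β))) with hh
  have hh0 : 0 < h := by positivity
  have hMs : M * M ^ (-(1 / (2 + β))) = M ^ ((1 + β) / (2 + β)) := by
    nth_rw 1 [← Real.rpow_one M]
    rw [← Real.rpow_add hM0]
    congr 1
    field_simp
    ring
  have hhρ : h ≤ ρ := by
    have h1 : M ^ (-(1 / (2 + β))) ≤ ((ε / ρ) ^ (2 + β)) ^ (-(1 / (2 + β))) := by
      apply Real.rpow_le_rpow_of_nonpos (by positivity) hm
      have : 0 < 1 / (2 + β) := by positivity
      linarith
    have h2 : ((ε / ρ) ^ (2 + β)) ^ (-(1 / (2 + β))) = (ε / ρ)⁻¹ := by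
      rw [← Real.rpow_mul (by positivity), ← Real.rpow_neg_one]
      congr 1
      field_simp
    calc h ≤ ε * (ε / ρ)⁻¹ := by
          rw [← h2]
          exact mul_le_mul_of_nonneg_left h1 hε0.le
      _ = ρ := by
          field_simp
  set T := ε / 256 * M ^ ((1 + β) / (2 + β)) with hT
  have hT1 : T ≤ h * mass (npoly K c N) θ₀ ρ / (256 * ρ ^ 2) := by
    have : h * mass (npoly K c N) θ₀ ρ / (256 * ρ ^ 2) = h * M / 256 := by
      rw [hM]
      field_simp
    rw [this, hT, hh, ← hMs]
    apply le_of_eq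
    ring
  have hT2 : T ≤ K⁻¹ / 2 * (K⁻¹ / (2 * h)) ^ (1 + β) := by
    have h1 : K⁻¹ / (2 * h) = K⁻¹ / (2 * ε) * M ^ (1 / (2 + β)) := by
      rw [hh, Real.rpow_neg hM0.le]
      field_simp
    rw [h1, Real.mul_rpow (by positivity) (by positivity), ← Real.rpow_mul hM0.le]
    have h2 : 1 / (2 + β) * (1 + β) = (1 + β) / (2 + β) := by ring
    have h3 : 1 ≤ (K⁻¹ / (2 * ε)) ^ (1 + β) := by
      apply Real.one_le_rpow _ (by linarith)
      rw [one_le_div (by positivity)]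
      linarith
    rw [h2, hT]
    have h4 : ε / 256 ≤ K⁻¹ / 2 := by linarith
    calc ε / 256 * M ^ ((1 + β) / (2 + β))
        ≤ K⁻¹ / 2 * (1 * M ^ ((1 + β) / (2 + β))) := by
          rw [one_mul]
          gcongr
      _ ≤ _ := by gcongr
  have hρ2 : ρ ≤ 1 / 2 := by linarith [rho0_le hK]
  have key := hc.le_logInv hK hβ hP0 hh0 hhρ hρ2 (by positivity) hT1 hT2 hθ hne
  -- Here the smallness of `rho0` enters: half of the main term T/4 becomes at least 2 and absorbs
  -- log 3.
  have hMbig : 4096 / ε ≤ M ^ ((1 + β) / (2 + β)) := by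
    have h1 : 4096 / ε ≤ ε / ρ := by
      rw [div_le_div_iff₀ hε0 hρ0]
      have h2 : ρ ≤ ε ^ 2 / 4096 := hρ
      linarith
    have h3 : 1 ≤ ε / ρ := by
      refine le_trans ?_ h1
      rw [one_le_div hε0]
      linarith
    calc 4096 / ε ≤ (ε / ρ) ^ (1 : ℝ) := by rwa [Real.rpow_one]
      _ ≤ (ε / ρ) ^ (1 + β) := Real.rpow_le_rpow_of_exponent_le h3 (by linarith)
      _ = ((ε / ρ) ^ (2 + β)) ^ ((1 + β) / (2 + β)) := by
          rw [← Real.rpow_mul (by positivity)]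
          congr 1
          field_simp
      _ ≤ _ := by gcongr
  rw [div_le_iff₀ hε0] at hMbig
  have := log_three_le_two
  rw [hT] at key
  linarith

/-- Doubling of the scale increases the mass. -/
lemma Decay.mass_two_mul (hK : 1 ≤ K) (hβ : 0 ≤ β) (hc : Decay K β c)
    (hP0 : npoly K c N ≠ 0) {ρ θ₀ : ℝ} (hρ0 : 0 < ρ) (hρ : ρ ≤ rho0 K)
    (hm : (eps K / ρ) ^ (2 + β) ≤ mass (npoly K c N) θ₀ ρ / ρ ^ 2) :
    mass (npoly K c N) θ₀ ρ
        + 2 * ρ * (eps K / 2048 * (mass (npoly K c N) θ₀ ρ / ρ ^ 2) ^ ((1 + β) / (2 + β)))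
      ≤ mass (npoly K c N) θ₀ (2 * ρ) := by
  set P := npoly K c N with hP
  set b := eps K / 2048 * (mass P θ₀ ρ / ρ ^ 2) ^ ((1 + β) / (2 + β)) with hb
  have hi := intervalIntegrable_logInv P
  -- The gain comes from the two arcs of length ρ that are added on either side; finitely many zeros
  -- of the polynomial are ignored.
  have hside : ∀ x, |x - θ₀| ≤ 2 * ρ → |x + ρ - θ₀| ≤ 2 * ρ →
      ρ * b ≤ ∫ θ in x..(x + ρ), logInv P θ := by
    intro x hx1 hx2
    have h1 : ∫ _ in x..(x + ρ), b = ρ * b := by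
      rw [intervalIntegral.integral_const, smul_eq_mul]
      ring
    rw [← h1]
    apply intervalIntegral.integral_mono_ae_restrict (by linarith) (by simp) (hi _ _)
    have hae := ae_restrict_of_ae (s := Set.Icc x (x + ρ)) (ae_eval_circleMap_ne_zero hP0)
    filter_upwards [hae, ae_restrict_mem measurableSet_Icc] with θ hne hθ
    apply hc.le_logInv_rpow hK hβ hP0 hρ0 hρ hm _ hne
    rw [abs_le] at hx1 hx2 ⊢
    exact ⟨by linarith [hθ.1, hx1.1], by linarith [hθ.2, hx2.2]⟩
  have h1 := hside (θ₀ - 2 * ρ) (by rw [abs_le]; constructor <;> linarith)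
    (by rw [abs_le]; constructor <;> linarith)
  have h2 := hside (θ₀ + ρ) (by rw [abs_le]; constructor <;> linarith)
    (by rw [abs_le]; constructor <;> linarith)
  have e1 : θ₀ - 2 * ρ + ρ = θ₀ - ρ := by ring
  have e2 : θ₀ + ρ + ρ = θ₀ + 2 * ρ := by ring
  rw [e1] at h1
  rw [e2] at h2
  have h3 : mass P θ₀ (2 * ρ) = (∫ θ in (θ₀ - 2 * ρ)..(θ₀ - ρ), logInv P θ) + mass P θ₀ ρ
      + ∫ θ in (θ₀ + ρ)..(θ₀ + 2 * ρ), logInv P θ := by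
    rw [mass, mass, intervalIntegral.integral_add_adjacent_intervals (hi _ _) (hi _ _),
      intervalIntegral.integral_add_adjacent_intervals (hi _ _) (hi _ _)]
  rw [h3]
  linarith

/-- Since 1 + x ≥ e^(x/2) on [0,1], taking the root gives e^(x/(2q)). With q = 2 + β this makes the
growth of the mass additive. -/
lemma one_add_div_le_rpow {x q : ℝ} (hx0 : 0 ≤ x) (hx1 : x ≤ 1) (hq : 1 ≤ q) :
    1 + x / (2 * q) ≤ (1 + x) ^ (1 / q) := by
  have hq0 : 0 < q := by linarith
  have h1 : Real.exp (x / 2) ≤ 1 + x := by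
    have h2 : 1 - x / 2 ≤ Real.exp (-(x / 2)) := by linarith [Real.add_one_le_exp (-(x / 2))]
    rw [Real.exp_neg] at h2
    have h3 := Real.exp_pos (x / 2)
    have h4 : (1 - x / 2) * Real.exp (x / 2) ≤ 1 := by
      have := mul_le_mul_of_nonneg_right h2 h3.le
      rwa [inv_mul_cancel₀ h3.ne'] at this
    nlinarith
  calc 1 + x / (2 * q) ≤ Real.exp (x / (2 * q)) := by linarith [Real.add_one_le_exp (x / (2 * q))]
    _ = Real.exp (x / 2) ^ (1 / q) := by
        rw [← Real.exp_mul]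
        congr 1
        field_simp
    _ ≤ _ := by gcongr

/-- The growth of the mass in a form suited for iteration. -/
lemma Decay.mass_rpow_two_mul (hK : 1 ≤ K) (hβ : 0 ≤ β) (hc : Decay K β c)
    (hP0 : npoly K c N ≠ 0) {ρ θ₀ : ℝ} (hρ0 : 0 < ρ) (hρ : ρ ≤ rho0 K)
    (hm : eps K ^ (2 + β) * ρ ^ (-β) ≤ mass (npoly K c N) θ₀ ρ) :
    mass (npoly K c N) θ₀ ρ ^ (1 / (2 + β)) + eps K / (2048 * (2 + β)) * ρ ^ (-(β / (2 + β)))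
      ≤ mass (npoly K c N) θ₀ (2 * ρ) ^ (1 / (2 + β)) := by
  have hε0 := eps_pos hK
  have hq : 0 < 2 + β := by linarith
  set ε := eps K
  set m := mass (npoly K c N) θ₀ ρ with hmdef
  have hm0 : 0 < m := lt_of_lt_of_le (by positivity) hm
  have hm' : (ε / ρ) ^ (2 + β) ≤ m / ρ ^ 2 := by
    rw [Real.div_rpow hε0.le hρ0.le, le_div_iff₀ (by positivity), div_mul_eq_mul_div,
      div_le_iff₀ (by positivity), ← Real.rpow_two]
    have : ε ^ (2 + β) * ρ ^ (2 : ℝ) = ε ^ (2 + β) * ρ ^ (-β) * ρ ^ (2 + β) := by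
      rw [mul_assoc, ← Real.rpow_add hρ0]
      congr 2
      ring
    rw [this]
    gcongr
  have h1 := hc.mass_two_mul hK hβ hP0 hρ0 hρ hm'
  -- The relative gain of mass in one doubling; the lower bound on the mass keeps it at most 1/1024.
  set x := ε / 1024 * ρ ^ (-(β / (2 + β))) * m ^ (-(1 / (2 + β))) with hx
  have hx0 : 0 ≤ x := by positivity
  have hx1 : x ≤ 1 := by
    have h2 : m ^ (-(1 / (2 + β))) ≤ (ε ^ (2 + β) * ρ ^ (-β)) ^ (-(1 / (2 + β))) := by
      apply Real.rpow_le_rpow_of_nonpos (by positivity) hm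
      have : 0 < 1 / (2 + β) := by positivity
      linarith
    have h3 : (ε ^ (2 + β) * ρ ^ (-β)) ^ (-(1 / (2 + β))) = ε⁻¹ * ρ ^ (β / (2 + β)) := by
      rw [Real.mul_rpow (by positivity) (by positivity), ← Real.rpow_mul hε0.le,
        ← Real.rpow_mul hρ0.le, ← Real.rpow_neg_one]
      congr 2
      · field_simp
      · field_simp
    rw [h3] at h2
    calc x ≤ ε / 1024 * ρ ^ (-(β / (2 + β))) * (ε⁻¹ * ρ ^ (β / (2 + β))) := by
          rw [hx]
          gcongr
      _ = 1 / 1024 * (ρ ^ (-(β / (2 + β))) * ρ ^ (β / (2 + β))) := by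
          field_simp
      _ = 1 / 1024 := by
          rw [← Real.rpow_add hρ0, neg_add_cancel, Real.rpow_zero, mul_one]
      _ ≤ 1 := by norm_num
  have h2 : m * (1 + x) ≤ mass (npoly K c N) θ₀ (2 * ρ) := by
    refine le_trans (le_of_eq ?_) h1
    have h3 : (m / ρ ^ 2) ^ ((1 + β) / (2 + β))
        = m ^ ((1 + β) / (2 + β)) * ρ ^ (-(2 * ((1 + β) / (2 + β)))) := by
      rw [Real.div_rpow hm0.le (by positivity), ← Real.rpow_two, ← Real.rpow_mul hρ0.le,
        Real.rpow_neg hρ0.le, div_eq_mul_inv]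
    have h4 : ρ * ρ ^ (-(2 * ((1 + β) / (2 + β)))) = ρ ^ (-(β / (2 + β))) := by
      nth_rw 1 [← Real.rpow_one ρ]
      rw [← Real.rpow_add hρ0]
      congr 1
      field_simp
      ring
    have h5 : m * m ^ (-(1 / (2 + β))) = m ^ ((1 + β) / (2 + β)) := by
      nth_rw 1 [← Real.rpow_one m]
      rw [← Real.rpow_add hm0]
      congr 1
      field_simp
      ring
    rw [h3, ← h5, hx, ← h4]
    ring
  have h3 : m ^ (1 / (2 + β)) * (1 + x) ^ (1 / (2 + β))
      ≤ mass (npoly K c N) θ₀ (2 * ρ) ^ (1 / (2 + β)) := by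
    rw [← Real.mul_rpow hm0.le (by linarith)]
    gcongr
  refine le_trans ?_ h3
  refine le_trans (le_of_eq ?_)
    (mul_le_mul_of_nonneg_left (one_add_div_le_rpow hx0 hx1 (by linarith : 1 ≤ 2 + β))
      (by positivity))
  have h6 : m ^ (1 / (2 + β)) * m ^ (-(1 / (2 + β))) = 1 := by
    rw [← Real.rpow_add hm0, add_neg_cancel, Real.rpow_zero]
  calc _ = m ^ (1 / (2 + β)) + ε / (2048 * (2 + β)) * ρ ^ (-(β / (2 + β)))
        * (m ^ (1 / (2 + β)) * m ^ (-(1 / (2 + β)))) := by rw [h6, mul_one]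
    _ = _ := by
        rw [hx]
        field_simp
        ring

/-- A large mass on a small arc forces a small value at the origin. -/
lemma Decay.sum_le_of_mass (hK : 1 ≤ K) (hβ : 0 ≤ β) (hc : Decay K β c) {A : ℝ}
    (hA : Real.exp (-A) ≤ ‖(npoly K c N).eval 0‖) {θ₀ : ℝ} {J : ℕ}
    (hm : eps K ^ (2 + β) * (rho0 K / 2 ^ J) ^ (-β) ≤ mass (npoly K c N) θ₀ (rho0 K / 2 ^ J)) :
    eps K / (2048 * (2 + β)) * ∑ i ∈ Finset.range J, (2 : ℝ) ^ (β / (2 + β) * (i + 1))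
      ≤ (2 * Real.pi * A) ^ (1 / (2 + β)) := by
  have hε0 := eps_pos hK
  have hq : 0 < 2 + β := by linarith
  have hρ0 := rho0_pos hK
  have hρ1 := rho0_le hK
  have hP1 := hc.norm_eval_npoly_le hK hβ N
  have hP0 : npoly K c N ≠ 0 := by
    intro h
    rw [h, eval_zero, norm_zero] at hA
    exact absurd hA (not_le.2 (Real.exp_pos _))
  set r := rho0 K / 2 ^ J with hr
  have hr0 : 0 < r := by positivity
  -- Telescoping of the additive growth, starting from the trivial bound 0 at the smallest scale.
  have key : ∀ j ≤ J, eps K / (2048 * (2 + β)) *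
      ∑ i ∈ Finset.range j, (2 ^ i * r) ^ (-(β / (2 + β)))
        ≤ mass (npoly K c N) θ₀ (2 ^ j * r) ^ (1 / (2 + β)) := by
    intro j
    induction j with
    | zero =>
      intro _
      simp only [Finset.range_zero, Finset.sum_empty, mul_zero]
      exact Real.rpow_nonneg (mass_nonneg hP1 θ₀ (by positivity)) _
    | succ j ih =>
      intro hj
      have hj' : (1 : ℝ) ≤ 2 ^ j := one_le_pow₀ (by norm_num)
      have hle : 2 ^ j * r ≤ rho0 K := by
        rw [hr, mul_div_assoc', div_le_iff₀ (by positivity), mul_comm]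
        gcongr
        · norm_num
        · omega
      -- The threshold does not increase with the scale and the mass does not decrease, so the
      -- condition at the smallest scale persists.
      have hmj : eps K ^ (2 + β) * (2 ^ j * r) ^ (-β) ≤ mass (npoly K c N) θ₀ (2 ^ j * r) := by
        calc eps K ^ (2 + β) * (2 ^ j * r) ^ (-β) ≤ eps K ^ (2 + β) * r ^ (-β) := by
              gcongr ?_ * ?_
              apply Real.rpow_le_rpow_of_nonpos hr0 _ (by linarith)
              nlinarith
          _ ≤ _ := hm
          _ ≤ _ := mass_mono hP1 θ₀ hr0.le (by nlinarith)
      have h1 := hc.mass_rpow_two_mul hK hβ hP0 (by positivity) hle hmj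
      have h2 := ih (by omega)
      rw [Finset.sum_range_succ, mul_add]
      have e : 2 ^ (j + 1) * r = 2 * (2 ^ j * r) := by ring
      rw [e]
      linarith
  have h1 := key J le_rfl
  have e1 : 2 ^ J * r = rho0 K := by
    rw [hr]
    field_simp
  rw [e1] at h1
  have h2 := mass_le hP1 hA θ₀ hρ0.le (by linarith [Real.pi_gt_three])
  have h3 : mass (npoly K c N) θ₀ (rho0 K) ^ (1 / (2 + β)) ≤ (2 * Real.pi * A) ^ (1 / (2 + β)) :=
    Real.rpow_le_rpow (mass_nonneg hP1 θ₀ hρ0.le) h2 (by positivity)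
  refine le_trans ?_ (h1.trans h3)
  gcongr ?_ * ?_
  -- The scales are now counted downwards from `rho0`, whose own nonpositive power is at least 1 and
  -- is dropped.
  rw [← Finset.sum_range_reflect]
  refine Finset.sum_le_sum fun i hi => ?_
  have hi' := Finset.mem_range.1 hi
  have e2 : (((J - 1 - i : ℕ) : ℝ) + 1) = J - i := by
    have : J - 1 - i + 1 = J - i := by omega
    rw [← Nat.cast_add_one, this, Nat.cast_sub hi'.le]
  have e3 : (2 : ℝ) ^ (β / (2 + β) * ((J : ℝ) - i)) = (2 ^ i / 2 ^ J) ^ (-(β / (2 + β))) := by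
    rw [← Real.rpow_natCast, ← Real.rpow_natCast, ← Real.rpow_sub (by norm_num),
      ← Real.rpow_mul (by norm_num)]
    congr 1
    ring
  rw [e2, e3]
  apply Real.rpow_le_rpow_of_nonpos (by positivity)
  · rw [hr, ← mul_div_assoc]
    gcongr
    exact mul_le_of_le_one_right (by positivity) (by linarith)
  · have : 0 ≤ β / (2 + β) := by positivity
    linarith

end

end Gevrey

namespace Gevrey

open MeasureTheory Polynomial

/-! ### Counting the zeros -/

lemma exists_sub_multiset {α : Type*} (Z : Multiset α) {n : ℕ} (hn : n ≤ Multiset.card Z) :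
    ∃ Z' ≤ Z, Multiset.card Z' = n := by
  induction Z using Quotient.inductionOn with
  | h l =>
    refine ⟨((l.take n : List α) : Multiset α), ?_, ?_⟩
    · exact Multiset.coe_le.2 (List.take_sublist n l).subperm
    · simpa using hn

lemma Rapid.exists_part_close {c : ℕ → ℂ} (hc : Rapid c) {δ : ℝ} (hδ : 0 < δ) :
    ∃ N, 1 ≤ N ∧ ∀ z : ℂ, ‖z‖ ≤ 1 → ‖part c N z - psum c z‖ ≤ δ := by
  have h1 := tendsto_sum_nat_add fun k => ‖c k‖
  obtain ⟨N, hN1, hN2⟩ := ((h1.eventually_lt_const hδ).and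
    (Filter.eventually_ge_atTop 1)).exists
  refine ⟨N, hN2, fun z hz => ?_⟩
  have h2 := (hc.summable hz).sum_add_tsum_nat_add N
  rw [part, psum, ← h2, sub_add_cancel_left, norm_neg]
  refine (tsum_of_norm_bounded ((summable_nat_add_iff N).2 hc.summable_norm).hasSum
    fun k => ?_).trans hN1.le
  exact norm_mul_pow_le c hz (k + N)

section

variable {K β : ℝ} {c : ℕ → ℂ}

lemma Decay.exp_le_norm_npoly (hK : 1 ≤ K) {A : ℝ} (hA : Real.exp (-A) ≤ ‖c 0‖) {N : ℕ}
    (hN : 1 ≤ N) : Real.exp (-(A + Real.log (supBound K))) ≤ ‖(npoly K c N).eval 0‖ := by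
  have hS := one_le_supBound hK
  have h0 : part c N 0 = c 0 := by
    rw [part, Finset.sum_eq_single_of_mem 0 (Finset.mem_range.2 (by omega))]
    · simp
    · intro k _ hk
      simp [hk]
  rw [norm_eval_npoly hK, h0, neg_add, Real.exp_add, Real.exp_neg (Real.log _),
    Real.exp_log (by linarith), ← div_eq_mul_inv]
  gcongr

/-- Smallness of the function gives a lower bound for `logInv`. -/
lemma le_logInv_of_norm_psum_le (hK : 1 ≤ K) {N : ℕ} {θ n : ℝ}
    (hψ : ‖psum c (circleMap 0 1 θ)‖ ≤ supBound K * Real.exp (-n))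
    (hclose : ‖part c N (circleMap 0 1 θ) - psum c (circleMap 0 1 θ)‖
      ≤ supBound K * Real.exp (-n))
    (hne : (npoly K c N).eval (circleMap 0 1 θ) ≠ 0) :
    n - Real.log 2 ≤ logInv (npoly K c N) θ := by
  have hS := one_le_supBound hK
  have h1 : ‖part c N (circleMap 0 1 θ)‖ ≤ 2 * Real.exp (-n) * supBound K := by
    calc _ = ‖(part c N (circleMap 0 1 θ) - psum c (circleMap 0 1 θ))
          + psum c (circleMap 0 1 θ)‖ := by rw [sub_add_cancel]
      _ ≤ _ := norm_add_le _ _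
      _ ≤ _ := by linarith
  have h2 : ‖(npoly K c N).eval (circleMap 0 1 θ)‖ ≤ 2 * Real.exp (-n) := by
    rw [norm_eval_npoly hK, div_le_iff₀ (by linarith)]
    exact h1
  have h3 := Real.log_le_log (norm_pos_iff.2 hne) h2
  rw [Real.log_mul (by norm_num) (Real.exp_pos _).ne', Real.log_exp] at h3
  rw [logInv]
  linarith

lemma norm_circleMap_sub_le (θ θ' : ℝ) : ‖circleMap 0 1 θ - circleMap 0 1 θ'‖ ≤ |θ - θ'| := by
  have := (lipschitzWith_circleMap 0 1).dist_le_mul θ θ'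
  simpa [dist_eq_norm, Real.dist_eq] using this

lemma log_two_le : Real.log 2 ≤ 3 / 4 := by
  linarith [Real.log_two_lt_d9]

/-- The number of zeros in small neighbourhoods of boundary points is under control. -/
lemma Decay.card_lt_of_near (hK : 1 ≤ K) (hβ : 0 ≤ β) (hc : Decay K β c) {A : ℝ}
    (hA : Real.exp (-A) ≤ ‖c 0‖) {J : ℕ}
    (hJ : (2 * Real.pi * (A + Real.log (supBound K))) ^ (1 / (2 + β)) <
      eps K / (2048 * (2 + β)) * ∑ i ∈ Finset.range J, (2 : ℝ) ^ (β / (2 + β) * (i + 1)))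
    {Z : Multiset ℂ} (hZ : ZerosOf c Z) {θ₀ : ℝ}
    (hθ : ∀ z ∈ Z, ‖circleMap 0 1 θ₀ - z‖ ≤ rho0 K / 2 ^ J) :
    (Multiset.card Z : ℝ) ≤ (256 * K ^ 2 * (rho0 K / 2 ^ J)) ^ (-(1 + β)) := by
  have hK0 : 0 < K := by linarith
  have hε0 := eps_pos hK
  have hε1 := eps_le' hK
  have hρ0 := rho0_pos hK
  set r := rho0 K / 2 ^ J with hr
  have hr0 : 0 < r := by positivity
  have hrρ : r ≤ rho0 K := div_le_self hρ0.le (one_le_pow₀ (by norm_num))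
  have hεK : eps K * (256 * K ^ 2) = 1 / 8 := by
    unfold eps
    field_simp
    norm_num
  have hr1 : 256 * K ^ 2 * r ≤ 1 := by
    calc 256 * K ^ 2 * r ≤ 256 * K ^ 2 * (eps K ^ 2 / 4096) := by gcongr; exact hrρ
      _ = eps K * (256 * K ^ 2) * (eps K / 4096) := by ring
      _ ≤ 1 := by rw [hεK]; linarith
  set X := (256 * K ^ 2 * r) ^ (-(1 + β)) with hX
  have hX1 : 1 ≤ X := Real.one_le_rpow_of_pos_of_le_one_of_nonpos (by positivity) hr1 (by linarith)
  by_contra! hcon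
  -- The smallness e^(-n) is available only up to the threshold `X`, so just this many zeros of the
  -- cluster are kept.
  set n := ⌊X⌋₊ with hn
  have hnX : (n : ℝ) ≤ X := Nat.floor_le (by linarith)
  have hn1 : 1 ≤ n := Nat.le_floor (by simpa using hX1)
  have hn1' : (1 : ℝ) ≤ n := by exact_mod_cast hn1
  have hnX2 : X / 2 ≤ n := by
    have := Nat.lt_floor_add_one X
    linarith
  have hnZ : n ≤ Multiset.card Z := by
    have : (n : ℝ) ≤ Multiset.card Z := hnX.trans hcon.le
    exact_mod_cast this
  obtain ⟨Z', hZ', hcard⟩ := exists_sub_multiset Z hnZ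
  have hS := one_le_supBound hK
  -- The degree is chosen after `n`, so that the polynomial is as small as the function; no later
  -- bound depends on it.
  obtain ⟨N, hN1, hN⟩ := (hc.rapid hK hβ).exists_part_close
    (δ := supBound K * Real.exp (-n)) (by positivity)
  set P := npoly K c N with hP
  have hA' := Decay.exp_le_norm_npoly hK hA hN1
  have hP0 : P ≠ 0 := by
    intro h
    rw [← hP, h, eval_zero, norm_zero] at hA'
    exact absurd hA' (not_le.2 (Real.exp_pos _))
  -- On the whole arc logInv ≥ n - log 2 ≥ n/4, because n ≥ 1 and log 2 ≤ 3/4.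
  have hmass : r * n / 2 ≤ mass P θ₀ r := by
    have h1 : ∫ _ in (θ₀ - r)..(θ₀ + r), (n / 4 : ℝ) = r * n / 2 := by
      rw [intervalIntegral.integral_const, smul_eq_mul]
      ring
    rw [← h1, mass]
    apply intervalIntegral.integral_mono_ae_restrict (by linarith) (by simp)
      (intervalIntegrable_logInv P _ _)
    have hae := ae_restrict_of_ae (s := Set.Icc (θ₀ - r) (θ₀ + r)) (ae_eval_circleMap_ne_zero hP0)
    filter_upwards [hae, ae_restrict_mem measurableSet_Icc] with θ hne hθI
    have hw := (norm_circleMap_zero_one θ).le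
    have hsmall := hc.norm_psum_le_exp hK hβ (hZ.mono hZ') hr0 hw (fun z hz => ?_)
      (by rw [hcard]; exact hnX)
    · rw [hcard] at hsmall
      have := le_logInv_of_norm_psum_le hK hsmall (hN _ hw) hne
      have := log_two_le
      linarith
    · have h2 := norm_circleMap_sub_le θ θ₀
      have h3 : |θ - θ₀| ≤ r := abs_le.2 ⟨by linarith [hθI.1], by linarith [hθI.2]⟩
      have h4 := hθ z (Multiset.mem_of_le hZ' hz)
      calc ‖circleMap 0 1 θ - z‖
          = ‖(circleMap 0 1 θ - circleMap 0 1 θ₀) + (circleMap 0 1 θ₀ - z)‖ := by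
            rw [sub_add_sub_cancel]
        _ ≤ _ := norm_add_le _ _
        _ ≤ 2 * r := by linarith
  have hbig : eps K ^ (2 + β) * r ^ (-β) ≤ mass P θ₀ r := by
    refine le_trans ?_ hmass
    -- The value of `eps` is chosen for this: the crowding threshold has to produce enough mass to
    -- start the growth. The factor 1/4 comes from n ≥ X/2 and from the 1/2 in the mass.
    have h1 : eps K ^ (2 + β) ≤ 1 / 4 * (256 * K ^ 2) ^ (-(1 + β)) := by
      have e : eps K ^ (2 + β) = eps K * eps K ^ (1 + β) := by
        nth_rw 2 [← Real.rpow_one (eps K)]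
        rw [← Real.rpow_add hε0]
        congr 1
        ring
      have h2 : eps K ≤ (256 * K ^ 2)⁻¹ := by
        rw [← one_div, le_div_iff₀ (by positivity), hεK]
        norm_num
      rw [e, Real.rpow_neg (by positivity), ← Real.inv_rpow (by positivity)]
      gcongr
      linarith
    have h3 : X = (256 * K ^ 2) ^ (-(1 + β)) * r ^ (-(1 + β)) :=
      Real.mul_rpow (by positivity) hr0.le
    have h4 : r ^ (-β) = r * r ^ (-(1 + β)) := by
      nth_rw 2 [← Real.rpow_one r]
      rw [← Real.rpow_add hr0]
      congr 1
      ring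
    calc eps K ^ (2 + β) * r ^ (-β) ≤ 1 / 4 * (256 * K ^ 2) ^ (-(1 + β)) * r ^ (-β) := by
          gcongr
      _ = r * (X / 2) / 2 := by
          rw [h3, h4]
          ring
      _ ≤ _ := by gcongr
  exact absurd (hc.sum_le_of_mass hK hβ hA' hbig) (not_le.2 hJ)

/-! ### Averaging the local number of zeros over the circle -/

lemma measurable_countP (Z : Multiset ℂ) (r : ℝ) :
    Measurable fun θ : ℝ => (Z.countP (fun z => ‖circleMap 0 1 θ - z‖ ≤ r) : ℝ) := by
  induction Z using Multiset.induction with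
  | empty => simp
  | cons a Z ih =>
    simp only [Multiset.countP_cons, Nat.cast_add]
    refine ih.add ?_
    have : MeasurableSet {θ : ℝ | ‖circleMap 0 1 θ - a‖ ≤ r} :=
      measurableSet_le (by fun_prop) measurable_const
    simp only [Nat.cast_ite, Nat.cast_one, Nat.cast_zero]
    exact Measurable.ite this measurable_const measurable_const

lemma intervalIntegrable_countP (Z : Multiset ℂ) (r a b : ℝ) :
    IntervalIntegrable (fun θ : ℝ => (Z.countP (fun z => ‖circleMap 0 1 θ - z‖ ≤ r) : ℝ))
      volume a b := by
  refine (intervalIntegrable_const (c := (Multiset.card Z : ℝ))).mono_fun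
    (measurable_countP Z r).aestronglyMeasurable (Filter.Eventually.of_forall fun θ => ?_)
  simp only [Real.norm_natCast]
  exact_mod_cast Multiset.countP_le_card _ _

/-- The zero is within r/2 of its radial projection, hence within r of all points of the circle
whose angle differs from its argument by at most r/2. -/
lemma half_le_integral_ite {z : ℂ} {r : ℝ} (hr0 : 0 < r) (hr1 : r ≤ 1) (hz : ‖z‖ ≤ 1)
    (hzr : 1 - r / 2 ≤ ‖z‖) :
    r / 2 ≤ ∫ θ in (0 - Real.pi)..(0 + Real.pi),
      ((Multiset.countP (fun z => ‖circleMap 0 1 θ - z‖ ≤ r) {z} : ℕ) : ℝ) := by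
  have hpi := Real.pi_gt_three
  set φ := Complex.arg z with hφ
  have hφ1 := Complex.neg_pi_lt_arg z
  have hφ2 := Complex.arg_le_pi z
  rw [← hφ] at hφ1 hφ2
  have hzφ : ‖circleMap 0 1 φ - z‖ ≤ r / 2 := by
    have h1 : circleMap 0 1 φ - z = (1 - ‖z‖ : ℝ) * circleMap 0 1 φ := by
      have h2 := Complex.norm_mul_exp_arg_mul_I z
      rw [← hφ] at h2
      have h3 : circleMap 0 1 φ = Complex.exp (φ * Complex.I) := by simp [circleMap]
      rw [h3]
      nth_rw 1 [← h2]
      push_cast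
      ring
    rw [h1, norm_mul, norm_circleMap_zero_one, mul_one, Complex.norm_real,
      Real.norm_of_nonneg (by linarith)]
    linarith
  have hnear : ∀ θ, |θ - φ| ≤ r / 2 →
      ((Multiset.countP (fun z => ‖circleMap 0 1 θ - z‖ ≤ r) {z} : ℕ) : ℝ) = 1 := by
    intro θ hθ
    have : ‖circleMap 0 1 θ - z‖ ≤ r := by
      have h2 := norm_circleMap_sub_le θ φ
      calc ‖circleMap 0 1 θ - z‖ = ‖(circleMap 0 1 θ - circleMap 0 1 φ) + (circleMap 0 1 φ - z)‖ := by
            rw [sub_add_sub_cancel]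
        _ ≤ _ := norm_add_le _ _
        _ ≤ _ := by linarith
    rw [← Multiset.cons_zero,
      Multiset.countP_cons_of_pos (p := fun z => ‖circleMap 0 1 θ - z‖ ≤ r) _ this]
    simp
  -- Only the half of the arc on the side of angle 0 is used, since the other half may cross the cut
  -- at ±π.
  obtain ⟨x, hx1, hx2, hx3⟩ : ∃ x, 0 - Real.pi ≤ x ∧ x + r / 2 ≤ 0 + Real.pi ∧
      ∀ θ ∈ Set.Icc x (x + r / 2), |θ - φ| ≤ r / 2 := by
    rcases le_total 0 φ with h | h
    · exact ⟨φ - r / 2, by linarith, by linarith, fun θ hθ =>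
        abs_le.2 ⟨by linarith [hθ.1], by linarith [hθ.2]⟩⟩
    · exact ⟨φ, by linarith, by linarith, fun θ hθ =>
        abs_le.2 ⟨by linarith [hθ.1], by linarith [hθ.2]⟩⟩
  calc r / 2 = ∫ _ in x..(x + r / 2), (1 : ℝ) := by
        rw [intervalIntegral.integral_const, smul_eq_mul]
        ring
    _ = ∫ θ in x..(x + r / 2),
          ((Multiset.countP (fun z => ‖circleMap 0 1 θ - z‖ ≤ r) {z} : ℕ) : ℝ) := by
        apply intervalIntegral.integral_congr
        intro θ hθ
        rw [Set.uIcc_of_le (by linarith)] at hθ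
        exact (hnear θ (hx3 θ hθ)).symm
    _ ≤ _ := by
        apply intervalIntegral.integral_mono_interval hx1 (by linarith) hx2
          (Filter.Eventually.of_forall fun θ => Nat.cast_nonneg _) (intervalIntegrable_countP _ _ _ _)

lemma card_le_integral_countP {Z : Multiset ℂ} {r : ℝ} (hr0 : 0 < r) (hr1 : r ≤ 1)
    (hZ : ∀ z ∈ Z, ‖z‖ ≤ 1 ∧ 1 - r / 2 ≤ ‖z‖) :
    r / 2 * Multiset.card Z ≤ ∫ θ in (0 - Real.pi)..(0 + Real.pi),
      (Z.countP (fun z => ‖circleMap 0 1 θ - z‖ ≤ r) : ℝ) := by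
  induction Z using Multiset.induction with
  | empty => simp
  | cons a Z ih =>
    have h1 := ih fun z hz => hZ z (Multiset.mem_cons_of_mem hz)
    have ha := hZ a (Multiset.mem_cons_self a Z)
    have h2 := half_le_integral_ite hr0 hr1 ha.1 ha.2
    have h3 : ∫ θ in (0 - Real.pi)..(0 + Real.pi),
        (((a ::ₘ Z).countP (fun z => ‖circleMap 0 1 θ - z‖ ≤ r) : ℕ) : ℝ)
        = (∫ θ in (0 - Real.pi)..(0 + Real.pi),
            ((Multiset.countP (fun z => ‖circleMap 0 1 θ - z‖ ≤ r) {a} : ℕ) : ℝ))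
          + ∫ θ in (0 - Real.pi)..(0 + Real.pi),
            (Z.countP (fun z => ‖circleMap 0 1 θ - z‖ ≤ r) : ℝ) := by
      rw [← intervalIntegral.integral_add (intervalIntegrable_countP _ _ _ _)
        (intervalIntegrable_countP _ _ _ _)]
      congr 1
      ext θ
      rw [← Multiset.singleton_add, Multiset.countP_add, Nat.cast_add]
    rw [h3, Multiset.card_cons]
    push_cast
    linarith

/-- The number of zeros close to the unit circle. -/
lemma Decay.card_shallow_le (hK : 1 ≤ K) (hβ : 0 ≤ β) (hc : Decay K β c) {A : ℝ}
    (hA : Real.exp (-A) ≤ ‖c 0‖) {J : ℕ}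
    (hJ : (2 * Real.pi * (A + Real.log (supBound K))) ^ (1 / (2 + β)) <
      eps K / (2048 * (2 + β)) * ∑ i ∈ Finset.range J, (2 : ℝ) ^ (β / (2 + β) * (i + 1)))
    {Z : Multiset ℂ} (hZ : ZerosOf c Z)
    (hsh : ∀ z ∈ Z, 1 - rho0 K / 2 ^ J / 2 ≤ ‖z‖) :
    rho0 K / 2 ^ J / 2 * Multiset.card Z
      ≤ 2 * Real.pi * (A + Real.log (supBound K)) + 2 * Real.pi := by
  have hρ0 := rho0_pos hK
  have hρ1 := rho0_le hK
  set r := rho0 K / 2 ^ J with hr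
  have hr0 : 0 < r := by positivity
  have hrρ : r ≤ rho0 K := div_le_self hρ0.le (one_le_pow₀ (by norm_num))
  have hS := one_le_supBound hK
  have hpi := Real.pi_pos
  obtain ⟨N, hN1, hN⟩ := (hc.rapid hK hβ).exists_part_close
    (δ := supBound K * Real.exp (-(Multiset.card Z : ℝ))) (by positivity)
  set P := npoly K c N with hP
  have hA' := Decay.exp_le_norm_npoly hK hA hN1
  have hP0 : P ≠ 0 := by
    intro h
    rw [← hP, h, eval_zero, norm_zero] at hA'
    exact absurd hA' (not_le.2 (Real.exp_pos _))
  have h1 := mass_le (hc.norm_eval_npoly_le hK hβ N) hA' 0 hpi.le le_rfl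
  have h2 := card_le_integral_countP hr0 (by linarith)
    (fun z hz => ⟨mem_closedDisc.1 (hZ.1 z hz), hsh z hz⟩)
  -- No point of the circle is crowded at scale r, so outside finitely many points logInv is at
  -- least the local count minus log 2. Approximation up to e^(-|Z|) suffices for all these counts
  -- at once.
  have h3 : ∫ θ in (0 - Real.pi)..(0 + Real.pi),
      ((Z.countP (fun z => ‖circleMap 0 1 θ - z‖ ≤ r) : ℝ) - 1) ≤ mass P 0 Real.pi := by
    rw [mass]
    apply intervalIntegral.integral_mono_ae_restrict (by linarith)
      ((intervalIntegrable_countP _ _ _ _).sub (by simp)) (intervalIntegrable_logInv P _ _)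
    have hae := ae_restrict_of_ae (s := Set.Icc (0 - Real.pi) (0 + Real.pi))
      (ae_eval_circleMap_ne_zero hP0)
    filter_upwards [hae] with θ hne
    have hw := (norm_circleMap_zero_one θ).le
    set Y := Z.filter fun z => ‖circleMap 0 1 θ - z‖ ≤ r with hY
    have hYZ : ZerosOf c Y := hZ.mono (Multiset.filter_le _ _)
    have hYr : ∀ z ∈ Y, ‖circleMap 0 1 θ - z‖ ≤ r := fun z hz => (Multiset.mem_filter.1 hz).2
    have hcardY := hc.card_lt_of_near hK hβ hA hJ hYZ hYr
    have hsmall := hc.norm_psum_le_exp hK hβ hYZ hr0 hw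
      (fun z hz => (hYr z hz).trans (by linarith)) hcardY
    have hle : (Multiset.card Y : ℝ) ≤ Multiset.card Z := by
      exact_mod_cast Multiset.card_le_card (Multiset.filter_le _ _)
    have := le_logInv_of_norm_psum_le hK hsmall ((hN _ hw).trans (by gcongr)) hne
    rw [Multiset.countP_eq_card_filter]
    have := log_two_le
    linarith
  rw [intervalIntegral.integral_sub (intervalIntegrable_countP _ _ _ _) (by simp),
    intervalIntegral.integral_const, smul_eq_mul] at h3
  linarith

/-- The number of zeros at a positive distance from the unit circle. -/
lemma Decay.card_deep_le (hK : 1 ≤ K) (hβ : 0 ≤ β) (hc : Decay K β c) {A r : ℝ}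
    (hA : Real.exp (-A) ≤ ‖c 0‖) {Z : Multiset ℂ} (hZ : ZerosOf c Z)
    (hd : ∀ z ∈ Z, ‖z‖ ≤ 1 - r) :
    r * Multiset.card Z ≤ A + Real.log (supBound K) := by
  have hS := one_le_supBound hK
  have h1 := hZ.norm_psum_zero_le (hc.rapid hK hβ) fun w hw => hc.norm_psum_le hK hβ hw
  rw [psum_zero] at h1
  have h2 : (Z.map fun z => ‖z‖).prod ≤ Real.exp (-r) ^ Multiset.card Z := by
    apply multiset_prod_le_pow _ _ _ fun z _ => norm_nonneg z
    intro z hz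
    have := hd z hz
    linarith [Real.add_one_le_exp (-r)]
  have h3 : Real.exp (-A) ≤ Real.exp (Real.log (supBound K) - r * Multiset.card Z) := by
    refine hA.trans (h1.trans ?_)
    rw [sub_eq_add_neg, Real.exp_add, Real.exp_log (by linarith)]
    gcongr
    refine h2.trans_eq ?_
    rw [← Real.exp_nat_mul]
    congr 1
    ring
  have := Real.exp_le_exp.1 h3
  linarith

/-- The bound for the number of all zeros. -/
lemma Decay.card_le (hK : 1 ≤ K) (hβ : 0 ≤ β) (hc : Decay K β c) {A : ℝ} (hA1 : 1 ≤ A)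
    (hA : Real.exp (-A) ≤ ‖c 0‖) {J : ℕ}
    (hJ : (2 * Real.pi * (A + Real.log (supBound K))) ^ (1 / (2 + β)) <
      eps K / (2048 * (2 + β)) * ∑ i ∈ Finset.range J, (2 : ℝ) ^ (β / (2 + β) * (i + 1)))
    {Z : Multiset ℂ} (hZ : ZerosOf c Z) :
    (Multiset.card Z : ℝ) ≤ 40 * (1 + Real.log (supBound K)) / rho0 K * A * 2 ^ J := by
  classical
  have hρ0 := rho0_pos hK
  have hS := one_le_supBound hK
  have hl : 0 ≤ Real.log (supBound K) := Real.log_nonneg hS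
  set l := Real.log (supBound K)
  set r := rho0 K / 2 ^ J with hr
  have hr0 : 0 < r := by positivity
  have hpi4 := Real.pi_lt_four
  set Zs := Z.filter fun z => 1 - r / 2 ≤ ‖z‖ with hZs
  set Zd := Z.filter fun z => ¬ 1 - r / 2 ≤ ‖z‖ with hZd
  have h1 := hc.card_shallow_le hK hβ hA hJ (hZ.mono (Multiset.filter_le _ _) : ZerosOf c Zs)
    fun z hz => (Multiset.mem_filter.1 hz).2
  have h2 := hc.card_deep_le hK hβ (r := r / 2) hA
    (hZ.mono (Multiset.filter_le _ _) : ZerosOf c Zd)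
    fun z hz => (not_le.1 (Multiset.mem_filter.1 hz).2).le
  have h3 : (Multiset.card Z : ℝ) = Multiset.card Zs + Multiset.card Zd := by
    rw [← Nat.cast_add, ← Multiset.card_add, hZs, hZd, Multiset.filter_add_not]
  have h4 : r / 2 * (Multiset.card Z : ℝ) ≤ 20 * (1 + l) * A := by
    rw [h3, mul_add]
    have h5 : 2 * Real.pi * (A + l) + 2 * Real.pi ≤ 8 * (A + l) + 8 := by nlinarith
    nlinarith
  have e : 40 * (1 + l) / rho0 K * A * 2 ^ J = 20 * (1 + l) * A / (r / 2) := by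
    rw [hr]
    field_simp
    norm_num
  rw [e, le_div_iff₀ (by positivity)]
  linarith

end

end Gevrey

/-! ### The number of dyadic scales -/

namespace Gevrey

lemma ClassAComparable.mono {K K' β : ℝ} {f : ℂ → ℂ} (hK : 0 < K) (h : K ≤ K')
    (hf : ClassAComparable K β f) : ClassAComparable K' β f := by
  have hsub : Set.Icc K⁻¹ K ⊆ Set.Icc K'⁻¹ K' := Set.Icc_subset_Icc (by gcongr) h
  obtain ⟨a, ha, a', ha', hf⟩ := hf
  exact ⟨a, hsub ha, a', hsub ha', hf⟩

lemma ClassCComparable.mono {K K' β : ℝ} {f : ℂ → ℂ} (hK : 0 < K) (h : K ≤ K')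
    (hf : ClassCComparable K β f) : ClassCComparable K' β f := by
  have hsub : Set.Icc K⁻¹ K ⊆ Set.Icc K'⁻¹ K' := Set.Icc_subset_Icc (by gcongr) h
  obtain ⟨a, ha, a', ha', hf⟩ := hf
  exact ⟨a, hsub ha, a', hsub ha', hf⟩

/-- The number of zeros is controlled by a number `n` of dyadic scales. -/
lemma exists_scales_bound {K β₀ : ℝ} (hK : 1 ≤ K) (hβ₀ : 0 ≤ β₀) : ∃ C : ℝ, 1 ≤ C ∧
    ∀ β : ℝ, 0 ≤ β → β ≤ β₀ → ∀ c : ℕ → ℂ, Decay K β c → ∀ A : ℝ, 1 ≤ A →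
    Real.exp (-A) ≤ ‖c 0‖ → ∃ n : ℕ,
    ∑ i ∈ Finset.range n, (2 : ℝ) ^ (β / (2 + β) * (i + 1)) ≤ C * A ^ (1 / (2 + β)) ∧
    ∀ Z, ZerosOf c Z → (Multiset.card Z : ℝ) ≤ C * A * 2 ^ n := by
  have hρ0 := rho0_pos hK
  have hε := eps_pos hK
  have hl : 0 ≤ Real.log (supBound K) := Real.log_nonneg (one_le_supBound hK)
  have hpi := Real.pi_gt_three
  set l := Real.log (supBound K) with hl'
  set C₁ := 2 * Real.pi * (1 + l) with hC₁
  have hC₁1 : 1 ≤ C₁ := by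
    rw [hC₁]
    nlinarith
  set C₂ := C₁ * (2048 * (2 + β₀)) / eps K with hC₂
  set C₃ := 80 * (1 + l) / rho0 K with hC₃
  have hC₂0 : 0 ≤ C₂ := by positivity
  have hC₃0 : 0 ≤ C₃ := by positivity
  refine ⟨1 + C₂ + C₃, by linarith, fun β hβ hββ₀ c hc A hA1 hA => ?_⟩
  have hq : 0 < 2 + β := by linarith
  set M := (2 * Real.pi * (A + l)) ^ (1 / (2 + β)) with hM
  have hMle : M ≤ C₁ * A ^ (1 / (2 + β)) := by
    have h1 : 2 * Real.pi * (A + l) ≤ C₁ * A := by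
      rw [hC₁, mul_assoc _ (1 + l)]
      refine mul_le_mul_of_nonneg_left ?_ (by positivity)
      nlinarith
    calc M ≤ (C₁ * A) ^ (1 / (2 + β)) := by
          rw [hM]
          gcongr
      _ = C₁ ^ (1 / (2 + β)) * A ^ (1 / (2 + β)) :=
          Real.mul_rpow (by linarith) (by linarith)
      _ ≤ _ := by
          gcongr
          refine Real.rpow_le_self_of_one_le hC₁1 ?_
          rw [div_le_one hq]
          linarith
  -- Every term of the sum is at least 1, so it is unbounded in J even for β = 0.
  have hex : ∃ J : ℕ, M < eps K / (2048 * (2 + β)) *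
      ∑ i ∈ Finset.range J, (2 : ℝ) ^ (β / (2 + β) * (i + 1)) := by
    obtain ⟨J, hJ⟩ := exists_nat_gt (M / (eps K / (2048 * (2 + β))))
    refine ⟨J, ?_⟩
    rw [div_lt_iff₀' (by positivity)] at hJ
    refine hJ.trans_le ?_
    gcongr
    calc (J : ℝ) = ∑ i ∈ Finset.range J, (1 : ℝ) := by simp
      _ ≤ _ := Finset.sum_le_sum fun i _ =>
          Real.one_le_rpow (by norm_num) (by positivity)
  classical
  have hJ := Nat.find_spec hex
  have hmin := fun n => Nat.find_min hex (m := n)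
  set J := Nat.find hex
  have hJ0 : J ≠ 0 := by
    intro h
    rw [h] at hJ
    simp only [Finset.range_zero, Finset.sum_empty, mul_zero] at hJ
    have : 0 ≤ M := by positivity
    linarith
  -- At n = J - 1 the inequality still fails, which bounds the sum from above. The factor 2^J =
  -- 2·2^n accounts for 80 in place of 40.
  obtain ⟨n, hn⟩ := Nat.exists_eq_succ_of_ne_zero hJ0
  refine ⟨n, ?_, fun Z hZ => ?_⟩
  · have h1 := not_lt.1 (hmin n (by omega))
    rw [← le_div_iff₀' (by positivity)] at h1
    refine h1.trans ?_
    calc M / (eps K / (2048 * (2 + β)))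
        ≤ C₁ * A ^ (1 / (2 + β)) / (eps K / (2048 * (2 + β₀))) := by gcongr
      _ = C₂ * A ^ (1 / (2 + β)) := by
          rw [hC₂]
          field_simp
      _ ≤ _ := by
          gcongr
          linarith
  · refine (hc.card_le hK hβ hA1 hA hJ hZ).trans ?_
    rw [hn, pow_succ]
    calc 40 * (1 + l) / rho0 K * A * (2 ^ n * 2) = C₃ * A * 2 ^ n := by
          rw [hC₃]
          ring
      _ ≤ _ := by
          gcongr
          linarith

/-! ### Explicit bounds from the number of scales -/

lemma mul_two_pow_le_exp_sqrt {C A β : ℝ} (hC : 1 ≤ C) (hA : 1 ≤ A) (hβ : 0 ≤ β) {n : ℕ}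
    (h : ∑ i ∈ Finset.range n, (2 : ℝ) ^ (β / (2 + β) * (i + 1)) ≤ C * A ^ (1 / (2 + β))) :
    C * A * 2 ^ n ≤ Real.exp ((2 * C + 2) * √A) := by
  have hs : 1 ≤ √A := Real.one_le_sqrt.2 hA
  have hn : (n : ℝ) ≤ C * √A := by
    calc (n : ℝ) = ∑ i ∈ Finset.range n, (1 : ℝ) := by simp
      _ ≤ ∑ i ∈ Finset.range n, (2 : ℝ) ^ (β / (2 + β) * (i + 1)) :=
          Finset.sum_le_sum fun i _ => Real.one_le_rpow (by norm_num) (by positivity)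
      _ ≤ C * A ^ (1 / (2 + β)) := h
      _ ≤ C * √A := by
          rw [Real.sqrt_eq_rpow]
          gcongr
          linarith
  have h1 : C ≤ Real.exp (C * √A) := by
    have := Real.add_one_le_exp (C * √A)
    nlinarith
  have h2 : A ≤ Real.exp (2 * √A) := by
    have h3 := Real.add_one_le_exp (√A)
    calc A = √A ^ 2 := (Real.sq_sqrt (by linarith)).symm
      _ ≤ Real.exp (√A) ^ 2 := by
          gcongr
          linarith
      _ = _ := by
          rw [← Real.exp_nat_mul]
          norm_num
  have h3 : (2 : ℝ) ^ n ≤ Real.exp (C * √A) := by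
    have h4 := Real.add_one_le_exp 1
    calc (2 : ℝ) ^ n ≤ Real.exp 1 ^ n := by
          gcongr
          linarith
      _ = Real.exp n := by rw [← Real.exp_nat_mul, mul_one]
      _ ≤ _ := Real.exp_le_exp.2 hn
  calc C * A * 2 ^ n ≤ Real.exp (C * √A) * Real.exp (2 * √A) * Real.exp (C * √A) := by gcongr
    _ = _ := by
        rw [← Real.exp_add, ← Real.exp_add]
        congr 1
        ring

/-- Each increment of 2^(sn) is 1 - 2^(-s) ≤ s times the new term, as log 2 < 1. This form of the
geometric sum keeps the factor s, and hence the powers of β. -/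
lemma two_rpow_sub_one_le {s : ℝ} (hs : 0 ≤ s) (n : ℕ) :
    (2 : ℝ) ^ (s * n) - 1 ≤ s * ∑ i ∈ Finset.range n, (2 : ℝ) ^ (s * (i + 1)) := by
  induction n with
  | zero => simp
  | succ n ih =>
    rw [Finset.sum_range_succ, mul_add]
    push_cast
    have h1 : (2 : ℝ) ^ (s * n) = 2 ^ (-s) * 2 ^ (s * (n + 1)) := by
      rw [← Real.rpow_add (by norm_num)]
      congr 1
      ring
    have h2 : 1 - s ≤ (2 : ℝ) ^ (-s) := by
      rw [Real.rpow_def_of_pos (by norm_num)]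
      have h3 := Real.add_one_le_exp (Real.log 2 * -s)
      have h4 := Real.log_two_lt_d9
      nlinarith
    have h3 := mul_le_mul_of_nonneg_right h2 (by positivity : (0 : ℝ) ≤ 2 ^ (s * (n + 1)))
    rw [← h1] at h3
    linarith

/-- A logarithmic form of the bound for the number of scales. -/
lemma mul_log_two_le {C A β : ℝ} (hC : 1 ≤ C) (hA : 1 ≤ A) (hβ : 0 < β)
    (hAβ : 0 ≤ Real.log A + 2 * Real.log β) {n : ℕ}
    (h : ∑ i ∈ Finset.range n, (2 : ℝ) ^ (β / (2 + β) * (i + 1)) ≤ C * A ^ (1 / (2 + β))) :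
    β * (n * Real.log 2) ≤ (2 + β) * Real.log (Real.exp 1 + C) + (2 + β) * Real.log β
      + Real.log A := by
  have hA0 : 0 < A := by linarith
  have hq : 0 < 2 + β := by linarith
  have he := Real.exp_pos 1
  set T := β * A ^ (1 / (2 + β)) with hT
  have hT0 : 0 < T := by positivity
  have hlogT : Real.log T = Real.log β + Real.log A / (2 + β) := by
    rw [hT, Real.log_mul hβ.ne' (by positivity), Real.log_rpow hA0]
    ring
  -- This is where Aβ² ≥ 1 is needed, together with β log β ≥ β - 1. It lets a multiple of `T`
  -- absorb the 1 subtracted in the geometric sum.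
  have hT1 : 1 ≤ Real.exp 1 * T := by
    rw [← Real.log_nonneg_iff (by positivity), Real.log_mul he.ne' hT0.ne', Real.log_exp, hlogT]
    have h1 := Real.one_sub_inv_le_log_of_pos hβ
    have h2 : β - 1 ≤ β * Real.log β := by
      have := mul_le_mul_of_nonneg_left h1 hβ.le
      rwa [mul_sub, mul_one, mul_inv_cancel₀ hβ.ne'] at this
    have h3 : 1 + (Real.log β + Real.log A / (2 + β)) =
        ((2 + β) + (2 + β) * Real.log β + Real.log A) / (2 + β) := by
      field_simp
      ring
    rw [h3]
    refine div_nonneg ?_ hq.le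
    nlinarith
  have h1 : (2 : ℝ) ^ (β / (2 + β) * n) ≤ (Real.exp 1 + C) * T := by
    have h2 := two_rpow_sub_one_le (s := β / (2 + β)) (by positivity) n
    have h3 : β / (2 + β) * ∑ i ∈ Finset.range n, (2 : ℝ) ^ (β / (2 + β) * (i + 1))
        ≤ β * (C * A ^ (1 / (2 + β))) := by
      gcongr
      exact div_le_self hβ.le (by linarith)
    have h4 : β * (C * A ^ (1 / (2 + β))) = C * T := by
      rw [hT]
      ring
    linarith
  have h2 := Real.log_le_log (by positivity) h1
  rw [Real.log_rpow (by norm_num), Real.log_mul (by positivity) hT0.ne', hlogT] at h2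
  have h3 := mul_le_mul_of_nonneg_left h2 hq.le
  have h4 : (2 + β) * (β / (2 + β) * n * Real.log 2) = β * (n * Real.log 2) := by
    field_simp
  have h5 : (2 + β) * (Real.log (Real.exp 1 + C) + (Real.log β + Real.log A / (2 + β))) =
      (2 + β) * Real.log (Real.exp 1 + C) + (2 + β) * Real.log β + Real.log A := by
    field_simp
    ring
  linarith

/-- The constant in the exponent of the power bounds. -/
noncomputable def powConst (β₀ C : ℝ) : ℝ :=
  β₀ * Real.log C + (2 + β₀) * Real.log (Real.exp 1 + C) + 1 + 2 * β₀ + β₀ ^ 2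

lemma powConst_pos {β₀ C : ℝ} (hβ₀ : 0 < β₀) (hC : 1 ≤ C) : 0 < powConst β₀ C := by
  have he := Real.exp_pos 1
  have h1 := Real.log_nonneg hC
  have h2 : 0 ≤ Real.log (Real.exp 1 + C) := Real.log_nonneg (by linarith)
  unfold powConst
  positivity

lemma mul_two_pow_eq_exp {C A : ℝ} (hC : 0 < C) (hA : 0 < A) (n : ℕ) :
    C * A * 2 ^ n = Real.exp (Real.log C + Real.log A + n * Real.log 2) := by
  rw [Real.exp_add, Real.exp_add, Real.exp_log hC, Real.exp_log hA, Real.exp_nat_mul,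
    Real.exp_log (by norm_num)]

/-- The number of scales gives A^(1/β+1) β^(2/β+1) e^(c/β). The bound here has the further factor
(Aβ²)^(1/β) β, in which the power is at least 1 and β ≥ e^(1-1/β). -/
lemma mul_two_pow_le_of_sq {C A β β₀ : ℝ} (hC : 1 ≤ C) (hA : 1 ≤ A) (hβ : 0 < β) (hβ₀ : β ≤ β₀)
    (hAβ : 0 ≤ Real.log A + 2 * Real.log β) {n : ℕ}
    (h : ∑ i ∈ Finset.range n, (2 : ℝ) ^ (β / (2 + β) * (i + 1)) ≤ C * A ^ (1 / (2 + β))) :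
    C * A * 2 ^ n ≤ A ^ (2 / β + 1) * β ^ (4 / β + 2) * Real.exp (powConst β₀ C / β) := by
  have hA0 : 0 < A := by linarith
  have he := Real.exp_pos 1
  have h1 := mul_log_two_le hC hA hβ hAβ h
  have hD : 0 ≤ Real.log (Real.exp 1 + C) := Real.log_nonneg (by linarith)
  have hlC := Real.log_nonneg hC
  have hb : β - 1 ≤ β * Real.log β := by
    have := mul_le_mul_of_nonneg_left (Real.one_sub_inv_le_log_of_pos hβ) hβ.le
    rwa [mul_sub, mul_one, mul_inv_cancel₀ hβ.ne'] at this
  rw [mul_two_pow_eq_exp (by linarith) hA0, Real.rpow_def_of_pos hA0, Real.rpow_def_of_pos hβ,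
    ← Real.exp_add, ← Real.exp_add, Real.exp_le_exp]
  have e : Real.log A * (2 / β + 1) + Real.log β * (4 / β + 2) + powConst β₀ C / β =
      (Real.log A * (2 + β) + Real.log β * (4 + 2 * β) + powConst β₀ C) / β := by
    field_simp
  rw [e, le_div_iff₀ hβ, powConst]
  nlinarith [mul_le_mul_of_nonneg_right hβ₀ hlC, mul_le_mul_of_nonneg_right hβ₀ hD, sq_nonneg β₀]

/-- In A^(1/β+1) β^(2/β+1) e^(c/β) the power of β is at most e^(c'/β), since (2+β) log β is bounded
above for β ≤ β₀. -/
lemma mul_two_pow_le_of_fourth {C A β β₀ : ℝ} (hC : 1 ≤ C) (hA : 1 ≤ A) (hβ : 0 < β)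
    (hβ₀ : β ≤ β₀) (hAβ : 0 ≤ Real.log A + 2 * Real.log β) {n : ℕ}
    (h : ∑ i ∈ Finset.range n, (2 : ℝ) ^ (β / (2 + β) * (i + 1)) ≤ C * A ^ (1 / (2 + β))) :
    C * A * 2 ^ n ≤ A ^ (1 / β + 1) * Real.exp (powConst β₀ C / β) := by
  have hA0 : 0 < A := by linarith
  have he := Real.exp_pos 1
  have h1 := mul_log_two_le hC hA hβ hAβ h
  have hD : 0 ≤ Real.log (Real.exp 1 + C) := Real.log_nonneg (by linarith)
  have hlC := Real.log_nonneg hC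
  have hb : (2 + β) * Real.log β ≤ 2 * β₀ + β₀ ^ 2 := by
    have := mul_le_mul_of_nonneg_left (Real.log_le_sub_one_of_pos hβ) (by linarith : 0 ≤ 2 + β)
    nlinarith
  rw [mul_two_pow_eq_exp (by linarith) hA0, Real.rpow_def_of_pos hA0,
    ← Real.exp_add, Real.exp_le_exp]
  have e : Real.log A * (1 / β + 1) + powConst β₀ C / β =
      (Real.log A * (1 + β) + powConst β₀ C) / β := by
    field_simp
  rw [e, le_div_iff₀ hβ, powConst]
  nlinarith [mul_le_mul_of_nonneg_right hβ₀ hlC, mul_le_mul_of_nonneg_right hβ₀ hD]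

/-- The zero count of a function of either class is controlled by a number of dyadic scales. -/
lemma exists_zeroCount_bound {K β₀ : ℝ} (hK : 1 ≤ K) (hβ₀ : 0 ≤ β₀) : ∃ C : ℝ, 1 ≤ C ∧
    ∀ β : ℝ, 0 ≤ β → β ≤ β₀ → ∀ (f : ℂ → ℂ) (A : ℝ),
    (ClassAComparable K β f ∨ ClassCComparable K β f) → 1 ≤ A → Real.exp (-A) ≤ ‖f 0‖ →
    ∃ n : ℕ, ∑ i ∈ Finset.range n, (2 : ℝ) ^ (β / (2 + β) * (i + 1)) ≤ C * A ^ (1 / (2 + β)) ∧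
    zeroCount f ≤ ENNReal.ofReal (C * A * 2 ^ n) := by
  have hK0 : 0 < K := by linarith
  have hKK : K ≤ 4 * K ^ (1 + β₀) := by
    have := Real.self_le_rpow_of_one_le hK (by linarith : 1 ≤ 1 + β₀)
    linarith
  set K₁ := 4 * K ^ (1 + β₀) with hK₁
  have hK₁1 : 1 ≤ K₁ := hK.trans hKK
  obtain ⟨C, hC, hCb⟩ := exists_scales_bound hK₁1 hβ₀
  refine ⟨C, hC, fun β hβ hββ₀ f A hf hA1 hA => ?_⟩
  have hf' : ClassAComparable K₁ β f :=
    hf.elim (fun h => h.mono hK0 hKK) (classA_of_classC hβ hββ₀ hK)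
  obtain ⟨a, ⟨ha1, ha2⟩, a', ⟨ha1', ha2'⟩, hfA⟩ := hf'
  have ha0 : 0 < a := (inv_pos.2 (by linarith)).trans_le ha1
  have hdec : Decay K₁ β (taylorCoeff f) := fun k => (hfA.coeff_le k).trans (by gcongr)
  have h0 : f 0 = taylorCoeff f 0 := by simp [taylorCoeff]
  obtain ⟨n, hn, hZ⟩ := hCb β hβ hββ₀ _ hdec A hA1 (h0 ▸ hA)
  exact ⟨n, hn, zeroCount_le (hfA.rapid hβ ha0) (hfA.eqOn_psum hβ ha0) hZ⟩

end Gevrey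

/-! ### The theorem -/

theorem theorem1 (K : ℝ) (hK : 1 ≤ K) :
    -- the two descriptions of the class with parameters comparable to `1` are equivalent
    (∀ β₀ : ℝ, 0 < β₀ → ∃ K' : ℝ, 1 ≤ K' ∧ ∀ β : ℝ, 0 ≤ β → β ≤ β₀ → ∀ f : ℂ → ℂ,
      (Gevrey.ClassAComparable K β f → Gevrey.ClassCComparable K' β f) ∧
      (Gevrey.ClassCComparable K β f → Gevrey.ClassAComparable K' β f)) ∧
    -- the case `β = 0`
    (∃ c : ℝ, 0 < c ∧ ∀ (f : ℂ → ℂ) (A : ℝ),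
      (Gevrey.ClassAComparable K 0 f ∨ Gevrey.ClassCComparable K 0 f) →
      1 ≤ A → Real.exp (-A) ≤ ‖f 0‖ →
      Gevrey.zeroCount f ≤ ENNReal.ofReal (Real.exp (c * √A))) ∧
    -- the case `0 < β ≤ β₀`
    (∀ β₀ : ℝ, 0 < β₀ → ∃ c : ℝ, 0 < c ∧ ∀ β : ℝ, 0 < β → β ≤ β₀ → ∀ (f : ℂ → ℂ) (A : ℝ),
      (Gevrey.ClassAComparable K β f ∨ Gevrey.ClassCComparable K β f) →
      1 ≤ A → Real.exp (-A) ≤ ‖f 0‖ →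
      (A ≤ β ^ (-2 : ℤ) →
        Gevrey.zeroCount f ≤ ENNReal.ofReal (Real.exp (c * √A))) ∧
      (β ^ (-2 : ℤ) ≤ A → A ≤ β ^ (-4 : ℤ) →
        Gevrey.zeroCount f ≤
          ENNReal.ofReal (A ^ (2 / β + 1) * β ^ (4 / β + 2) * Real.exp (c / β))) ∧
      (β ^ (-4 : ℤ) ≤ A →
        Gevrey.zeroCount f ≤ ENNReal.ofReal (A ^ (1 / β + 1) * Real.exp (c / β)))) := by
  have hK0 : 0 < K := by linarith
  refine ⟨fun β₀ hβ₀ => ?_, ?_, fun β₀ hβ₀ => ?_⟩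
  · obtain ⟨K', hK', h⟩ := Gevrey.exists_classC_of_classA hK
    have hp : 0 < 4 * K ^ (1 + β₀) := by positivity
    refine ⟨K' + 4 * K ^ (1 + β₀), by linarith, fun β hβ hββ₀ f => ⟨fun hf => ?_, fun hf => ?_⟩⟩
    · exact (h β hβ f hf).mono (by linarith) (by linarith)
    · exact (Gevrey.classA_of_classC hβ hββ₀ hK hf).mono hp (by linarith)
  · obtain ⟨C, hC, h⟩ := Gevrey.exists_zeroCount_bound hK le_rfl
    refine ⟨2 * C + 2, by linarith, fun f A hf hA1 hA => ?_⟩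
    obtain ⟨n, hn, hN⟩ := h 0 le_rfl le_rfl f A hf hA1 hA
    exact hN.trans (ENNReal.ofReal_le_ofReal (Gevrey.mul_two_pow_le_exp_sqrt hC hA1 le_rfl hn))
  · obtain ⟨C, hC, h⟩ := Gevrey.exists_zeroCount_bound hK hβ₀.le
    have hP := Gevrey.powConst_pos hβ₀ hC
    set P := Gevrey.powConst β₀ C with hPdef
    refine ⟨2 * C + 2 + P, by linarith, fun β hβ hββ₀ f A hf hA1 hA => ?_⟩
    obtain ⟨n, hn, hN⟩ := h β hβ.le hββ₀ f A hf hA1 hA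
    have hle : Real.exp (P / β) ≤ Real.exp ((2 * C + 2 + P) / β) := by
      gcongr
      linarith
    have hL := Real.log_nonneg hA1
    refine ⟨fun _ => ?_, fun h2 _ => ?_, fun h4 => ?_⟩
    · refine hN.trans (ENNReal.ofReal_le_ofReal
        ((Gevrey.mul_two_pow_le_exp_sqrt hC hA1 hβ.le hn).trans
          (Real.exp_le_exp.2 (mul_le_mul_of_nonneg_right (by linarith) (Real.sqrt_nonneg A)))))
    · have h3 := Real.log_le_log (by positivity) h2
      rw [Real.log_zpow] at h3
      push_cast at h3
      refine hN.trans (ENNReal.ofReal_le_ofReal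
        ((Gevrey.mul_two_pow_le_of_sq hC hA1 hβ hββ₀ (by linarith) hn).trans ?_))
      gcongr
    -- The condition Aβ² ≥ 1 is the mean of log A ≥ 0 and log A + 4 log β ≥ 0.
    · have h3 := Real.log_le_log (by positivity) h4
      rw [Real.log_zpow] at h3
      push_cast at h3
      refine hN.trans (ENNReal.ofReal_le_ofReal
        ((Gevrey.mul_two_pow_le_of_fourth hC hA1 hβ hββ₀ (by linarith) hn).trans ?_))
      gcongr
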